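/- Let $\mathbb O=\mathbb H\oplus\mathbb H$ with product $(\alpha_1,\alpha_2)(\beta_1,\beta_2)=(\alpha_1\beta_1-\bar\beta_2\alpha_2,\ \beta_2\alpha_1+\alpha_2\bar\beta_1)$ be the octonions, with basis $e_0,\dots,e_7=(1,0),(i,0),(j,0),(k,0),(0,1),(0,i),(0,j),(0,k)$. Let $G_2=\mathrm{Aut}(\mathbb O)$ and $\mathfrak g_2=\mathrm{Der}(\mathbb O)$, both acting on $\langle e_1,\dots,e_7\rangle$ by $7\times7$ matrices, and let $(X,Y)=-\frac1{16}\,\mathrm{Kill}(X,Y)$ on $\mathfrak g_2$. Let $\mathbb H=\langle e_0,\dots,e_3\rangle$, let $so(4)\subset\mathfrak g_2$ be the Lie algebra of the stabilizer of $\mathbb H$, and let $\mathfrak m=so(4)^\perp$. Let $E_{pq}$ be the matrix units, $1\le p,q\le 7$, let $E[p,q]=E_{qp}-E_{pq}$, and let $C_1=E[4,7]+E[5,6]$, $C_2=E[5,7]-E[4,6]$, $C_3=E[4,5]+E[6,7]$, $C_4=-E[2,7]-E[3,6]$, $C_5=E[2,6]-E[3,7]$, $C_6=E[3,4]-E[2,5]$,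 $C_7=E[2,4]+E[3,5]$, and $\sqrt3C_8=2E[2,3]-E[4,5]+E[6,7]$, $\sqrt3C_9=2E[1,2]-E[4,7]+E[5,6]$, $\sqrt3C_{10}=2E[1,3]+E[4,6]+E[5,7]$, $\sqrt3C_{11}=2E[1,4]+E[2,7]-E[3,6]$, $\sqrt3C_{12}=2E[1,5]-E[2,6]-E[3,7]$, $\sqrt3C_{13}=2E[1,6]+E[2,5]+E[3,4]$, $\sqrt3C_{14}=2E[1,7]-E[2,4]+E[3,5]$. A *local parametrization* of the variety $\mathcal H$ of quaternionic subalgebras of $\mathbb O$ is the map $a\mapsto\varphi(a)\mathbb H$ given by a smooth map $\varphi:U\to G_2$, $U\subseteq\mathbb R^8$ open, such that $a\mapsto\varphi(a)\mathbb H$ is an immersion (that is, $\varphi^{-1}\partial_v\varphi\in so(4)$ only for $v=0$). The *induced metric* in these parameters is $g_{\mu\nu}=(\tilde J_\mu,\tilde J_\nu)$, where $\tilde J_\mu$ is the orthogonal projection to $\mathfrak m$ of $\varphi^{-1}\partial_\mu\varphi$. 1. A subset of $\mathbb O$ is a quaternionic subalgebra if and only if it is $g\mathbb H$ for some $g\in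 G_2$, and the stabilizer of $\mathbb H$ in $G_2$ consists exactly of the maps $(x,y)\mapsto(ax\bar a,\,by\bar a)$ with $a,b$ unit quaternions; thus $\mathcal H=G_2/SO(4)$. 2. $\mathfrak g_2=so(4)\oplus\mathfrak m$ with $[so(4),so(4)]\subseteq so(4)$, $[so(4),\mathfrak m]\subseteq\mathfrak m$, $[\mathfrak m,\mathfrak m]\subseteq so(4)$. The matrices $C_1,\dots,C_{14}$ are an orthonormal basis of $\mathfrak g_2$; $C_1,C_2,C_3,C_8,C_9,C_{10}$ span $so(4)$, and $C_4,\dots,C_7,C_{11},\dots,C_{14}$ span $\mathfrak m$. 3. Every point of $\mathcal H$ lies in the image of a local parametrization. The induced metric is a smooth Riemannian metric in every local parametrization, and it is a well-defined metric on $\mathcal H$: if $\psi(b)\mathbb H=\varphi(\tau(b))\mathbb H$ with $\tau$ smooth, then $g_\psi=\tau^*g_\varphi$. 4. Let $$h(a_1,\dots,a_8)=e^{\sqrt3a_1C_8}e^{\sqrt3a_2C_9}e^{\sqrt3a_3C_8}\;e^{a_4C_3}e^{a_5C_2}e^{a_6C_3}\;e^{\sqrt3a_7C_{11}}e^{a_8C_5}.$$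 On the set where $f(2a_7,2a_8)\sin(2a_2)\sin(2a_5)\ne0$, with $f(\alpha,\beta)=\sin\frac{\beta-\alpha}2\sin\frac{\beta+\alpha}2\sin\frac{\beta-3\alpha}2\sin\frac{\beta+3\alpha}2\sin\alpha\sin\beta$, the map $a\mapsto h(a)\mathbb H$ is a local parametrization of $\mathcal H$. For every $a\in\mathbb R^8$ the induced metric in these coordinates is $$\begin{aligned}ds^2_{\mathcal H}={}&da_8^2+3\,da_7^2+\left[\sin^2a_8\cos^2a_7+\cos^2a_8\sin^2a_7\right]\left(da_5^2+\sin^2(2a_5)\,da_4^2+3\,da_2^2+3\sin^2(2a_2)\,da_1^2\right)\\&+\tfrac12\cos(2a_8)\cos(2a_7)\sin^2(2a_7)\left\{(A_1+3B_2)^2+(A_2-3B_1)^2\right\}\\&-\sin(2a_7)\sin(2a_8)\left\{\sin^2(2a_7)(A_1+3B_2)(A_2-3B_1)+3(A_1B_1-A_2B_2)+6B_1B_2\right\}\\&+\tfrac34\sin^2(2a_7)(A_3-B_3)^2+\tfrac14\sin^2(2a_8)(A_3+3B_3)^2,\end{aligned}$$ where $A_n=I_n(a_4,a_5,a_6)$,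 $B_n=I_n(a_1,a_2,a_3)$ and $I_1(x,y,z)=\sin(2y)\cos(2z)\,dx-\sin(2z)\,dy$, $I_2(x,y,z)=\sin(2y)\sin(2z)\,dx+\cos(2z)\,dy$, $I_3(x,y,z)=dz+\cos(2y)\,dx$. 5. In every local parametrization, hence on all of $\mathcal H$ and in particular in the coordinates $a_1,\dots,a_8$ of part 4, the Riemann tensor of the induced metric is given by the structure constants, $\sum_\kappa R^\kappa{}_{\lambda\mu\nu}\tilde J_\kappa=-[[\tilde J_\mu,\tilde J_\nu],\tilde J_\lambda]$ (where $R^\kappa{}_{\lambda\mu\nu}\partial_\kappa=R(\partial_\mu,\partial_\nu)\partial_\lambda$), and the metric is Einstein: $\rho_{\mu\nu}=R^\kappa{}_{\mu\kappa\nu}=8\,g_{\mu\nu}$. -/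

import Mathlib

open scoped Quaternion Matrix ContDiff

attribute [local instance 100] LieRing.ofAssociativeRing

namespace G2Quat

noncomputable section

/-! ### The octonions, their automorphism group and their derivations -/

/-- Octonions are pairs of quaternions. The product is `octMul` (the componentwise product that
Mathlib puts on a product type is never used). -/
abbrev Octonion : Type := ℍ[ℝ] × ℍ[ℝ]

abbrev Mat7 : Type := Matrix (Fin 7) (Fin 7) ℝ

/-- The Cayley-Dickson product. -/
def octMul (x y : Octonion) : Octonion :=
  (x.1 * y.1 - star y.2 * x.2, y.2 * x.1 + x.2 * star y.1)

/-- The octonion `t e₀ + u₀ e₁ + ⋯ + u₆ e₇` in the canonical basis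
`e₀, …, e₃ = (1,0), (i,0), (j,0), (k,0)` and `e₄, …, e₇ = (0,1), (0,i), (0,j), (0,k)`. -/
def octOf (t : ℝ) (u : Fin 7 → ℝ) : Octonion :=
  (⟨t, u 0, u 1, u 2⟩, ⟨u 3, u 4, u 5, u 6⟩)

/-- The coordinates of an octonion along `e₁, …, e₇`. -/
def octIm (x : Octonion) : Fin 7 → ℝ :=
  ![x.1.imI, x.1.imJ, x.1.imK, x.2.re, x.2.imI, x.2.imJ, x.2.imK]

/-- The linear map of the octonions that fixes `1` and acts by the matrix `M` on `e₁, …, e₇`. -/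
def autAct (M : Mat7) (x : Octonion) : Octonion := octOf x.1.re (M *ᵥ octIm x)

/-- The linear map of the octonions that kills `1` and acts by the matrix `M` on `e₁, …, e₇`. -/
def derAct (M : Mat7) (x : Octonion) : Octonion := octOf 0 (M *ᵥ octIm x)

/-- The group `G₂` of automorphisms of the octonions, as `7 × 7` matrices (an automorphism fixes
`1` and preserves the imaginary octonions). -/
def G2 : Set Mat7 :=
  {g | IsUnit g.det ∧ ∀ x y, autAct g (octMul x y) = octMul (autAct g x) (autAct g y)}

theorem octOf_add (s t : ℝ) (u v : Fin 7 → ℝ) : octOf (s + t) (u + v) = octOf s u + octOf t v :=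
  rfl

theorem octOf_sub (s t : ℝ) (u v : Fin 7 → ℝ) : octOf (s - t) (u - v) = octOf s u - octOf t v :=
  rfl

theorem octOf_smul (c t : ℝ) (u : Fin 7 → ℝ) : octOf (c * t) (c • u) = c • octOf t u :=
  rfl

theorem derAct_add (M N : Mat7) (x : Octonion) :
    derAct (M + N) x = derAct M x + derAct N x := by
  rw [derAct, Matrix.add_mulVec, derAct, derAct, ← octOf_add, add_zero]

theorem derAct_smul (c : ℝ) (M : Mat7) (x : Octonion) :
    derAct (c • M) x = c • derAct M x := by
  rw [derAct, Matrix.smul_mulVec, derAct, ← octOf_smul, mul_zero]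

theorem derAct_zero (x : Octonion) : derAct 0 x = 0 := by
  have e := derAct_smul 0 0 x
  rwa [zero_smul, zero_smul] at e

theorem octIm_derAct (M : Mat7) (x : Octonion) : octIm (derAct M x) = M *ᵥ octIm x := by
  ext i
  fin_cases i <;> rfl

theorem derAct_lie (M N : Mat7) (x : Octonion) :
    derAct ⁅M, N⁆ x = derAct M (derAct N x) - derAct N (derAct M x) := by
  have h1 : derAct M (derAct N x) = octOf 0 (M *ᵥ (N *ᵥ octIm x)) := by
    rw [derAct, octIm_derAct]
  have h2 : derAct N (derAct M x) = octOf 0 (N *ᵥ (M *ᵥ octIm x)) := by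
    rw [derAct, octIm_derAct]
  rw [h1, h2, ← octOf_sub, sub_zero, derAct, Ring.lie_def, Matrix.sub_mulVec,
    Matrix.mulVec_mulVec, Matrix.mulVec_mulVec]

theorem octMul_add_left (x y z : Octonion) : octMul (x + y) z = octMul x z + octMul y z := by
  refine Prod.ext ?_ ?_ <;> simp only [octMul, Prod.fst_add, Prod.snd_add] <;> noncomm_ring

theorem octMul_add_right (x y z : Octonion) : octMul x (y + z) = octMul x y + octMul x z := by
  refine Prod.ext ?_ ?_ <;> simp only [octMul, Prod.fst_add, Prod.snd_add, star_add] <;>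
    noncomm_ring

theorem octMul_smul_left (c : ℝ) (x z : Octonion) : octMul (c • x) z = c • octMul x z := by
  refine Prod.ext ?_ ?_ <;> simp [octMul, smul_sub, smul_add]

theorem octMul_smul_right (c : ℝ) (x z : Octonion) : octMul x (c • z) = c • octMul x z := by
  refine Prod.ext ?_ ?_ <;> simp [octMul, smul_sub, smul_add]

theorem derAct_add_right (M : Mat7) (x y : Octonion) :
    derAct M (x + y) = derAct M x + derAct M y := by
  have e : octIm (x + y) = octIm x + octIm y := by
    ext i
    fin_cases i <;> rfl
  rw [derAct, e, Matrix.mulVec_add, derAct, derAct, ← octOf_add, add_zero]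

theorem octMul_sub_left (x y z : Octonion) : octMul (x - y) z = octMul x z - octMul y z := by
  have e := octMul_add_left (x - y) y z
  rw [sub_add_cancel] at e
  rw [e, add_sub_cancel_right]

theorem octMul_sub_right (x y z : Octonion) : octMul x (y - z) = octMul x y - octMul x z := by
  have e := octMul_add_right x (y - z) z
  rw [sub_add_cancel] at e
  rw [e, add_sub_cancel_right]

/-- The Lie algebra of `G₂`: the derivations of the octonions. -/
def g2 : LieSubalgebra ℝ Mat7 where
  carrier := {D | ∀ x y, derAct D (octMul x y) = octMul (derAct D x) y + octMul x (derAct D y)}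
  zero_mem' := by
    intro x y
    ext <;> simp [derAct_zero, octMul]
  add_mem' := by
    intro M N hM hN x y
    rw [derAct_add, derAct_add, derAct_add, hM, hN, octMul_add_left, octMul_add_right]
    abel
  smul_mem' := by
    intro c M hM x y
    rw [derAct_smul, derAct_smul, derAct_smul, hM, octMul_smul_left, octMul_smul_right, smul_add]
  lie_mem' := by
    intro M N hM hN x y
    rw [derAct_lie, derAct_lie, derAct_lie, hN, hM, derAct_add_right, derAct_add_right, hM, hM,
      hN, hN, octMul_sub_left, octMul_sub_right]
    abel

/-! ### Quaternionic subalgebras and the reductive splitting -/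

/-- Subalgebras of the octonions that are isomorphic to the quaternions. -/
def IsQuaternionicSubalgebra (Q : Set Octonion) : Prop :=
  ∃ f : ℍ[ℝ] →ₗ[ℝ] Octonion, Function.Injective f ∧ f 1 = (1, 0) ∧
    (∀ p q, f (p * q) = octMul (f p) (f q)) ∧ Q = Set.range f

/-- The canonical quaternionic subalgebra, spanned by `e₀, e₁, e₂, e₃`. -/
def canonicalH : Set Octonion := {x | x.2 = 0}

/-- The point `g ℍ` of the variety of quaternionic subalgebras. -/
def orbitPoint (g : Mat7) : Set Octonion := autAct g '' canonicalH

/-- The map `x + y e₄ ↦ a x a⁻ + (b y a⁻) e₄` (with `a⁻` the conjugate of `a`) for unit quaternions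
`a`, `b`; the subgroup `SO(4)` of `G₂` consists of these maps. -/
def gammaMap (a b : ℍ[ℝ]) (x : Octonion) : Octonion := (a * x.1 * star a, b * x.2 * star a)

/-- The Lie algebra of the stabilizer of `ℍ` in `G₂`. -/
def so4 : Submodule ℝ g2 where
  carrier := {X | ∀ x ∈ canonicalH, derAct (X : Mat7) x ∈ canonicalH}
  zero_mem' := by
    intro x _
    simp [derAct_zero, canonicalH]
  add_mem' := by
    intro X Y hX hY x hx
    have h1 : (derAct (X : Mat7) x).2 = 0 := hX x hx
    have h2 : (derAct (Y : Mat7) x).2 = 0 := hY x hx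
    simp [canonicalH, derAct_add, h1, h2]
  smul_mem' := by
    intro c X hX x hx
    have h1 : (derAct (X : Mat7) x).2 = 0 := hX x hx
    simp [canonicalH, derAct_smul, h1]

/-- The invariant inner product on the Lie algebra of `G₂`: the Killing form times `-1/16`. -/
def invInner (X Y : g2) : ℝ := -(1 / 16) * killingForm ℝ g2 X Y

/-- The orthogonal complement of `so4`. -/
def mm : Submodule ℝ g2 where
  carrier := {X | ∀ Z ∈ so4, invInner X Z = 0}
  zero_mem' := by
    intro Z _
    simp [invInner]
  add_mem' := by
    intro X Y hX hY Z hZ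
    have h1 := hX Z hZ
    have h2 := hY Z hZ
    simp only [invInner] at h1 h2
    simp only [invInner, map_add, LinearMap.add_apply, mul_add, h1, h2, add_zero]
  smul_mem' := by
    intro c X hX Z hZ
    have h1 := hX Z hZ
    simp only [invInner] at h1
    simp only [invInner, map_smul, LinearMap.smul_apply, smul_eq_mul]
    rw [mul_left_comm, h1, mul_zero]

open Classical in
/-- The component in `mm` of an element of `g2 = so4 ⊕ mm` (and `0` for other matrices). -/
def horizontalPart (A : Mat7) : g2 :=
  if h : ∃ X : g2, X ∈ mm ∧ ∃ Z ∈ so4, A = (X : Mat7) + (Z : Mat7) then h.choose else 0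

/-! ### The metric on the quotient in local parameters -/

/-- Partial derivative in `ℝ⁸`. -/
def pd (f : (Fin 8 → ℝ) → ℝ) (i : Fin 8) (a : Fin 8 → ℝ) : ℝ := fderiv ℝ f a (Pi.single i 1)

/-- The component along `da_i` of `φ⁻¹ dφ`. -/
def current (φ : (Fin 8 → ℝ) → Mat7) (i : Fin 8) (a : Fin 8 → ℝ) : Mat7 :=
  (φ a)⁻¹ * Matrix.of fun r s => pd (fun b => φ b r s) i a

/-- The component along `da_i` of the projection of `φ⁻¹ dφ` orthogonally to the fibre. -/
def achtBein (φ : (Fin 8 → ℝ) → Mat7) (i : Fin 8) (a : Fin 8 → ℝ) : g2 :=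
  horizontalPart (current φ i a)

/-- The metric that the invariant metric of `G₂` induces on the base, in the parameters `a`
of the point `φ(a) ℍ`. -/
def inducedMetric (φ : (Fin 8 → ℝ) → Mat7) (a : Fin 8 → ℝ) : Matrix (Fin 8) (Fin 8) ℝ :=
  Matrix.of fun i j => invInner (achtBein φ i a) (achtBein φ j a)

/-- `a ↦ φ(a) ℍ`, for `a ∈ U`, is a smooth local parametrization of the eight-dimensional base,
given together with a smooth lift `φ` to `G₂`. The last field says that it is an immersion:
the kernel of the differential of `g ↦ g ℍ` at `g` is `g · so4`. -/
structure IsLocalParam (U : Set (Fin 8 → ℝ)) (φ : (Fin 8 → ℝ) → Mat7) : Prop where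
  isOpen : IsOpen U
  mem : ∀ a ∈ U, φ a ∈ G2
  smooth : ∀ r s, ContDiffOn ℝ ∞ (fun a => φ a r s) U
  immersion : ∀ a ∈ U, ∀ v : Fin 8 → ℝ,
    (∃ Z ∈ so4, (Z : Mat7) = ∑ i, v i • current φ i a) → v = 0

/-! ### Curvature of a metric on a domain of `ℝ⁸` -/

/-- Christoffel symbols `Γ^k_{ij}` of the Levi-Civita connection. -/
def christoffel (g : (Fin 8 → ℝ) → Matrix (Fin 8) (Fin 8) ℝ) (k i j : Fin 8) (a : Fin 8 → ℝ) : ℝ :=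
  1 / 2 * ∑ l, (g a)⁻¹ k l *
    (pd (fun b => g b j l) i a + pd (fun b => g b i l) j a - pd (fun b => g b i j) l a)

/-- `R^k_{l ij}`, the `k`-th component of `R(∂_i, ∂_j) ∂_l`. -/
def riemann (g : (Fin 8 → ℝ) → Matrix (Fin 8) (Fin 8) ℝ) (k l i j : Fin 8) (a : Fin 8 → ℝ) : ℝ :=
  pd (christoffel g k j l) i a - pd (christoffel g k i l) j a +
    ∑ m, (christoffel g k i m a * christoffel g m j l a -
      christoffel g k j m a * christoffel g m i l a)

/-- The Ricci tensor `R^k_{l kj}`. -/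
def ricci (g : (Fin 8 → ℝ) → Matrix (Fin 8) (Fin 8) ℝ) (a : Fin 8 → ℝ) :
    Matrix (Fin 8) (Fin 8) ℝ :=
  Matrix.of fun l j => ∑ k, riemann g k l k j a

/-! ### The explicit coordinates -/

/-- The generators `C₁, …, C₁₄` of the Lie algebra of `G₂` (other indices are not used). -/
def genC : ℕ → Mat7
  | 1 =>
      !![0, 0, 0, 0, 0, 0, 0;
        0, 0, 0, 0, 0, 0, 0;
        0, 0, 0, 0, 0, 0, 0;
        0, 0, 0, 0, 0, 0, -1;
        0, 0, 0, 0, 0, -1, 0;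
        0, 0, 0, 0, 1, 0, 0;
        0, 0, 0, 1, 0, 0, 0]
  | 2 =>
      !![0, 0, 0, 0, 0, 0, 0;
        0, 0, 0, 0, 0, 0, 0;
        0, 0, 0, 0, 0, 0, 0;
        0, 0, 0, 0, 0, 1, 0;
        0, 0, 0, 0, 0, 0, -1;
        0, 0, 0, -1, 0, 0, 0;
        0, 0, 0, 0, 1, 0, 0]
  | 3 =>
      !![0, 0, 0, 0, 0, 0, 0;
        0, 0, 0, 0, 0, 0, 0;
        0, 0, 0, 0, 0, 0, 0;
        0, 0, 0, 0, -1, 0, 0;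
        0, 0, 0, 1, 0, 0, 0;
        0, 0, 0, 0, 0, 0, -1;
        0, 0, 0, 0, 0, 1, 0]
  | 4 =>
      !![0, 0, 0, 0, 0, 0, 0;
        0, 0, 0, 0, 0, 0, 1;
        0, 0, 0, 0, 0, 1, 0;
        0, 0, 0, 0, 0, 0, 0;
        0, 0, 0, 0, 0, 0, 0;
        0, 0, -1, 0, 0, 0, 0;
        0, -1, 0, 0, 0, 0, 0]
  | 5 =>
      !![0, 0, 0, 0, 0, 0, 0;
        0, 0, 0, 0, 0, -1, 0;
        0, 0, 0, 0, 0, 0, 1;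
        0, 0, 0, 0, 0, 0, 0;
        0, 0, 0, 0, 0, 0, 0;
        0, 1, 0, 0, 0, 0, 0;
        0, 0, -1, 0, 0, 0, 0]
  | 6 =>
      !![0, 0, 0, 0, 0, 0, 0;
        0, 0, 0, 0, 1, 0, 0;
        0, 0, 0, -1, 0, 0, 0;
        0, 0, 1, 0, 0, 0, 0;
        0, -1, 0, 0, 0, 0, 0;
        0, 0, 0, 0, 0, 0, 0;
        0, 0, 0, 0, 0, 0, 0]
  | 7 =>
      !![0, 0, 0, 0, 0, 0, 0;
        0, 0, 0, -1, 0, 0, 0;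
        0, 0, 0, 0, -1, 0, 0;
        0, 1, 0, 0, 0, 0, 0;
        0, 0, 1, 0, 0, 0, 0;
        0, 0, 0, 0, 0, 0, 0;
        0, 0, 0, 0, 0, 0, 0]
  | 8 => (1 / √3 : ℝ) •
      !![0, 0, 0, 0, 0, 0, 0;
        0, 0, -2, 0, 0, 0, 0;
        0, 2, 0, 0, 0, 0, 0;
        0, 0, 0, 0, 1, 0, 0;
        0, 0, 0, -1, 0, 0, 0;
        0, 0, 0, 0, 0, 0, -1;
        0, 0, 0, 0, 0, 1, 0]
  | 9 => (1 / √3 : ℝ) •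
      !![0, -2, 0, 0, 0, 0, 0;
        2, 0, 0, 0, 0, 0, 0;
        0, 0, 0, 0, 0, 0, 0;
        0, 0, 0, 0, 0, 0, 1;
        0, 0, 0, 0, 0, -1, 0;
        0, 0, 0, 0, 1, 0, 0;
        0, 0, 0, -1, 0, 0, 0]
  | 10 => (1 / √3 : ℝ) •
      !![0, 0, -2, 0, 0, 0, 0;
        0, 0, 0, 0, 0, 0, 0;
        2, 0, 0, 0, 0, 0, 0;
        0, 0, 0, 0, 0, -1, 0;
        0, 0, 0, 0, 0, 0, -1;
        0, 0, 0, 1, 0, 0, 0;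
        0, 0, 0, 0, 1, 0, 0]
  | 11 => (1 / √3 : ℝ) •
      !![0, 0, 0, -2, 0, 0, 0;
        0, 0, 0, 0, 0, 0, -1;
        0, 0, 0, 0, 0, 1, 0;
        2, 0, 0, 0, 0, 0, 0;
        0, 0, 0, 0, 0, 0, 0;
        0, 0, -1, 0, 0, 0, 0;
        0, 1, 0, 0, 0, 0, 0]
  | 12 => (1 / √3 : ℝ) •
      !![0, 0, 0, 0, -2, 0, 0;
        0, 0, 0, 0, 0, 1, 0;
        0, 0, 0, 0, 0, 0, 1;
        0, 0, 0, 0, 0, 0, 0;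
        2, 0, 0, 0, 0, 0, 0;
        0, -1, 0, 0, 0, 0, 0;
        0, 0, -1, 0, 0, 0, 0]
  | 13 => (1 / √3 : ℝ) •
      !![0, 0, 0, 0, 0, -2, 0;
        0, 0, 0, 0, -1, 0, 0;
        0, 0, 0, -1, 0, 0, 0;
        0, 0, 1, 0, 0, 0, 0;
        0, 1, 0, 0, 0, 0, 0;
        2, 0, 0, 0, 0, 0, 0;
        0, 0, 0, 0, 0, 0, 0]
  | 14 => (1 / √3 : ℝ) •
      !![0, 0, 0, 0, 0, 0, -2;
        0, 0, 0, 1, 0, 0, 0;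
        0, 0, 0, 0, -1, 0, 0;
        0, -1, 0, 0, 0, 0, 0;
        0, 0, 1, 0, 0, 0, 0;
        0, 0, 0, 0, 0, 0, 0;
        2, 0, 0, 0, 0, 0, 0]
  | _ => 0

/-- The indices of the generators of the subalgebra `so(4)`. -/
def latin : Set ℕ := {1, 2, 3, 8, 9, 10}

/-- The complementary indices. -/
def greek : Set ℕ := {4, 5, 6, 7, 11, 12, 13, 14}

/-- `s(x, y, z) = e^{x C₃} e^{y C₂} e^{z C₃}`. -/
def sElt (x y z : ℝ) : Mat7 :=
  NormedSpace.exp (x • genC 3) * NormedSpace.exp (y • genC 2) * NormedSpace.exp (z • genC 3)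

/-- `σ(x, y, z) = e^{√3 x C₈} e^{√3 y C₉} e^{√3 z C₈}`. -/
def sigmaElt (x y z : ℝ) : Mat7 :=
  NormedSpace.exp ((√3 * x) • genC 8) * NormedSpace.exp ((√3 * y) • genC 9) *
    NormedSpace.exp ((√3 * z) • genC 8)

/-- `h = σ(a₁, a₂, a₃) s(a₄, a₅, a₆) e^{√3 a₇ C₁₁} e^{a₈ C₅}`; the coordinate `a_i` is
`a (i - 1)`. -/
def hElt (a : Fin 8 → ℝ) : Mat7 :=
  sigmaElt (a 0) (a 1) (a 2) * sElt (a 3) (a 4) (a 5) *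
    NormedSpace.exp ((√3 * a 6) • genC 11) * NormedSpace.exp (a 7 • genC 5)

/-- The function `f(α, β)` of the invariant volume density. -/
def densF (α β : ℝ) : ℝ :=
  Real.sin ((β - α) / 2) * Real.sin ((β + α) / 2) * Real.sin ((β - 3 * α) / 2) *
    Real.sin ((β + 3 * α) / 2) * Real.sin α * Real.sin β

/-- The parameters at which the volume density of the base does not vanish. -/
def chartDomain : Set (Fin 8 → ℝ) :=
  {a | densF (2 * a 6) (2 * a 7) * Real.sin (2 * a 1) * Real.sin (2 * a 4) ≠ 0}

/-- The 1-form `I₁(x,y,z)` at `p = (x,y,z)`, applied to `v = (dx,dy,dz)`. -/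
def formI1 (p v : Fin 3 → ℝ) : ℝ :=
  Real.sin (2 * p 1) * Real.cos (2 * p 2) * v 0 - Real.sin (2 * p 2) * v 1

/-- The 1-form `I₂(x,y,z)`. -/
def formI2 (p v : Fin 3 → ℝ) : ℝ :=
  Real.sin (2 * p 1) * Real.sin (2 * p 2) * v 0 + Real.cos (2 * p 2) * v 1

/-- The 1-form `I₃(x,y,z)`. -/
def formI3 (p v : Fin 3 → ℝ) : ℝ := v 2 + Real.cos (2 * p 1) * v 0

/-- The explicit quadratic form `ds²` at `a`, evaluated on `v = (da₁, …, da₈)`. Here `A₁, A₂, A₃`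
are the forms `I₁, I₂, I₃` in `(a₄, a₅, a₆)` and `B₁, B₂, B₃` those in `(a₁, a₂, a₃)`. -/
def explicitMetric (a v : Fin 8 → ℝ) : ℝ :=
  let A₁ := formI1 ![a 3, a 4, a 5] ![v 3, v 4, v 5]
  let A₂ := formI2 ![a 3, a 4, a 5] ![v 3, v 4, v 5]
  let A₃ := formI3 ![a 3, a 4, a 5] ![v 3, v 4, v 5]
  let B₁ := formI1 ![a 0, a 1, a 2] ![v 0, v 1, v 2]
  let B₂ := formI2 ![a 0, a 1, a 2] ![v 0, v 1, v 2]
  let B₃ := formI3 ![a 0, a 1, a 2] ![v 0, v 1, v 2]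
  v 7 ^ 2 + 3 * v 6 ^ 2
    + (Real.sin (a 7) ^ 2 * Real.cos (a 6) ^ 2 + Real.cos (a 7) ^ 2 * Real.sin (a 6) ^ 2) *
      (v 4 ^ 2 + Real.sin (2 * a 4) ^ 2 * v 3 ^ 2
        + 3 * v 1 ^ 2 + 3 * Real.sin (2 * a 1) ^ 2 * v 0 ^ 2)
    + 1 / 2 * Real.cos (2 * a 7) * Real.cos (2 * a 6) * Real.sin (2 * a 6) ^ 2 *
      ((A₁ + 3 * B₂) ^ 2 + (A₂ - 3 * B₁) ^ 2)
    - Real.sin (2 * a 6) * Real.sin (2 * a 7) *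
      (Real.sin (2 * a 6) ^ 2 * (A₁ + 3 * B₂) * (A₂ - 3 * B₁)
        + 3 * (A₁ * B₁ - A₂ * B₂) + 6 * B₁ * B₂)
    + 3 / 4 * Real.sin (2 * a 6) ^ 2 * (A₃ - B₃) ^ 2
    + 1 / 4 * Real.sin (2 * a 7) ^ 2 * (A₃ + 3 * B₃) ^ 2

end

end G2Quat

/-! Everything rests on three facts: octonions obey a polarized alternative law, the pair (𝔤₂,
so(4)) is symmetric, and the Killing form is a multiple of the trace form.

Homogeneity is Cayley-Dickson doubling. If f embeds ℍ in 𝕆 and c is a unit vector orthogonal to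
f(ℍ), the alternative law shows that (x₁, x₂) ↦ f(x₁) + f(x₂)c is an automorphism carrying ℍ to f(ℍ)
(`isQuaternionicSubalgebra_iff`). The stabilizer of ℍ follows from Skolem-Noether
(`Quaternion.exists_unit_conj`) and from orthogonality of automorphisms: only the image of e₄ is
left to choose (`stabilizer_canonicalH_iff`).

Conjugation by s = diag(1,1,1,-1,-1,-1,-1) gives an involution θ of 𝔤₂ with so(4) and 𝔪 as its ±1
eigenspaces (`mem_so4_iff`, `mem_mm_iff`); all bracket relations follow. Finite sums over the
generators, evaluated on integer matrices, give (X,Y) = -tr(XY)/4 (`invInner_eq`), so the form is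
positive definite and ad-invariant.

For a lift φ write φ⁻¹∂ᵢφ = Hᵢ + Vᵢ with Hᵢ odd and Vᵢ even. The Hᵢ form a frame of 𝔪, and g_ij =
(Hᵢ,Hⱼ). Set ∇ᵢHⱼ = ∂ᵢHⱼ + [Vᵢ,Hⱼ]. The odd part of the Maurer-Cartan equation makes this symmetric
in i, j; invariance of the form makes it metric. Hence it is the Levi-Civita connection
(`IsLocalParam.sum_christoffel_smul`). The even part computes its curvature, and by the Jacobi
identity only -[[Hᵢ,Hⱼ],H_l] survives (`IsLocalParam.sum_riemann_smul`). The Ricci tensor is then a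
trace over 𝔪, evaluated by Casimir sums over the odd generators (`trace_curvOp`).

Two lifts of the same points differ by a right factor κ in the stabilizer. It conjugates H
isometrically and adds only the even term κ⁻¹dκ, so the metric is well defined
(`inducedMetric_comp`).

For the explicit coordinates, φ⁻¹dφ of a product of exponentials is a sum of adjoint rotations. The
generators C₁₁ and C₅ rotate planes with frequencies 0, 1, 2, 3, and the squared length becomes a
sum of eight squares (`trForm_oddPart_dirCurrent_hElt`). Double angle formulas turn it into the
stated metric, and the same squares show where it is nondegenerate. Left translates of this one
chart cover the variety. -/

namespace G2Quat

/-! ### Conjugation and inner product of octonions -/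

/-- Octonionic conjugation. -/
def octConj (x : Octonion) : Octonion := (star x.1, -x.2)

/-- The euclidean inner product of octonions. -/
noncomputable def octDot (x y : Octonion) : ℝ := (x.1 * star y.1).re + (x.2 * star y.2).re

theorem octOf_re_octIm (x : Octonion) : octOf x.1.re (octIm x) = x := rfl

theorem octIm_octOf (t : ℝ) (u : Fin 7 → ℝ) : octIm (octOf t u) = u := by
  ext i
  fin_cases i <;> rfl

theorem re_octOf (t : ℝ) (u : Fin 7 → ℝ) : (octOf t u).1.re = t := rfl

theorem fst_imI_octOf (t : ℝ) (u : Fin 7 → ℝ) : (octOf t u).1.imI = u 0 := rfl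

theorem fst_imJ_octOf (t : ℝ) (u : Fin 7 → ℝ) : (octOf t u).1.imJ = u 1 := rfl

theorem fst_imK_octOf (t : ℝ) (u : Fin 7 → ℝ) : (octOf t u).1.imK = u 2 := rfl

theorem snd_re_octOf (t : ℝ) (u : Fin 7 → ℝ) : (octOf t u).2.re = u 3 := rfl

theorem snd_imI_octOf (t : ℝ) (u : Fin 7 → ℝ) : (octOf t u).2.imI = u 4 := rfl

theorem snd_imJ_octOf (t : ℝ) (u : Fin 7 → ℝ) : (octOf t u).2.imJ = u 5 := rfl

theorem snd_imK_octOf (t : ℝ) (u : Fin 7 → ℝ) : (octOf t u).2.imK = u 6 := rfl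

theorem smul_octOne_add_octOf (t : ℝ) (u : Fin 7 → ℝ) :
    t • ((1, 0) : Octonion) + octOf 0 u = octOf t u := by
  ext <;> simp [re_octOf, fst_imI_octOf, fst_imJ_octOf, fst_imK_octOf, snd_re_octOf,
    snd_imI_octOf, snd_imJ_octOf, snd_imK_octOf]

theorem octConj_eq (x : Octonion) : octConj x = octOf x.1.re (-octIm x) := by
  ext <;> simp [octConj, octOf, octIm]

theorem autAct_octConj (g : Mat7) (x : Octonion) : autAct g (octConj x) = octConj (autAct g x) := by
  rw [octConj_eq, octConj_eq, autAct, autAct, octIm_octOf, octIm_octOf, Matrix.mulVec_neg]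
  rfl

theorem re_octMul_octConj (x y : Octonion) : (octMul x (octConj y)).1.re = octDot x y := by
  simp [octMul, octConj, octDot]
  ring

theorem octDot_octOf (u v : Fin 7 → ℝ) : octDot (octOf 0 u) (octOf 0 v) = u ⬝ᵥ v := by
  simp [octDot, dotProduct, Fin.sum_univ_seven, re_octOf, fst_imI_octOf, fst_imJ_octOf,
    fst_imK_octOf, snd_re_octOf, snd_imI_octOf, snd_imJ_octOf, snd_imK_octOf]
  ring

theorem octDot_comm (x y : Octonion) : octDot x y = octDot y x := by
  simp [octDot]
  ring

theorem octDot_self (x : Octonion) :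
    octDot x x = Quaternion.normSq x.1 + Quaternion.normSq x.2 := by
  simp [octDot, Quaternion.normSq_def]

theorem octOne_octMul (x : Octonion) : octMul (1, 0) x = x := by
  ext <;> simp [octMul]

/-- Polarization in x of x(x̄y) = |x|²y, that is, the left alternative law combined with the norm.
This identity and its mirror image below stand in for associativity in the Cayley-Dickson relations.
-/
theorem octMul_octConj_linearized (x y z : Octonion) :
    octMul x (octMul (octConj z) y) + octMul z (octMul (octConj x) y) =
      (2 * octDot x z) • y := by
  ext <;> simp only [octMul, octConj, octDot, Prod.fst_add, Prod.snd_add, Prod.smul_fst,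
    Prod.smul_snd, Quaternion.re_add, Quaternion.imI_add, Quaternion.imJ_add, Quaternion.imK_add,
    Quaternion.re_sub, Quaternion.imI_sub, Quaternion.imJ_sub, Quaternion.imK_sub,
    Quaternion.re_neg, Quaternion.imI_neg, Quaternion.imJ_neg, Quaternion.imK_neg,
    Quaternion.re_star, Quaternion.imI_star, Quaternion.imJ_star, Quaternion.imK_star,
    Quaternion.re_mul, Quaternion.imI_mul, Quaternion.imJ_mul, Quaternion.imK_mul,
    Quaternion.re_smul, Quaternion.imI_smul, Quaternion.imJ_smul, Quaternion.imK_smul,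
    smul_eq_mul] <;> ring

theorem octConj_octMul_linearized (x y z : Octonion) :
    octMul (octMul y (octConj x)) z + octMul (octMul y (octConj z)) x =
      (2 * octDot x z) • y := by
  ext <;> simp only [octMul, octConj, octDot, Prod.fst_add, Prod.snd_add, Prod.smul_fst,
    Prod.smul_snd, Quaternion.re_add, Quaternion.imI_add, Quaternion.imJ_add, Quaternion.imK_add,
    Quaternion.re_sub, Quaternion.imI_sub, Quaternion.imJ_sub, Quaternion.imK_sub,
    Quaternion.re_neg, Quaternion.imI_neg, Quaternion.imJ_neg, Quaternion.imK_neg,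
    Quaternion.re_star, Quaternion.imI_star, Quaternion.imJ_star, Quaternion.imK_star,
    Quaternion.re_mul, Quaternion.imI_mul, Quaternion.imJ_mul, Quaternion.imK_mul,
    Quaternion.re_smul, Quaternion.imI_smul, Quaternion.imJ_smul, Quaternion.imK_smul,
    smul_eq_mul] <;> ring

theorem octMul_add_octConj (x y : Octonion) :
    octMul x (octConj y) + octMul y (octConj x) = (2 * octDot x y) • ((1, 0) : Octonion) := by
  ext <;> simp [octMul, octConj, octDot]
  all_goals ring

theorem octConj_octMul (x y : Octonion) :
    octConj (octMul x y) = octMul (octConj y) (octConj x) := by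
  refine Prod.ext ?_ ?_
  · simp [octMul, octConj]
  · simp only [octMul, octConj, star_neg, star_star]
    noncomm_ring

theorem octConj_add_self (x : Octonion) : x + octConj x = (2 * x.1.re) • ((1, 0) : Octonion) := by
  ext <;> simp [octConj, two_mul]

theorem octConj_of_re_eq_zero {x : Octonion} (h : x.1.re = 0) : octConj x = -x := by
  ext <;> simp [octConj, h]

theorem octConj_octConj (x : Octonion) : octConj (octConj x) = x := by
  ext <;> simp [octConj]

theorem octMul_neg_left (x y : Octonion) : octMul (-x) y = -octMul x y := by
  rw [← neg_one_smul ℝ x, octMul_smul_left, neg_one_smul]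

theorem octMul_neg_right (x y : Octonion) : octMul x (-y) = -octMul x y := by
  rw [← neg_one_smul ℝ y, octMul_smul_right, neg_one_smul]

/-- The imaginary part of x² is 2 Re(x) Im(x). If Re x were nonzero, x would be real and x² could
not be negative. This forces an embedding of ℍ to send imaginary quaternions to imaginary octonions.
-/
theorem re_eq_zero_of_octMul_self {x : Octonion} {r : ℝ} (hr : 0 < r)
    (h : octMul x x = (-r) • ((1, 0) : Octonion)) : x.1.re = 0 := by
  by_contra hx
  have e := h
  simp only [Prod.ext_iff, Quaternion.ext_iff, octMul] at e
  simp at e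
  obtain ⟨⟨h0, h1, h2, h3⟩, h4, h5, h6, h7⟩ := e
  have k1 : x.1.imI = 0 := mul_left_cancel₀ hx (by linarith)
  have k2 : x.1.imJ = 0 := mul_left_cancel₀ hx (by linarith)
  have k3 : x.1.imK = 0 := mul_left_cancel₀ hx (by linarith)
  have k4 : x.2.re = 0 := h4.resolve_right hx
  have k5 : x.2.imI = 0 := mul_left_cancel₀ hx (by linarith)
  have k6 : x.2.imJ = 0 := mul_left_cancel₀ hx (by linarith)
  have k7 : x.2.imK = 0 := mul_left_cancel₀ hx (by linarith)
  rw [k1, k2, k3, k4, k5, k6, k7] at h0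
  nlinarith [mul_self_nonneg x.1.re]

/-! ### The group `G₂` -/

theorem autAct_add (M : Mat7) (x y : Octonion) : autAct M (x + y) = autAct M x + autAct M y := by
  have e : octIm (x + y) = octIm x + octIm y := by
    ext i
    fin_cases i <;> rfl
  rw [autAct, e, Matrix.mulVec_add, autAct, autAct, ← octOf_add]
  rfl

theorem autAct_smul (M : Mat7) (c : ℝ) (x : Octonion) : autAct M (c • x) = c • autAct M x := by
  have e : octIm (c • x) = c • octIm x := by
    ext i
    fin_cases i <;> simp [octIm]
  rw [autAct, e, Matrix.mulVec_smul, autAct, ← octOf_smul]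
  simp

theorem autAct_one_left (x : Octonion) : autAct 1 x = x := by
  rw [autAct, Matrix.one_mulVec, octOf_re_octIm]

theorem autAct_mul (M N : Mat7) (x : Octonion) : autAct (M * N) x = autAct M (autAct N x) := by
  rw [autAct, autAct, autAct, octIm_octOf, Matrix.mulVec_mulVec, re_octOf]

theorem autAct_octOne (M : Mat7) : autAct M (1, 0) = (1, 0) := by
  have e : octIm (1, 0) = 0 := by
    ext i
    fin_cases i <;> simp [octIm]
  rw [autAct, e, Matrix.mulVec_zero]
  ext <;> simp [octOf]

theorem octDot_autAct {g : Mat7}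
    (hg : ∀ x y, autAct g (octMul x y) = octMul (autAct g x) (autAct g y)) (x y : Octonion) :
    octDot (autAct g x) (autAct g y) = octDot x y := by
  rw [← re_octMul_octConj, ← autAct_octConj, ← hg, autAct, re_octOf, re_octMul_octConj]

/-- A multiplicative `autAct g` also commutes with conjugation and preserves real parts, hence
preserves ⟨x,y⟩ = Re(xȳ). So invertibility is automatic in `mem_G2_of_octMul`, and inverses in G₂
are transposes, whose entries are visibly smooth. -/
theorem transpose_mul_self_of_octMul {g : Mat7}
    (hg : ∀ x y, autAct g (octMul x y) = octMul (autAct g x) (autAct g y)) : gᵀ * g = 1 := by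
  have h : ∀ u v : Fin 7 → ℝ, (g *ᵥ u) ⬝ᵥ (g *ᵥ v) = u ⬝ᵥ v := by
    intro u v
    have e := octDot_autAct hg (octOf 0 u) (octOf 0 v)
    rwa [autAct, autAct, octIm_octOf, octIm_octOf, re_octOf, re_octOf, octDot_octOf,
      octDot_octOf] at e
  refine Matrix.ext_of_mulVec_single fun j => funext fun i => ?_
  have e := h (Pi.single i 1) (Pi.single j 1)
  rw [Matrix.dotProduct_mulVec, Matrix.vecMul_mulVec, ← Matrix.dotProduct_mulVec,
    single_one_dotProduct, single_one_dotProduct] at e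
  rw [e, Matrix.one_mulVec]

theorem mem_G2_of_octMul {g : Mat7}
    (hg : ∀ x y, autAct g (octMul x y) = octMul (autAct g x) (autAct g y)) : g ∈ G2 :=
  ⟨(Matrix.isUnit_iff_isUnit_det g).mp (IsUnit.of_mul_eq_one _ (mul_eq_one_comm.mp
    (transpose_mul_self_of_octMul hg))), hg⟩

theorem transpose_mul_self_of_mem_G2 {g : Mat7} (hg : g ∈ G2) : gᵀ * g = 1 :=
  transpose_mul_self_of_octMul hg.2

theorem inv_eq_transpose_of_mem_G2 {g : Mat7} (hg : g ∈ G2) : g⁻¹ = gᵀ :=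
  Matrix.inv_eq_left_inv (transpose_mul_self_of_mem_G2 hg)

theorem inv_mul_self_of_mem_G2 {g : Mat7} (hg : g ∈ G2) : g⁻¹ * g = 1 :=
  Matrix.nonsing_inv_mul _ hg.1

theorem mul_inv_self_of_mem_G2 {g : Mat7} (hg : g ∈ G2) : g * g⁻¹ = 1 :=
  Matrix.mul_nonsing_inv _ hg.1

theorem mul_mem_G2 {g h : Mat7} (hg : g ∈ G2) (hh : h ∈ G2) : g * h ∈ G2 :=
  mem_G2_of_octMul fun x y => by simp only [autAct_mul, hh.2, hg.2]

theorem autAct_inv_autAct {g : Mat7} (hg : g ∈ G2) (x : Octonion) :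
    autAct g⁻¹ (autAct g x) = x := by
  rw [← autAct_mul, inv_mul_self_of_mem_G2 hg, autAct_one_left]

theorem autAct_autAct_inv {g : Mat7} (hg : g ∈ G2) (x : Octonion) :
    autAct g (autAct g⁻¹ x) = x := by
  rw [← autAct_mul, mul_inv_self_of_mem_G2 hg, autAct_one_left]

theorem inv_mem_G2 {g : Mat7} (hg : g ∈ G2) : g⁻¹ ∈ G2 :=
  mem_G2_of_octMul fun x y => by
    conv_lhs => rw [← autAct_autAct_inv hg x, ← autAct_autAct_inv hg y, ← hg.2,
      autAct_inv_autAct hg]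

theorem orbitPoint_mul (g h : Mat7) : orbitPoint (g * h) = autAct g '' orbitPoint h := by
  rw [orbitPoint, orbitPoint, Set.image_image]
  simp only [autAct_mul]

theorem orbitPoint_one : orbitPoint 1 = canonicalH := by
  simp [orbitPoint, autAct_one_left]

theorem orbitPoint_inv_mul_eq {g h : Mat7} (hg : g ∈ G2) (e : orbitPoint h = orbitPoint g) :
    orbitPoint (g⁻¹ * h) = canonicalH := by
  rw [orbitPoint_mul, e, ← orbitPoint_mul, inv_mul_self_of_mem_G2 hg, orbitPoint_one]

/-- The passage from automorphisms given by a formula to elements of the matrix group: such a map is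
determined by its restriction to the imaginary octonions. -/
theorem exists_matrix_autAct (G : Octonion →ₗ[ℝ] Octonion) (h1 : G (1, 0) = (1, 0))
    (h0 : ∀ u, (G (octOf 0 u)).1.re = 0) : ∃ M : Mat7, ∀ x, autAct M x = G x := by
  let L : (Fin 7 → ℝ) →ₗ[ℝ] (Fin 7 → ℝ) :=
    { toFun := fun u => octIm (G (octOf 0 u))
      map_add' := fun u v => by
        have e : octOf 0 (u + v) = octOf 0 u + octOf 0 v := by rw [← octOf_add, add_zero]
        rw [e, map_add]
        ext i
        fin_cases i <;> rfl
      map_smul' := fun c u => by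
        have e : octOf 0 (c • u) = c • octOf 0 u := by rw [← octOf_smul, mul_zero]
        rw [e, map_smul]
        ext i
        fin_cases i <;> simp [octIm] }
  refine ⟨LinearMap.toMatrix' L, fun x => ?_⟩
  have e2 : octOf 0 (octIm (G (octOf 0 (octIm x)))) = G (octOf 0 (octIm x)) := by
    conv_rhs => rw [← octOf_re_octIm (G (octOf 0 (octIm x))), h0]
  rw [autAct, LinearMap.toMatrix'_mulVec]
  conv_rhs => rw [← octOf_re_octIm x, ← smul_octOne_add_octOf, map_add, map_smul, h1, ← e2,
    smul_octOne_add_octOf]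
  rfl

/-! ### Automorphisms of the quaternions are inner -/

theorem exists_quaternion_units : ∃ i j k : ℍ[ℝ],
    (i * i = -1 ∧ j * j = -1 ∧ k * k = -1) ∧ (i * j = k ∧ j * k = i ∧ k * i = j) ∧
    (j * i = -k ∧ k * j = -i ∧ i * k = -j) ∧
    ∀ p : ℍ[ℝ], p = p.re • 1 + p.imI • i + p.imJ • j + p.imK • k := by
  obtain ⟨i, i0, i1, i2, i3⟩ : ∃ i : ℍ[ℝ], i.re = 0 ∧ i.imI = 1 ∧ i.imJ = 0 ∧ i.imK = 0 :=
    ⟨⟨0, 1, 0, 0⟩, rfl, rfl, rfl, rfl⟩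
  obtain ⟨j, j0, j1, j2, j3⟩ : ∃ j : ℍ[ℝ], j.re = 0 ∧ j.imI = 0 ∧ j.imJ = 1 ∧ j.imK = 0 :=
    ⟨⟨0, 0, 1, 0⟩, rfl, rfl, rfl, rfl⟩
  obtain ⟨k, k0, k1, k2, k3⟩ : ∃ k : ℍ[ℝ], k.re = 0 ∧ k.imI = 0 ∧ k.imJ = 0 ∧ k.imK = 1 :=
    ⟨⟨0, 0, 0, 1⟩, rfl, rfl, rfl, rfl⟩
  refine ⟨i, j, k, ⟨?_, ?_, ?_⟩, ⟨?_, ?_, ?_⟩, ⟨?_, ?_, ?_⟩, fun p => ?_⟩ <;> ext <;>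
    simp [i0, i1, i2, i3, j0, j1, j2, j3, k0, k1, k2, k3]

/-- Skolem-Noether by averaging: a sum over the group {±1, ±i, ±j, ±k} produces a nonzero w with
A(p)w = wp, and w/|w| is the required unit. -/
theorem Quaternion.exists_unit_conj (A : ℍ[ℝ] →ₗ[ℝ] ℍ[ℝ]) (h1 : A 1 = 1)
    (hmul : ∀ p q, A (p * q) = A p * A q) :
    ∃ a : ℍ[ℝ], ‖a‖ = 1 ∧ ∀ p, A p = a * p * star a := by
  obtain ⟨i, j, k, ⟨ii, jj, kk⟩, ⟨ij, jk, ki⟩, ⟨ji, kj, ik⟩, dec⟩ := exists_quaternion_units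
  -- This is Σ A(u) q u⁻¹ over u = 1, i, j, k, since u⁻¹ = -u for the imaginary units. Left
  -- multiplication by a unit permutes the u up to signs that cancel, which gives the intertwining
  -- property.
  let w : ℍ[ℝ] → ℍ[ℝ] := fun q => q - A i * q * i - A j * q * j - A k * q * k
  have inter : ∀ q p, A p * w q = w q * p := by
    intro q p
    have e1 : A i * w q = w q * i := by
      have r1 : A i * A i = -1 := by rw [← hmul, ii, map_neg, h1]
      have r2 : A i * A j = A k := by rw [← hmul, ij]
      have r3 : A i * A k = -A j := by rw [← hmul, ik, map_neg]
      simp only [w, mul_sub, sub_mul, ← mul_assoc, r1, r2, r3]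
      simp only [mul_assoc, ii, ji, ki]
      noncomm_ring
    have e2 : A j * w q = w q * j := by
      have r1 : A j * A i = -A k := by rw [← hmul, ji, map_neg]
      have r2 : A j * A j = -1 := by rw [← hmul, jj, map_neg, h1]
      have r3 : A j * A k = A i := by rw [← hmul, jk]
      simp only [w, mul_sub, sub_mul, ← mul_assoc, r1, r2, r3]
      simp only [mul_assoc, ij, jj, kj]
      noncomm_ring
    have e3 : A k * w q = w q * k := by
      rw [← ij, hmul, mul_assoc, e2, ← mul_assoc, e1, mul_assoc]
    conv_lhs => rw [dec p]
    conv_rhs => rw [dec p]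
    simp only [map_add, map_smul, h1, add_mul, mul_add, smul_mul_assoc, mul_smul_comm, e1, e2, e3,
      one_mul, mul_one]
  -- The sum Σ w(v)v⁻¹ over v = 1, i, j, k. Since Σ v u⁻¹ v⁻¹ = 4 Re(u⁻¹), only the term u = 1
  -- survives; so w does not vanish identically.
  have total : w 1 - w i * i - w j * j - w k * k = (4 : ℕ) • (1 : ℍ[ℝ]) := by
    simp only [w, sub_mul, mul_assoc, ii, jj, kk, ij, ji, jk, kj, ki, ik, mul_neg, neg_mul, mul_one,
      one_mul]
    noncomm_ring
  have hne : ∃ q, w q ≠ 0 := by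
    by_contra! h
    rw [h, h, h, h] at total
    have e := congrArg (fun p : ℍ[ℝ] => p.re) total
    simp only [Quaternion.re_smul, zero_mul, sub_zero, Quaternion.re_zero, Quaternion.re_one] at e
    norm_num at e
  obtain ⟨q, hq⟩ := hne
  have hn : ‖w q‖ ≠ 0 := norm_ne_zero_iff.mpr hq
  refine ⟨‖w q‖⁻¹ • w q, by rw [norm_smul, norm_inv, norm_norm, inv_mul_cancel₀ hn], fun p => ?_⟩
  have hs : w q * star (w q) = ((‖w q‖ * ‖w q‖ : ℝ) : ℍ[ℝ]) := by
    rw [Quaternion.self_mul_star, Quaternion.normSq_eq_norm_mul_self]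
  rw [Quaternion.star_smul, smul_mul_assoc, smul_mul_smul_comm, ← inter, mul_assoc, hs,
    Quaternion.mul_coe_eq_smul, smul_smul]
  have e : ‖w q‖⁻¹ * ‖w q‖⁻¹ * (‖w q‖ * ‖w q‖) = 1 := by field_simp
  rw [e, one_smul]

theorem mul_star_self_of_norm_eq_one {a : ℍ[ℝ]} (ha : ‖a‖ = 1) : a * star a = 1 := by
  rw [Quaternion.self_mul_star, Quaternion.normSq_eq_norm_mul_self, ha]
  simp

theorem star_mul_self_of_norm_eq_one {a : ℍ[ℝ]} (ha : ‖a‖ = 1) : star a * a = 1 := by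
  rw [Quaternion.star_mul_self, Quaternion.normSq_eq_norm_mul_self, ha]
  simp

/-! ### The stabilizer of the quaternions -/

theorem gammaMap_octMul {a b : ℍ[ℝ]} (ha : ‖a‖ = 1) (hb : ‖b‖ = 1) (x y : Octonion) :
    gammaMap a b (octMul x y) = octMul (gammaMap a b x) (gammaMap a b y) := by
  have h1 : ∀ p : ℍ[ℝ], star a * (a * p) = p := fun p => by
    rw [← mul_assoc, star_mul_self_of_norm_eq_one ha, one_mul]
  have h2 : ∀ p : ℍ[ℝ], star b * (b * p) = p := fun p => by
    rw [← mul_assoc, star_mul_self_of_norm_eq_one hb, one_mul]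
  simp only [gammaMap, octMul, star_mul, star_star, mul_sub, sub_mul, mul_add, add_mul, mul_assoc,
    h1, h2]

theorem exists_mem_G2_gammaMap {a b : ℍ[ℝ]} (ha : ‖a‖ = 1) (hb : ‖b‖ = 1) :
    ∃ g ∈ G2, ∀ x, autAct g x = gammaMap a b x := by
  let G : Octonion →ₗ[ℝ] Octonion :=
    { toFun := gammaMap a b
      map_add' := fun x y => by simp [gammaMap, mul_add, add_mul]
      map_smul' := fun c x => by simp [gammaMap] }
  obtain ⟨M, hM⟩ := exists_matrix_autAct G
    (by
      change gammaMap a b (1, 0) = _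
      simp [gammaMap, mul_star_self_of_norm_eq_one ha])
    (fun u => by
      have e : ∀ p : ℍ[ℝ], (a * p * star a).re = (a * star a).re * p.re := fun p => by
        simp
        ring
      change (a * (octOf 0 u).1 * star a).re = 0
      rw [e, re_octOf, mul_zero])
  refine ⟨M, mem_G2_of_octMul fun x y => ?_, hM⟩
  rw [hM, hM, hM]
  exact gammaMap_octMul ha hb x y

theorem octMul_snd (y : ℍ[ℝ]) : octMul (y, 0) (0, 1) = (0, y) := by
  ext <;> simp [octMul]

/-- An automorphism preserving ℍ is inner there, and it preserves ℍ^⊥ = ℍe₄ because it is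
orthogonal. As 𝕆 = ℍ ⊕ ℍe₄, the image of e₄ is the only remaining datum. -/
theorem stabilizer_canonicalH_iff (F : Octonion → Octonion) :
    (∃ g ∈ G2, orbitPoint g = canonicalH ∧ autAct g = F) ↔
      ∃ a b : ℍ[ℝ], ‖a‖ = 1 ∧ ‖b‖ = 1 ∧ F = gammaMap a b := by
  constructor
  · rintro ⟨g, hg, hH, rfl⟩
    have hs : ∀ p : ℍ[ℝ], (autAct g (p, 0)).2 = 0 := fun p => by
      have : autAct g (p, 0) ∈ canonicalH := hH ▸ Set.mem_image_of_mem _ rfl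
      exact this
    let A : ℍ[ℝ] →ₗ[ℝ] ℍ[ℝ] :=
      { toFun := fun p => (autAct g (p, 0)).1
        map_add' := fun p q => by
          have e : ((p + q, 0) : Octonion) = (p, 0) + (q, 0) := by simp
          rw [e, autAct_add, Prod.fst_add]
        map_smul' := fun c p => by
          have e : ((c • p, 0) : Octonion) = c • (p, 0) := by simp
          rw [e, autAct_smul, Prod.smul_fst, RingHom.id_apply] }
    have hA : ∀ p, autAct g (p, 0) = (A p, 0) := fun p => Prod.ext rfl (hs p)
    obtain ⟨a, ha, hAa⟩ := Quaternion.exists_unit_conj A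
      (by change (autAct g (1, 0)).1 = 1; rw [autAct_octOne])
      (fun p q => by
        have e : ((p * q, 0) : Octonion) = octMul (p, 0) (q, 0) := by simp [octMul]
        change (autAct g (p * q, 0)).1 = _
        rw [e, hg.2, hA, hA]
        simp [octMul])
    -- The ℍ-component of g e₄ lies in ℍ = gℍ, so it is gz with z in ℍ. Its squared norm is ⟨g e₄,
    -- gz⟩ = ⟨e₄, z⟩ = 0.
    have h0 : (autAct g (0, 1)).1 = 0 := by
      obtain ⟨z, hz, hz'⟩ : ((autAct g (0, 1)).1, 0) ∈ orbitPoint g := by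
        rw [hH]
        rfl
      have e := octDot_autAct hg.2 (0, 1) z
      have hz2 : z.2 = 0 := hz
      rw [hz'] at e
      simp only [octDot, hz2] at e
      simp only [star_zero, mul_zero, zero_mul, Quaternion.re_zero, add_zero,
        Quaternion.self_mul_star, Quaternion.re_coe] at e
      exact Quaternion.normSq_eq_zero.mp e
    obtain ⟨c, hc⟩ : ∃ c, autAct g (0, 1) = (0, c) := ⟨_, Prod.ext h0 rfl⟩
    have hcn : ‖c‖ = 1 := by
      have e := octDot_autAct hg.2 (0, 1) (0, 1)
      rw [hc, octDot_self, octDot_self] at e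
      simp only [map_zero, map_one, zero_add, Quaternion.normSq_eq_norm_mul_self] at e
      nlinarith [norm_nonneg c]
    -- Since (p,0)(0,c) = (0,cp), the summand x₂e₄ goes to (0, c a x₂ ā); hence b = ca.
    refine ⟨a, c * a, ha, by rw [norm_mul, ha, hcn, one_mul], funext fun x => ?_⟩
    have ex : x = (x.1, 0) + octMul (x.2, 0) (0, 1) := by
      rw [octMul_snd]
      simp
    conv_lhs => rw [ex, autAct_add, hg.2, hA, hA, hc, hAa, hAa]
    simp [octMul, gammaMap, mul_assoc]
  · rintro ⟨a, b, ha, hb, rfl⟩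
    obtain ⟨g, hg, h⟩ := exists_mem_G2_gammaMap ha hb
    refine ⟨g, hg, ?_, funext h⟩
    ext x
    constructor
    · rintro ⟨y, hy, rfl⟩
      have hy2 : y.2 = 0 := hy
      rw [h]
      simp [canonicalH, gammaMap, hy2]
    · intro hx
      have hx2 : x.2 = 0 := hx
      refine ⟨(star a * x.1 * a, 0), rfl, ?_⟩
      rw [h]
      have e : a * (star a * x.1 * a) * star a = (a * star a) * x.1 * (a * star a) := by
        simp only [mul_assoc]
      refine Prod.ext ?_ ?_
      · simp only [gammaMap, e, mul_star_self_of_norm_eq_one ha, one_mul, mul_one]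
      · simp [gammaMap, hx2]

/-! ### Quaternionic subalgebras form one orbit -/

section
variable {a b c : Octonion}

theorem octMul_comm_of_octDot_eq_zero (hc : c.1.re = 0) (h : octDot a c = 0) :
    octMul a c = octMul c (octConj a) := by
  have e := octMul_add_octConj a c
  rw [h, octConj_of_re_eq_zero hc, octMul_neg_right, mul_zero, zero_smul] at e
  exact (neg_add_eq_zero.mp e)

theorem octDot_neg_right (x y : Octonion) : octDot x (-y) = -octDot x y := by
  simp [octDot]
  ring

/-- First Cayley-Dickson rule. Elements orthogonal to c satisfy bc = c b̄, and polarized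
alternativity gives a(c b̄) = c(ā b̄), where ā b̄ is the conjugate of ba; then c is moved back to
the right. -/
theorem octMul_octMul_of_octDot_eq_zero_left (hc : c.1.re = 0) (ha : octDot a c = 0)
    (hb : octDot b c = 0) (hba : octDot (octMul b a) c = 0) :
    octMul a (octMul b c) = octMul (octMul b a) c := by
  have e := octMul_octConj_linearized a (octConj b) (octConj c)
  rw [octConj_octConj, octConj_of_re_eq_zero hc, octDot_neg_right, ha, octMul_neg_left,
    ← octConj_octMul] at e
  simp only [neg_zero, mul_zero, zero_smul] at e
  rw [octMul_comm_of_octDot_eq_zero hc hb, octMul_comm_of_octDot_eq_zero hc hba,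
    add_neg_eq_zero.mp e]

/-- Second Cayley-Dickson rule: the mirror alternative law for the orthogonal pair c̄, b, with c̄ =
-c. -/
theorem octMul_octMul_of_octDot_eq_zero_right (hc : c.1.re = 0) (hb : octDot b c = 0) :
    octMul (octMul a c) b = octMul (octMul a (octConj b)) c := by
  have e := octConj_octMul_linearized (octConj c) a b
  rw [octConj_octConj, octDot_comm, octConj_of_re_eq_zero hc, octDot_neg_right, hb,
    octMul_neg_right] at e
  simp only [neg_zero, mul_zero, zero_smul] at e
  exact add_neg_eq_zero.mp e

theorem octMul_octMul_self (hc : c.1.re = 0) (hn : octDot c c = 1) (y : Octonion) :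
    octMul (octMul y c) c = -y := by
  have e := octConj_octMul_linearized c y c
  rw [octConj_of_re_eq_zero hc, hn, octMul_neg_right, octMul_neg_left, ← two_smul ℝ (-_), mul_one]
    at e
  have e2 := smul_right_injective _ (two_ne_zero (α := ℝ)) e
  exact neg_eq_iff_eq_neg.mp e2

theorem octDot_octMul_self (hn : octDot c c = 1) (b : Octonion) : octDot (octMul b c) c = b.1.re := by
  have e : octDot (octMul b c) c = b.1.re * octDot c c := by
    simp only [octMul, octDot, Quaternion.re_add, Quaternion.imI_add, Quaternion.imJ_add,
      Quaternion.imK_add, Quaternion.re_sub, Quaternion.imI_sub, Quaternion.imJ_sub,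
      Quaternion.imK_sub, Quaternion.re_star, Quaternion.imI_star, Quaternion.imJ_star,
      Quaternion.imK_star, Quaternion.re_mul, Quaternion.imI_mul, Quaternion.imJ_mul,
      Quaternion.imK_mul]
    ring
  rw [e, hn, mul_one]

/-- Third Cayley-Dickson rule. The mirror law for c̄ and bc reduces (ac)(bc) to (a(bc))c = ((ba)c)c
= -ba and to ⟨bc,c⟩ = Re b; the result combines into -b̄a because b̄a = 2 Re(b)a - ba. -/
theorem octMul_octMul_octMul (hc : c.1.re = 0) (hn : octDot c c = 1) (ha : octDot a c = 0)
    (hb : octDot b c = 0) (hba : octDot (octMul b a) c = 0) :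
    octMul (octMul a c) (octMul b c) = -octMul (octConj b) a := by
  have hbc : (octMul b c).1.re = 0 := by
    have e := re_octMul_octConj b c
    rw [hb, octConj_of_re_eq_zero hc, octMul_neg_right] at e
    simpa using e
  have e := octConj_octMul_linearized (octConj c) a (octMul b c)
  rw [octConj_octConj, octConj_of_re_eq_zero hc, octConj_of_re_eq_zero hbc, octDot_comm,
    octDot_neg_right, octDot_octMul_self hn, octMul_neg_right, octMul_neg_right, octMul_neg_left,
    octMul_octMul_of_octDot_eq_zero_left hc ha hb hba, octMul_octMul_self hc hn, neg_neg] at e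
  have e3 : octMul (octConj b) a = (2 * b.1.re) • a - octMul b a := by
    rw [eq_sub_iff_add_eq', ← octMul_add_left, octConj_add_self, octMul_smul_left, octOne_octMul]
  rw [e3, eq_sub_of_add_eq e, mul_neg, neg_smul]
  abel

end

/-- Dimension count: four linear functionals on an eight-dimensional space have a common nonzero
zero. -/
theorem exists_unit_octDot_eq_zero (f : ℍ[ℝ] →ₗ[ℝ] Octonion) :
    ∃ c : Octonion, octDot c c = 1 ∧ ∀ p, octDot (f p) c = 0 := by
  obtain ⟨i, j, k, -, -, -, dec⟩ := exists_quaternion_units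
  have dl : ∀ x y c, octDot (x + y) c = octDot x c + octDot y c := fun x y c => by
    simp [octDot]; ring
  have sl : ∀ (t : ℝ) x c, octDot (t • x) c = t * octDot x c := fun t x c => by
    simp [octDot]; ring
  have dr : ∀ x y c, octDot c (x + y) = octDot c x + octDot c y := fun x y c => by
    rw [octDot_comm, dl, octDot_comm, octDot_comm y]
  have sr : ∀ (t : ℝ) x c, octDot c (t • x) = t * octDot c x := fun t x c => by
    rw [octDot_comm, sl, octDot_comm]
  let v : Fin 4 → Octonion := ![f 1, f i, f j, f k]
  let T : (ℍ[ℝ] × ℍ[ℝ]) →ₗ[ℝ] (Fin 4 → ℝ) :=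
    { toFun := fun x n => octDot (v n) x
      map_add' := fun x y => funext fun n => dr x y (v n)
      map_smul' := fun t x => funext fun n => sr t x (v n) }
  have hlt : Module.finrank ℝ (Fin 4 → ℝ) < Module.finrank ℝ (ℍ[ℝ] × ℍ[ℝ]) := by
    rw [Module.finrank_prod, Quaternion.finrank_eq_four]
    simp
  obtain ⟨d, hd, hne⟩ := (Submodule.ne_bot_iff _).mp (LinearMap.ker_ne_bot_of_finrank_lt (f := T) hlt)
  have hT : ∀ n, octDot (v n) d = 0 := fun n => congrFun hd n
  have hpos : 0 < octDot d d := by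
    rw [octDot_self]
    have n1 := Quaternion.normSq_nonneg (a := d.1)
    have n2 := Quaternion.normSq_nonneg (a := d.2)
    rcases eq_or_ne d.1 0 with h | h
    · have h2 : d.2 ≠ 0 := fun h' => hne (Prod.ext h h')
      have := lt_of_le_of_ne n2 (Ne.symm (Quaternion.normSq_ne_zero.mpr h2))
      linarith
    · have := lt_of_le_of_ne n1 (Ne.symm (Quaternion.normSq_ne_zero.mpr h))
      linarith
  refine ⟨(√(octDot d d))⁻¹ • d, ?_, fun p => ?_⟩
  · rw [sl, sr, ← mul_assoc, ← mul_inv, Real.mul_self_sqrt hpos.le, inv_mul_cancel₀ hpos.ne']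
  · have h0 := hT 0
    have h1 := hT 1
    have h2 := hT 2
    have h3 := hT 3
    simp only [v, Matrix.cons_val] at h0 h1 h2 h3
    rw [sr, dec p]
    simp only [map_add, map_smul, dl, sl, h0, h1, h2, h3]
    ring

/-- Cayley-Dickson doubling: with c a unit vector orthogonal to f(ℍ), the three rules above say that
x₁ + x₂e₄ ↦ f(x₁) + f(x₂)c is multiplicative. They apply because f respects real parts and
conjugation, as p² = -|p|² for imaginary p. -/
theorem isQuaternionicSubalgebra_iff (Q : Set Octonion) :
    IsQuaternionicSubalgebra Q ↔ ∃ g ∈ G2, orbitPoint g = Q := by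
  constructor
  · rintro ⟨f, -, h1, hmul, rfl⟩
    have him : ∀ p : ℍ[ℝ], p.re = 0 → (f p).1.re = 0 := by
      intro p hp
      rcases eq_or_ne p 0 with rfl | hp0
      · simp
      have hpp : p * p = (-Quaternion.normSq p) • (1 : ℍ[ℝ]) := by
        have e : star p = -p := by ext <;> simp [hp]
        have e2 := Quaternion.self_mul_star p
        rw [e, mul_neg] at e2
        rw [neg_eq_iff_eq_neg.mp e2, neg_smul]
        ext <;> simp
      refine re_eq_zero_of_octMul_self (r := Quaternion.normSq p)
        (lt_of_le_of_ne Quaternion.normSq_nonneg (Ne.symm (Quaternion.normSq_ne_zero.mpr hp0))) ?_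
      rw [← hmul, hpp, map_smul, h1]
    have hre : ∀ p : ℍ[ℝ], (f p).1.re = p.re := by
      intro p
      have e : p = p.re • (1 : ℍ[ℝ]) + (p - p.re • (1 : ℍ[ℝ])) := by abel
      rw [e, map_add, map_smul, h1]
      have := him (p - p.re • (1 : ℍ[ℝ])) (by simp)
      simp only [Prod.fst_add, Quaternion.re_add, this]
      simp
    have hstar : ∀ p : ℍ[ℝ], f (star p) = octConj (f p) := by
      intro p
      have e : star p = (2 * p.re) • (1 : ℍ[ℝ]) - p := by
        ext <;> simp
        ring
      rw [e, map_sub, map_smul, h1, sub_eq_iff_eq_add', octConj_add_self, hre]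
    obtain ⟨c, hn, hc⟩ := exists_unit_octDot_eq_zero f
    have hc0 : c.1.re = 0 := by
      have := hc 1
      rw [h1] at this
      simpa [octDot] using this
    let G : Octonion →ₗ[ℝ] Octonion :=
      { toFun := fun x => f x.1 + octMul (f x.2) c
        map_add' := fun x y => by
          rw [Prod.fst_add, Prod.snd_add, map_add, map_add, octMul_add_left]
          abel
        map_smul' := fun t x => by
          rw [Prod.smul_fst, Prod.smul_snd, map_smul, map_smul, octMul_smul_left, smul_add]
          rfl }
    have hG : ∀ x, G x = f x.1 + octMul (f x.2) c := fun x => rfl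
    have z0 : octMul 0 c = 0 := by
      ext <;> simp [octMul]
    obtain ⟨M, hM⟩ := exists_matrix_autAct G (by rw [hG, map_zero, z0, h1, add_zero]) (fun u => by
      have e := re_octMul_octConj (f (octOf 0 u).2) c
      rw [hc, octConj_of_re_eq_zero hc0, octMul_neg_right] at e
      have e' : (octMul (f (octOf 0 u).2) c).1.re = 0 := by simpa using e
      rw [hG, Prod.fst_add, Quaternion.re_add, e', hre, re_octOf, add_zero])
    have hGm : ∀ x y, G (octMul x y) = octMul (G x) (G y) := by
      intro x y
      have hcc : ∀ p q, octDot (octMul (f p) (f q)) c = 0 := fun p q => by rw [← hmul, hc]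
      rw [hG, hG, hG, octMul_add_left, octMul_add_right, octMul_add_right,
        octMul_octMul_of_octDot_eq_zero_left hc0 (hc _) (hc _) (hcc _ _),
        octMul_octMul_of_octDot_eq_zero_right hc0 (hc _),
        octMul_octMul_octMul hc0 hn (hc _) (hc _) (hcc _ _)]
      change f (x.1 * y.1 - star y.2 * x.2) + octMul (f (y.2 * x.1 + x.2 * star y.1)) c = _
      rw [map_sub, map_add, hmul, hmul, hmul, hmul, hstar, hstar, octMul_add_left]
      abel
    refine ⟨M, mem_G2_of_octMul fun x y => by rw [hM, hM, hM, hGm], ?_⟩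
    ext z
    constructor
    · rintro ⟨x, hx, rfl⟩
      have hx2 : x.2 = 0 := hx
      exact ⟨x.1, by rw [hM, hG, hx2, map_zero, z0, add_zero]⟩
    · rintro ⟨p, rfl⟩
      exact ⟨(p, 0), rfl, by rw [hM, hG, map_zero, z0, add_zero]⟩
  · rintro ⟨g, hg, rfl⟩
    refine ⟨{ toFun := fun p => autAct g (p, 0), map_add' := fun p q => ?_,
              map_smul' := fun c p => ?_ }, fun p q h => ?_, autAct_octOne g, fun p q => ?_, ?_⟩
    · rw [← autAct_add]
      simp
    · rw [RingHom.id_apply, ← autAct_smul]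
      simp
    · have h' : autAct g (p, 0) = autAct g (q, 0) := h
      have e := congrArg (autAct g⁻¹) h'
      rw [autAct_inv_autAct hg, autAct_inv_autAct hg] at e
      exact congrArg Prod.fst e
    · have e : ((p * q, 0) : Octonion) = octMul (p, 0) (q, 0) := by simp [octMul]
      change autAct g (p * q, 0) = _
      rw [e, hg.2]
      rfl
    · ext z
      constructor
      · rintro ⟨x, hx, rfl⟩
        have hx2 : x.2 = 0 := hx
        exact ⟨x.1, congrArg (autAct g) (Prod.ext rfl hx2.symm)⟩
      · rintro ⟨p, rfl⟩
        exact ⟨(p, 0), rfl, rfl⟩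

/-! ### An integral basis of the Lie algebra of `G₂` -/

/-- Every row of a generator has at most one nonzero entry, in this column. -/
def genCol : Fin 14 → Fin 7 → Fin 7 :=
  ![![0, 1, 2, 6, 5, 4, 3], ![0, 1, 2, 5, 6, 3, 4], ![0, 1, 2, 4, 3, 6, 5],
    ![0, 6, 5, 3, 4, 2, 1], ![0, 5, 6, 3, 4, 1, 2], ![0, 4, 3, 2, 1, 5, 6],
    ![0, 3, 4, 1, 2, 5, 6], ![0, 2, 1, 4, 3, 6, 5], ![1, 0, 2, 6, 5, 4, 3],
    ![2, 1, 0, 5, 6, 3, 4], ![3, 6, 5, 0, 4, 2, 1], ![4, 5, 6, 3, 0, 1, 2],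
    ![5, 4, 3, 2, 1, 0, 6], ![6, 3, 4, 1, 2, 5, 0]]

/-- The only entry of a row of a generator that may be nonzero. -/
def genEntry : Fin 14 → Fin 7 → ℤ :=
  ![![0, 0, 0, -1, -1, 1, 1], ![0, 0, 0, 1, -1, -1, 1], ![0, 0, 0, -1, 1, -1, 1],
    ![0, 1, 1, 0, 0, -1, -1], ![0, -1, 1, 0, 0, 1, -1], ![0, 1, -1, 1, -1, 0, 0],
    ![0, -1, -1, 1, 1, 0, 0], ![0, -2, 2, 1, -1, -1, 1], ![-2, 2, 0, 1, -1, 1, -1],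
    ![-2, 0, 2, -1, -1, 1, 1], ![-2, -1, 1, 2, 0, -1, 1], ![-2, 1, 1, 0, 2, -1, -1],
    ![-2, -1, -1, 1, 1, 2, 0], ![-2, 1, -1, -1, 1, 0, 2]]

/-- The generators `C₁, …, C₇, √3 C₈, …, √3 C₁₄` as integer matrices. -/
def genT (k : Fin 14) : Matrix (Fin 7) (Fin 7) ℤ :=
  Matrix.of fun i j => if j = genCol k i then genEntry k i else 0

/-- The general element of the Lie algebra of `G₂`. -/
def g2Mat (x : Fin 14 → ℝ) : Mat7 :=
  !![0, -2 * x 8, -2 * x 9, -2 * x 10, -2 * x 11, -2 * x 12, -2 * x 13;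
    2 * x 8, 0, -2 * x 7, -x 6 + x 13, x 5 - x 12, -x 4 + x 11, x 3 - x 10;
    2 * x 9, 2 * x 7, 0, -x 5 - x 12, -x 6 - x 13, x 3 + x 10, x 4 + x 11;
    2 * x 10, x 6 - x 13, x 5 + x 12, 0, -x 2 + x 7, x 1 - x 9, -x 0 + x 8;
    2 * x 11, -x 5 + x 12, x 6 + x 13, x 2 - x 7, 0, -x 0 - x 8, -x 1 - x 9;
    2 * x 12, x 4 - x 11, -x 3 - x 10, -x 1 + x 9, x 0 + x 8, 0, -x 2 - x 7;
    2 * x 13, -x 3 + x 10, -x 4 - x 11, x 0 - x 8, x 1 + x 9, x 2 + x 7, 0]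

theorem g2Mat_mulVec (x : Fin 14 → ℝ) (u : Fin 7 → ℝ) : g2Mat x *ᵥ u =
    ![
      -2 * x 8 * u 1 - 2 * x 9 * u 2 - 2 * x 10 * u 3 - 2 * x 11 * u 4 - 2 * x 12 * u 5 - 2
        * x 13 * u 6,
      2 * x 8 * u 0 - 2 * x 7 * u 2 - x 6 * u 3 + x 13 * u 3 + x 5 * u 4 - x 12 * u 4 - x 4
        * u 5 + x 11 * u 5 + x 3 * u 6 - x 10 * u 6,
      2 * x 9 * u 0 + 2 * x 7 * u 1 - x 5 * u 3 - x 12 * u 3 - x 6 * u 4 - x 13 * u 4 + x 3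
        * u 5 + x 10 * u 5 + x 4 * u 6 + x 11 * u 6,
      2 * x 10 * u 0 + x 6 * u 1 - x 13 * u 1 + x 5 * u 2 + x 12 * u 2 - x 2 * u 4 + x 7 * u
        4 + x 1 * u 5 - x 9 * u 5 - x 0 * u 6 + x 8 * u 6,
      2 * x 11 * u 0 - x 5 * u 1 + x 12 * u 1 + x 6 * u 2 + x 13 * u 2 + x 2 * u 3 - x 7 * u
        3 - x 0 * u 5 - x 8 * u 5 - x 1 * u 6 - x 9 * u 6,
      2 * x 12 * u 0 + x 4 * u 1 - x 11 * u 1 - x 3 * u 2 - x 10 * u 2 - x 1 * u 3 + x 9 * u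
        3 + x 0 * u 4 + x 8 * u 4 - x 2 * u 6 - x 7 * u 6,
      2 * x 13 * u 0 - x 3 * u 1 + x 10 * u 1 - x 4 * u 2 - x 11 * u 2 + x 0 * u 3 - x 8 * u
        3 + x 1 * u 4 + x 9 * u 4 + x 2 * u 5 + x 7 * u 5] := by
  ext i
  fin_cases i <;> simp [g2Mat, Matrix.mulVec, dotProduct, Fin.sum_univ_succ] <;> ring

theorem g2Mat_mem_g2 (x : Fin 14 → ℝ) : g2Mat x ∈ g2 := by
  intro p q
  ext <;> simp only [derAct, g2Mat_mulVec, octMul, re_octOf, fst_imI_octOf, fst_imJ_octOf,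
    fst_imK_octOf, snd_re_octOf, snd_imI_octOf, snd_imJ_octOf, snd_imK_octOf, octIm,
    Matrix.cons_val, Prod.fst_add, Prod.snd_add, Quaternion.re_add, Quaternion.imI_add,
    Quaternion.imJ_add, Quaternion.imK_add, Quaternion.re_sub, Quaternion.imI_sub,
    Quaternion.imJ_sub, Quaternion.imK_sub, Quaternion.re_star, Quaternion.imI_star,
    Quaternion.imJ_star, Quaternion.imK_star, Quaternion.re_mul, Quaternion.imI_mul,
    Quaternion.imJ_mul, Quaternion.imK_mul] <;> ring

theorem derAct_octOf_single (M : Mat7) (i : Fin 7) :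
    derAct M (octOf 0 (Pi.single i 1)) = octOf 0 (fun r => M r i) := by
  rw [derAct, octIm_octOf, Matrix.mulVec_single_one]
  rfl

/-- The infinitesimal form of orthogonality: for imaginary u, v the real part of uv is -⟨u,v⟩, while
`derAct` has values of real part zero. The Leibniz rule then reads ⟨Xu,v⟩ + ⟨u,Xv⟩ = 0. -/
theorem transpose_eq_neg_of_mem_g2 {X : Mat7} (hX : X ∈ g2) : Xᵀ = -X := by
  have key : ∀ i j, X i j + X j i = 0 := by
    intro i j
    have e := congrArg (fun z : Octonion => z.1.re)
      (hX (octOf 0 (Pi.single i 1)) (octOf 0 (Pi.single j 1)))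
    have e1 : ∀ u v, (octMul (octOf 0 u) (octOf 0 v)).1.re = -(u ⬝ᵥ v) := by
      intro u v
      have := re_octMul_octConj (octOf 0 u) (octOf 0 v)
      rw [octConj_of_re_eq_zero (x := octOf 0 v) rfl, octMul_neg_right, octDot_octOf] at this
      rw [← this]
      simp
    rw [derAct_octOf_single, derAct_octOf_single] at e
    simp only [Prod.fst_add, Quaternion.re_add, e1] at e
    rw [derAct, re_octOf, dotProduct_single_one, single_one_dotProduct] at e
    linarith
  ext i j
  rw [Matrix.transpose_apply, Matrix.neg_apply]
  linarith [key i j]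

/-- The elements e₁, e₂, e₄ generate 𝕆. The Leibniz rule on the products of two of them supplies the
seven relations that cut the 21 entries of a skew matrix down to 14 parameters. -/
theorem exists_eq_g2Mat {X : Mat7} (hX : X ∈ g2) : ∃ x, X = g2Mat x := by
  have hs : ∀ i j, X j i = -X i j := fun i j => by
    rw [← Matrix.neg_apply, ← transpose_eq_neg_of_mem_g2 hX, Matrix.transpose_apply]
  have h01 := hX (octOf 0 (Pi.single 0 1)) (octOf 0 (Pi.single 1 1))
  have h03 := hX (octOf 0 (Pi.single 0 1)) (octOf 0 (Pi.single 3 1))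
  have h13 := hX (octOf 0 (Pi.single 1 1)) (octOf 0 (Pi.single 3 1))
  rw [derAct_octOf_single, derAct_octOf_single, Prod.ext_iff, Quaternion.ext_iff,
    Quaternion.ext_iff] at h01 h03 h13
  simp [derAct, octMul, re_octOf, fst_imI_octOf, fst_imJ_octOf, fst_imK_octOf, snd_re_octOf,
    snd_imI_octOf, snd_imJ_octOf, snd_imK_octOf, octIm, Matrix.mulVec, dotProduct,
    Fin.sum_univ_seven] at h01 h03 h13
  obtain ⟨-, a1, a2, a3, a4⟩ := h01
  obtain ⟨-, -, -, a5, a6⟩ := h03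
  obtain ⟨-, -, -, -, a7⟩ := h13
  -- The entries of `g2Mat x` equal to twice a parameter give x₇, …, x₁₃; one further entry below
  -- the diagonal then gives each of x₀, …, x₆.
  obtain ⟨x, hx⟩ : ∃ x : Fin 14 → ℝ, x = ![X 6 3 + X 1 0 / 2, X 2 0 / 2 - X 5 3,
    X 4 3 + X 2 1 / 2, X 3 0 / 2 - X 6 1, X 5 1 + X 4 0 / 2, X 5 0 / 2 - X 4 1,
    X 3 1 + X 6 0 / 2, X 2 1 / 2, X 1 0 / 2, X 2 0 / 2, X 3 0 / 2, X 4 0 / 2, X 5 0 / 2,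
    X 6 0 / 2] := ⟨_, rfl⟩
  have lower : ∀ i j, j < i → X i j = g2Mat x i j := by
    rw [hx]
    simp only [g2Mat, Fin.forall_fin_succ, Fin.forall_fin_zero]
    simp
    refine ⟨?_, ⟨?_, ?_⟩, ⟨?_, ?_⟩, ⟨?_, ?_⟩, ⟨?_, ?_, ?_⟩, ?_, ?_, ?_, ?_⟩ <;> linarith
  have hs' : ∀ i j, g2Mat x j i = -g2Mat x i j := fun i j => by
    rw [← Matrix.neg_apply, ← transpose_eq_neg_of_mem_g2 (g2Mat_mem_g2 x), Matrix.transpose_apply]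
  refine ⟨x, ?_⟩
  ext i j
  rcases lt_trichotomy i j with h | rfl | h
  · rw [hs, lower j i h, ← hs']
  · linarith [hs i i, hs' i i]
  · exact lower i j h

/-! ### Orthonormal generators -/

/-- The normalization of the generators. -/
noncomputable def genW (k : Fin 14) : ℝ := if k < 7 then 1 else 1 / √3

theorem genC_eq (k : Fin 14) : genC (k + 1) = genW k • (genT k).map (Int.cast : ℤ → ℝ) := by
  fin_cases k <;> simp [genC, genW, genT, genCol, genEntry, ← Matrix.ext_iff, Fin.forall_fin_succ]

theorem genT_apply_comm : ∀ k i j, genT k j i = -genT k i j := by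
  decide +kernel

/-- A row of a generator has one relevant entry, so matrix products collapse to table lookups. This
keeps the kernel evaluations below small. -/
theorem genT_mul_apply (k : Fin 14) (Y : Matrix (Fin 7) (Fin 7) ℤ) (i l : Fin 7) :
    (genT k * Y) i l = genEntry k i * Y (genCol k i) l := by
  simp [Matrix.mul_apply, genT]

theorem mul_genT_apply (k : Fin 14) (Y : Matrix (Fin 7) (Fin 7) ℤ) (i l : Fin 7) :
    (Y * genT k) i l = -(genEntry k l * Y i (genCol k l)) := by
  simp only [Matrix.mul_apply, genT_apply_comm k l]
  simp [genT, mul_comm]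

theorem genT_mul_mul_apply (k : Fin 14) (Y : Matrix (Fin 7) (Fin 7) ℤ) (i l : Fin 7) :
    (genT k * Y * genT k) i l =
      -(genEntry k i * genEntry k l * Y (genCol k i) (genCol k l)) := by
  rw [mul_genT_apply, genT_mul_apply]
  ring

theorem genT_trace (j k : Fin 14) : (genT j * genT k).trace =
    if j = k then (if j < 7 then -4 else -12) else 0 := by
  have h : ∀ j k, ∑ i, genEntry j i * genT k (genCol j i) i =
    if j = k then (if j < 7 then -4 else -12) else 0 := by decide +kernel
  rw [← h, Matrix.trace]
  simp only [Matrix.diag_apply, genT_mul_apply]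

/-- The squares of the normalizations, times three. -/
def genV (k : Fin 14) : ℤ := if k < 7 then 3 else 1

theorem genT_casimir : ∑ k, genV k • (genT k * genT k) = (-24 : ℤ) • 1 := by
  have h : ∀ i l, ∑ k, genV k * (genEntry k i * genT k (genCol k i) l) =
    -24 * (if i = l then 1 else 0) := by decide +kernel
  ext i l
  simp only [Matrix.sum_apply, Matrix.smul_apply, smul_eq_mul, genT_mul_apply, h, Matrix.one_apply]

/-- For the normalized generators E_k, `genT_casimir` gives Σ[E_k,[E_k,Y]] = -16Y - 2ΣE_kYE_k. The
vanishing thus says that the Casimir operator is -16 on the adjoint representation; it is what makes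
the Killing form four times the trace form. -/
theorem genT_sandwich (j : Fin 14) : ∑ k, genV k • (genT k * genT j * genT k) = 0 := by
  have h : ∀ j i l,
    ∑ k, genV k * -(genEntry k i * genEntry k l * genT j (genCol k i) (genCol k l)) = 0 := by
      decide +kernel
  ext i l
  simp only [Matrix.sum_apply, Matrix.smul_apply, smul_eq_mul, genT_mul_mul_apply, h,
    Matrix.zero_apply]

/-- The sign by which the involution of the symmetric space acts on a generator. -/
def genSign (k : Fin 14) : ℤ := if k ∈ ({0, 1, 2, 7, 8, 9} : Finset (Fin 14)) then 1 else -1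

/-- The diagonal of the involution that fixes `e₁, e₂, e₃` and reverses `e₄, …, e₇`. -/
def involSign (i : Fin 7) : ℤ := if i < 3 then 1 else -1

theorem genT_invol : ∀ k i j, involSign i * genT k i j * involSign j = genSign k * genT k i j := by
  decide +kernel

/-- A trace over 𝔪 runs over the odd generators only, and there the sandwich sum no longer vanishes.
After division by 3 the constant is -2/3, one of the two contributions to the Ricci tensor. -/
theorem genT_sandwich_odd (j : Fin 14) (hj : genSign j = -1) :
    ∑ k, (if genSign k = -1 then genV k else 0) • (genT k * genT j * genT k) =
      (-2 : ℤ) • genT j := by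
  have h : ∀ j, genSign j = -1 → ∀ i l, ∑ k, (if genSign k = -1 then genV k else 0) *
      -(genEntry k i * genEntry k l * genT j (genCol k i) (genCol k l)) = -2 * genT j i l := by
    decide +kernel
  ext i l
  simp only [Matrix.sum_apply, Matrix.smul_apply, smul_eq_mul, genT_mul_mul_apply, h j hj]

/-- The odd Casimir is not scalar: it is -16 on e₁, e₂, e₃ and -12 on e₄, …, e₇. Odd matrices
interchange these blocks, so only the sum -28 will matter. -/
theorem genT_casimir_odd :
    ∑ k, (if genSign k = -1 then genV k else 0) • (genT k * genT k) =
      Matrix.diagonal fun i => -14 - 2 * involSign i := by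
  have h : ∀ i l, ∑ k, (if genSign k = -1 then genV k else 0) *
      (genEntry k i * genT k (genCol k i) l) =
        if i = l then -14 - 2 * involSign i else 0 := by decide +kernel
  ext i l
  simp only [Matrix.sum_apply, Matrix.smul_apply, smul_eq_mul, genT_mul_apply, h,
    Matrix.diagonal_apply]

/-! ### The invariant form -/

/-- The invariant form `-tr(XY)/4`. -/
noncomputable def trForm (X Y : Mat7) : ℝ := -(1 / 4) * (X * Y).trace

theorem trForm_comm (X Y : Mat7) : trForm X Y = trForm Y X := by
  rw [trForm, trForm, Matrix.trace_mul_comm]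

theorem trForm_add_left (X Y Z : Mat7) : trForm (X + Y) Z = trForm X Z + trForm Y Z := by
  rw [trForm, trForm, trForm, add_mul, Matrix.trace_add, mul_add]

theorem trForm_smul_left (c : ℝ) (X Z : Mat7) : trForm (c • X) Z = c * trForm X Z := by
  rw [trForm, trForm, smul_mul_assoc, Matrix.trace_smul, smul_eq_mul, mul_left_comm]

theorem trForm_add_right (X Y Z : Mat7) : trForm Z (X + Y) = trForm Z X + trForm Z Y := by
  rw [trForm_comm, trForm_add_left, trForm_comm X, trForm_comm Y]

theorem trForm_smul_right (c : ℝ) (X Z : Mat7) : trForm Z (c • X) = c * trForm Z X := by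
  rw [trForm_comm, trForm_smul_left, trForm_comm X]

theorem trForm_neg_left (X Z : Mat7) : trForm (-X) Z = -trForm X Z := by
  rw [← neg_one_smul ℝ, trForm_smul_left, neg_one_mul]

theorem trForm_neg_right (X Z : Mat7) : trForm Z (-X) = -trForm Z X := by
  rw [trForm_comm, trForm_neg_left, trForm_comm]

theorem trForm_sub_left (X Y Z : Mat7) : trForm (X - Y) Z = trForm X Z - trForm Y Z := by
  rw [sub_eq_add_neg, trForm_add_left, trForm_neg_left, sub_eq_add_neg]

theorem trForm_zero_left (Z : Mat7) : trForm 0 Z = 0 := by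
  simp [trForm]

theorem trForm_sum_left {ι : Type*} (s : Finset ι) (f : ι → Mat7) (Z : Mat7) :
    trForm (∑ i ∈ s, f i) Z = ∑ i ∈ s, trForm (f i) Z := by
  rw [trForm, Finset.sum_mul, Matrix.trace_sum, Finset.mul_sum]
  rfl

theorem trForm_sum_right {ι : Type*} (s : Finset ι) (f : ι → Mat7) (Z : Mat7) :
    trForm Z (∑ i ∈ s, f i) = ∑ i ∈ s, trForm Z (f i) := by
  simp only [trForm_comm Z, trForm_sum_left]

theorem trForm_lie (X Y Z : Mat7) : trForm ⁅X, Y⁆ Z = -trForm Y ⁅X, Z⁆ := by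
  simp only [trForm, Ring.lie_def, sub_mul, mul_sub, Matrix.trace_sub]
  rw [Matrix.trace_mul_cycle X Y Z, Matrix.trace_mul_comm (Z * X) Y, mul_assoc Y X Z,
    ← mul_assoc Y Z X]
  ring_nf

theorem trForm_conj {k : Mat7} {k' : Mat7} (h : k' * k = 1) (X Y : Mat7) :
    trForm (k' * X * k) (k' * Y * k) = trForm X Y := by
  have h' : k * k' = 1 := mul_eq_one_comm.mp h
  have e : k' * X * k * (k' * Y * k) = k' * (X * Y) * k := by
    calc k' * X * k * (k' * Y * k) = k' * X * (k * k') * Y * k := by noncomm_ring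
      _ = k' * (X * Y) * k := by rw [h']; noncomm_ring
  rw [trForm, trForm, e, Matrix.trace_mul_cycle, h', one_mul]

/-! ### The orthonormal basis -/

/-- The generators, numbered from `0`. -/
noncomputable def gE (k : Fin 14) : Mat7 := genC (k + 1)

theorem genW_mul_self (k : Fin 14) : genW k * genW k = (genV k : ℝ) / 3 := by
  rw [genW, genV]
  split_ifs
  · norm_num
  · rw [div_mul_div_comm, Real.mul_self_sqrt (by norm_num)]
    norm_num

theorem genW_ne_zero (k : Fin 14) : genW k ≠ 0 := by
  rw [genW]
  split_ifs
  · norm_num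
  · positivity

theorem gE_eq (k : Fin 14) : gE k = genW k • (genT k).map (Int.cast : ℤ → ℝ) := genC_eq k

theorem map_intCast_mul (A B : Matrix (Fin 7) (Fin 7) ℤ) :
    (A * B).map (Int.cast : ℤ → ℝ) = A.map (Int.cast : ℤ → ℝ) * B.map (Int.cast : ℤ → ℝ) :=
  Matrix.map_mul (f := Int.castRingHom ℝ)

theorem map_intCast_sum_smul (a : Fin 14 → ℤ) (A : Fin 14 → Matrix (Fin 7) (Fin 7) ℤ) :
    (∑ k, a k • A k).map (Int.cast : ℤ → ℝ) =
      ∑ k, (a k : ℝ) • (A k).map (Int.cast : ℤ → ℝ) := by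
  ext i j
  simp only [Matrix.map_apply, Matrix.sum_apply, Matrix.smul_apply, smul_eq_mul, Int.cast_sum,
    Int.cast_mul]

set_option maxHeartbeats 2000000 in
theorem g2Mat_eq_sum (x : Fin 14 → ℝ) :
    g2Mat x = ∑ k, x k • (genT k).map (Int.cast : ℤ → ℝ) := by
  ext i j
  simp only [Matrix.sum_apply, Matrix.smul_apply, Matrix.map_apply, Fin.sum_univ_succ]
  fin_cases i <;> fin_cases j <;> simp [g2Mat, genT, genCol, genEntry] <;> ring

theorem gE_mem_g2 (k : Fin 14) : gE k ∈ g2 := by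
  have e : (genT k).map (Int.cast : ℤ → ℝ) = g2Mat (Pi.single k 1) := by
    rw [g2Mat_eq_sum, Finset.sum_eq_single k]
    · simp
    · intro b _ hb
      simp [hb]
    · simp
  rw [gE_eq, e]
  exact g2.smul_mem _ (g2Mat_mem_g2 _)

theorem trForm_gE (j k : Fin 14) : trForm (gE j) (gE k) = if j = k then 1 else 0 := by
  have e : (genT j * genT k).trace = ((genT j * genT k).map (Int.cast : ℤ → ℝ)).trace := by
    simp [Matrix.trace]
  rw [map_intCast_mul, genT_trace] at e
  rw [trForm, gE_eq, gE_eq, smul_mul_smul_comm, Matrix.trace_smul, ← e]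
  split_ifs with h1 h2
  · subst h1
    rw [genW_mul_self, genV, if_pos h2]
    norm_num
  · subst h1
    rw [genW_mul_self, genV, if_neg h2]
    norm_num
  · simp

theorem sum_gE_mul_self : ∑ k, gE k * gE k = (-8 : ℝ) • 1 := by
  have e := congrArg (fun A => (1 / 3 : ℝ) • Matrix.map A (Int.cast : ℤ → ℝ)) genT_casimir
  simp only [map_intCast_sum_smul, map_intCast_mul] at e
  rw [Finset.smul_sum] at e
  convert e using 1
  · refine Finset.sum_congr rfl fun k _ => ?_
    rw [gE_eq, smul_mul_smul_comm, genW_mul_self, smul_smul]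
    ring_nf
  · ext i j
    simp only [Matrix.smul_apply, Matrix.map_apply, Matrix.one_apply, smul_eq_mul]
    split_ifs <;> norm_num

theorem sum_gE_sandwich_gE (j : Fin 14) : ∑ k, gE k * gE j * gE k = 0 := by
  have e := congrArg (fun A => (1 / 3 * genW j : ℝ) • Matrix.map A (Int.cast : ℤ → ℝ))
    (genT_sandwich j)
  simp only [map_intCast_sum_smul, map_intCast_mul] at e
  rw [Finset.smul_sum] at e
  convert e using 1
  · refine Finset.sum_congr rfl fun k _ => ?_
    rw [gE_eq, gE_eq, smul_mul_smul_comm, smul_mul_smul_comm, mul_right_comm, genW_mul_self,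
      smul_smul]
    ring_nf
  · ext i j
    simp

theorem sum_gE_sandwich_odd (j : Fin 14) (hj : genSign j = -1) :
    ∑ k, (if genSign k = -1 then (1 : ℝ) else 0) • (gE k * gE j * gE k) =
      (-2 / 3 : ℝ) • gE j := by
  have e := congrArg (fun A => (1 / 3 * genW j : ℝ) • Matrix.map A (Int.cast : ℤ → ℝ))
    (genT_sandwich_odd j hj)
  simp only [map_intCast_sum_smul, map_intCast_mul] at e
  rw [Finset.smul_sum] at e
  convert e using 1
  · refine Finset.sum_congr rfl fun k _ => ?_
    rw [gE_eq, gE_eq, smul_mul_smul_comm, smul_mul_smul_comm, mul_right_comm, genW_mul_self,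
      smul_smul, smul_smul]
    congr 1
    split_ifs
    · ring
    · simp
  · ext i l
    simp only [gE_eq, Matrix.smul_apply, Matrix.map_apply, smul_eq_mul]
    push_cast
    ring

theorem sum_gE_mul_self_odd :
    ∑ k, (if genSign k = -1 then (1 : ℝ) else 0) • (gE k * gE k) =
      Matrix.diagonal fun i => (-14 - 2 * involSign i : ℝ) / 3 := by
  have e := congrArg (fun A => (1 / 3 : ℝ) • Matrix.map A (Int.cast : ℤ → ℝ)) genT_casimir_odd
  simp only [map_intCast_sum_smul, map_intCast_mul] at e
  rw [Finset.smul_sum] at e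
  convert e using 1
  · refine Finset.sum_congr rfl fun k _ => ?_
    rw [gE_eq, smul_mul_smul_comm, genW_mul_self, smul_smul, smul_smul]
    congr 1
    split_ifs
    · ring
    · simp
  · ext i j
    simp [Matrix.diagonal_apply]
    split_ifs
    · ring
    · simp

theorem eq_sum_trForm_smul_gE {X : Mat7} (hX : X ∈ g2) : X = ∑ k, trForm X (gE k) • gE k := by
  obtain ⟨x, rfl⟩ := exists_eq_g2Mat hX
  have e : g2Mat x = ∑ k, (x k / genW k) • gE k := by
    rw [g2Mat_eq_sum]
    refine Finset.sum_congr rfl fun k _ => ?_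
    rw [gE_eq, smul_smul, div_mul_cancel₀ _ (genW_ne_zero k)]
  have c : ∀ k, trForm (g2Mat x) (gE k) = x k / genW k := by
    intro k
    rw [e, trForm_sum_left, Finset.sum_eq_single k]
    · rw [trForm_smul_left, trForm_gE, if_pos rfl, mul_one]
    · intro b _ hb
      rw [trForm_smul_left, trForm_gE, if_neg hb, mul_zero]
    · simp
  simp only [c]
  exact e

theorem trForm_eq_sum {X : Mat7} (hX : X ∈ g2) (Y : Mat7) :
    trForm X Y = ∑ k, trForm X (gE k) * trForm Y (gE k) := by
  conv_lhs => rw [eq_sum_trForm_smul_gE hX]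
  rw [trForm_sum_left]
  refine Finset.sum_congr rfl fun k _ => ?_
  rw [trForm_smul_left, trForm_comm (gE k)]

theorem trForm_self_nonneg {X : Mat7} (hX : X ∈ g2) : 0 ≤ trForm X X := by
  rw [trForm_eq_sum hX]
  exact Finset.sum_nonneg fun k _ => mul_self_nonneg _

theorem eq_zero_of_trForm_self {X : Mat7} (hX : X ∈ g2) (h : trForm X X = 0) : X = 0 := by
  rw [trForm_eq_sum hX, Finset.sum_eq_zero_iff_of_nonneg fun k _ => mul_self_nonneg _] at h
  rw [eq_sum_trForm_smul_gE hX]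
  refine Finset.sum_eq_zero fun k hk => ?_
  rw [mul_self_eq_zero.mp (h k hk), zero_smul]

theorem sum_gE_sandwich {Y : Mat7} (hY : Y ∈ g2) : ∑ k, gE k * Y * gE k = 0 := by
  have e : ∀ k, gE k * Y * gE k = ∑ j, trForm Y (gE j) • (gE k * gE j * gE k) := by
    intro k
    conv_lhs => rw [eq_sum_trForm_smul_gE hY, Finset.mul_sum, Finset.sum_mul]
    simp only [mul_smul_comm, smul_mul_assoc]
  simp only [e]
  rw [Finset.sum_comm]
  simp only [← Finset.smul_sum, sum_gE_sandwich_gE, smul_zero, Finset.sum_const_zero]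

/-- The generators form a basis of the Lie algebra. -/
noncomputable def g2Basis : Module.Basis (Fin 14) ℝ g2 :=
  Module.Basis.ofEquivFun
    { toFun := fun X k => trForm X (gE k)
      map_add' := fun X Y => funext fun k => trForm_add_left _ _ _
      map_smul' := fun c X => funext fun k => trForm_smul_left _ _ _
      invFun := fun c => ∑ k, c k • ⟨gE k, gE_mem_g2 k⟩
      left_inv := fun X => by
        refine Subtype.ext ?_
        conv_rhs => rw [eq_sum_trForm_smul_gE X.2]
        simp
      right_inv := fun c => by
        ext k
        have e : ((∑ j, c j • (⟨gE j, gE_mem_g2 j⟩ : g2) : g2) : Mat7) = ∑ j, c j • gE j := by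
          simp
        change trForm ((∑ j, c j • (⟨gE j, gE_mem_g2 j⟩ : g2) : g2) : Mat7) (gE k) = c k
        rw [e, trForm_sum_left]
        simp [trForm_smul_left, trForm_gE] }

theorem coe_g2Basis (k : Fin 14) : ((g2Basis k : g2) : Mat7) = gE k := by
  rw [g2Basis, Module.Basis.coe_ofEquivFun]
  change ((∑ j, (Pi.single k 1 : Fin 14 → ℝ) j • (⟨gE j, gE_mem_g2 j⟩ : g2) : g2) : Mat7) = gE k
  simp [Pi.single_apply]

theorem g2Basis_repr (X : g2) (k : Fin 14) : g2Basis.repr X k = trForm X (gE k) := rfl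

/-- The Killing form is computed as Σ(E_k, [X,[Y,E_k]]) in the orthonormal basis. The two Casimir
terms give 4 tr(XY), and the two sandwich terms vanish. -/
theorem invInner_eq (X Y : g2) : invInner X Y = trForm X Y := by
  have hk : killingForm ℝ g2 X Y = 4 * ((X : Mat7) * Y).trace := by
    rw [killingForm_apply_apply, LinearMap.trace_eq_matrix_trace ℝ g2Basis, Matrix.trace]
    have e : ∀ k, Matrix.diag (LinearMap.toMatrix g2Basis g2Basis
        (LieAlgebra.ad ℝ g2 X ∘ₗ LieAlgebra.ad ℝ g2 Y)) k = -(1 / 4) *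
          (((X : Mat7) * Y * (gE k * gE k)).trace + ((Y : Mat7) * X * (gE k * gE k)).trace
            - ((X : Mat7) * (gE k * Y * gE k)).trace - ((Y : Mat7) * (gE k * X * gE k)).trace) := by
      intro k
      rw [Matrix.diag_apply, LinearMap.toMatrix_apply, g2Basis_repr, LinearMap.comp_apply,
        LieAlgebra.ad_apply, LieAlgebra.ad_apply, LieSubalgebra.coe_bracket,
        LieSubalgebra.coe_bracket, coe_g2Basis, trForm, Ring.lie_def, Ring.lie_def]
      congr 1
      have t : ((Y : Mat7) * X * (gE k * gE k)).trace = (gE k * Y * X * gE k).trace := by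
        rw [← mul_assoc, Matrix.trace_mul_comm, ← mul_assoc, ← mul_assoc]
      rw [t]
      simp only [← Matrix.trace_add, ← Matrix.trace_sub]
      congr 1
      noncomm_ring
    rw [Finset.sum_congr rfl fun k _ => e k, ← Finset.mul_sum]
    simp only [Finset.sum_add_distrib, Finset.sum_sub_distrib, ← Matrix.trace_sum,
      ← Finset.mul_sum, sum_gE_mul_self, sum_gE_sandwich X.2, sum_gE_sandwich Y.2]
    simp only [mul_smul_comm, mul_one, mul_zero, Matrix.trace_smul, Matrix.trace_zero, smul_eq_mul]
    rw [Matrix.trace_mul_comm (Y : Mat7) X]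
    ring
  rw [invInner, hk, trForm]
  ring

/-! ### The involution and the splitting -/

/-- The matrix of the involution. -/
def involMat : Mat7 := Matrix.diagonal fun i => (involSign i : ℝ)

/-- The involution `X ↦ s X s`. -/
def theta (X : Mat7) : Mat7 := involMat * X * involMat

theorem theta_apply (X : Mat7) (i j : Fin 7) : theta X i j = involSign i * X i j * involSign j := by
  rw [theta, involMat, Matrix.mul_diagonal, Matrix.diagonal_mul]

theorem involSign_mul_self : ∀ i, involSign i * involSign i = 1 := by
  decide

theorem involMat_mul_self : involMat * involMat = 1 := by
  rw [involMat, Matrix.diagonal_mul_diagonal, ← Matrix.diagonal_one]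
  congr 1
  ext i
  exact_mod_cast involSign_mul_self i

theorem theta_theta (X : Mat7) : theta (theta X) = X := by
  rw [theta, theta]
  calc involMat * (involMat * X * involMat) * involMat
      = (involMat * involMat) * X * (involMat * involMat) := by noncomm_ring
    _ = X := by rw [involMat_mul_self, one_mul, mul_one]

theorem theta_mul (X Y : Mat7) : theta (X * Y) = theta X * theta Y := by
  symm
  calc involMat * X * involMat * (involMat * Y * involMat)
      = involMat * X * (involMat * involMat) * Y * involMat := by noncomm_ring
    _ = involMat * (X * Y) * involMat := by rw [involMat_mul_self]; noncomm_ring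

theorem theta_add (X Y : Mat7) : theta (X + Y) = theta X + theta Y := by
  simp only [theta, mul_add, add_mul]

theorem theta_sub (X Y : Mat7) : theta (X - Y) = theta X - theta Y := by
  simp only [theta, mul_sub, sub_mul]

theorem theta_smul (c : ℝ) (X : Mat7) : theta (c • X) = c • theta X := by
  simp only [theta, mul_smul_comm, smul_mul_assoc]

theorem theta_lie (X Y : Mat7) : theta ⁅X, Y⁆ = ⁅theta X, theta Y⁆ := by
  simp only [Ring.lie_def, theta_sub, theta_mul]

theorem theta_sum {ι : Type*} (s : Finset ι) (f : ι → Mat7) :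
    theta (∑ i ∈ s, f i) = ∑ i ∈ s, theta (f i) := by
  simp only [theta, Finset.mul_sum, Finset.sum_mul]

theorem trForm_theta (X Y : Mat7) : trForm (theta X) (theta Y) = trForm X Y :=
  trForm_conj involMat_mul_self X Y

theorem theta_gE (k : Fin 14) : theta (gE k) = (genSign k : ℝ) • gE k := by
  ext i j
  have e := genT_invol k i j
  rw [theta_apply, gE_eq]
  simp only [Matrix.smul_apply, Matrix.map_apply, smul_eq_mul]
  have e' : (involSign i : ℝ) * genT k i j * involSign j = genSign k * genT k i j := by
    exact_mod_cast e
  linear_combination genW k * e'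

theorem theta_mem_g2 {X : Mat7} (hX : X ∈ g2) : theta X ∈ g2 := by
  rw [eq_sum_trForm_smul_gE hX, theta_sum]
  refine g2.toSubmodule.sum_mem fun k _ => ?_
  rw [theta_smul, theta_gE]
  exact g2.smul_mem _ (g2.smul_mem _ (gE_mem_g2 k))

theorem involSign_eq (i : Fin 7) : (involSign i : ℝ) = if i < 3 then 1 else -1 := by
  rw [involSign]
  split_ifs <;> simp

theorem theta_eq_self_iff {X : Mat7} :
    theta X = X ↔ ∀ i j, ((i < 3 ∧ ¬j < 3) ∨ (¬i < 3 ∧ j < 3)) → X i j = 0 := by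
  rw [← Matrix.ext_iff]
  refine forall₂_congr fun i j => ?_
  rw [theta_apply, involSign_eq, involSign_eq]
  split_ifs with h1 h2 h2 <;> simp [h1, h2, neg_eq_self]

/-- Preserving ℍ kills the lower left block, skew-symmetry then kills the upper right one, and the
matrices with both blocks zero are those fixed by θ. -/
theorem mem_so4_iff (X : g2) : X ∈ so4 ↔ theta X = X := by
  rw [theta_eq_self_iff]
  constructor
  · intro h
    have low : ∀ i j : Fin 7, ¬i < 3 → j < 3 → (X : Mat7) i j = 0 := by
      intro i j hi hj
      have hH : octOf 0 (Pi.single j 1) ∈ canonicalH := by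
        change (octOf 0 (Pi.single j 1)).2 = 0
        fin_cases j
        · ext <;> simp [octOf]
        · ext <;> simp [octOf]
        · ext <;> simp [octOf]
        all_goals simp at hj
      have e : (derAct (X : Mat7) (octOf 0 (Pi.single j 1))).2 = 0 := h _ hH
      rw [derAct_octOf_single, Quaternion.ext_iff] at e
      obtain ⟨e3, e4, e5, e6⟩ := e
      fin_cases i
      · simp at hi
      · simp at hi
      · simp at hi
      exacts [e3, e4, e5, e6]
    rintro i j (⟨hi, hj⟩ | ⟨hi, hj⟩)
    · have e := congrFun₂ (transpose_eq_neg_of_mem_g2 X.2) j i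
      rw [Matrix.transpose_apply, Matrix.neg_apply, low j i hj hi, neg_zero] at e
      exact e
    · exact low i j hi hj
  · intro h x hx
    have hx2 : x.2 = 0 := hx
    have hu : ∀ j : Fin 7, ¬j < 3 → octIm x j = 0 := by
      intro j hj
      fin_cases j
      · simp at hj
      · simp at hj
      · simp at hj
      all_goals simp [octIm, hx2]
    have hv : ∀ i : Fin 7, ¬i < 3 → ((X : Mat7) *ᵥ octIm x) i = 0 := by
      intro i hi
      change ∑ j, (X : Mat7) i j * octIm x j = 0
      refine Finset.sum_eq_zero fun j _ => ?_
      by_cases hj : j < 3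
      · rw [h i j (Or.inr ⟨hi, hj⟩), zero_mul]
      · rw [hu j hj, mul_zero]
    change (octOf 0 ((X : Mat7) *ᵥ octIm x)).2 = 0
    exact Quaternion.ext_iff.mpr ⟨hv 3 (by decide), hv 4 (by decide), hv 5 (by decide),
      hv 6 (by decide)⟩

theorem trForm_eq_zero_of_theta {X Y : Mat7} (hX : theta X = X) (hY : theta Y = -Y) :
    trForm X Y = 0 := by
  have e := trForm_theta X Y
  rw [hX, hY, trForm_neg_right] at e
  linarith

/-- For X in 𝔪 the element X + θX lies in so(4), so it is orthogonal to X; as θ is an isometry it is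
also orthogonal to θX. It is therefore orthogonal to itself, and positivity makes it zero. -/
theorem mem_mm_iff (X : g2) : X ∈ mm ↔ theta X = -X := by
  constructor
  · intro h
    have hZ : (⟨X + theta X, g2.add_mem X.2 (theta_mem_g2 X.2)⟩ : g2) ∈ so4 := by
      rw [mem_so4_iff]
      simp only [theta_add, theta_theta]
      abel
    have e := h _ hZ
    rw [invInner_eq] at e
    have e2 := trForm_theta (X : Mat7) (X + theta X)
    rw [theta_add, theta_theta, add_comm (theta _), e] at e2
    have e3 : trForm (X + theta X) (X + theta X) = 0 := by
      rw [trForm_add_left, e, e2, add_zero]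
    have := eq_zero_of_trForm_self (g2.add_mem X.2 (theta_mem_g2 X.2)) e3
    exact eq_neg_of_add_eq_zero_right this
  · intro h Z hZ
    rw [mem_so4_iff] at hZ
    rw [invInner_eq, trForm_comm, trForm_eq_zero_of_theta hZ h]

theorem lie_mem_so4_of_so4 (X : g2) (hX : X ∈ so4) (Y : g2) (hY : Y ∈ so4) : ⁅X, Y⁆ ∈ so4 := by
  rw [mem_so4_iff] at *
  rw [LieSubalgebra.coe_bracket, theta_lie, hX, hY]

theorem lie_mem_mm (X : g2) (hX : X ∈ so4) (Y : g2) (hY : Y ∈ mm) : ⁅X, Y⁆ ∈ mm := by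
  rw [mem_so4_iff] at hX
  rw [mem_mm_iff] at *
  rw [LieSubalgebra.coe_bracket, theta_lie, hX, hY, lie_neg]

theorem lie_mem_so4_of_mm (X : g2) (hX : X ∈ mm) (Y : g2) (hY : Y ∈ mm) : ⁅X, Y⁆ ∈ so4 := by
  rw [mem_mm_iff] at *
  rw [mem_so4_iff, LieSubalgebra.coe_bracket, theta_lie, hX, hY, neg_lie, lie_neg, neg_neg]

/-- The part of a matrix that is odd under the involution. -/
noncomputable def oddPart (X : Mat7) : Mat7 := (1 / 2 : ℝ) • (X - theta X)

/-- The part of a matrix that is even under the involution. -/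
noncomputable def evenPart (X : Mat7) : Mat7 := (1 / 2 : ℝ) • (X + theta X)

theorem oddPart_add_evenPart (X : Mat7) : oddPart X + evenPart X = X := by
  rw [oddPart, evenPart, ← smul_add]
  module

theorem theta_oddPart (X : Mat7) : theta (oddPart X) = -oddPart X := by
  rw [oddPart, theta_smul, theta_sub, theta_theta, ← smul_neg, neg_sub]

theorem theta_evenPart (X : Mat7) : theta (evenPart X) = evenPart X := by
  rw [evenPart, theta_smul, theta_add, theta_theta, add_comm]

theorem oddPart_mem_g2 {X : Mat7} (hX : X ∈ g2) : oddPart X ∈ g2 :=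
  g2.smul_mem _ (g2.sub_mem hX (theta_mem_g2 hX))

theorem evenPart_mem_g2 {X : Mat7} (hX : X ∈ g2) : evenPart X ∈ g2 :=
  g2.smul_mem _ (g2.add_mem hX (theta_mem_g2 hX))

theorem eq_zero_of_theta {X : Mat7} (h : theta X = X) (h' : theta X = -X) : X = 0 := by
  ext i j
  have e := congrFun₂ (h.symm.trans h') i j
  rw [Matrix.neg_apply] at e
  rw [Matrix.zero_apply]
  linarith

theorem isCompl_so4_mm : IsCompl so4 mm := by
  constructor
  · rw [Submodule.disjoint_def]
    intro X h h'
    rw [mem_so4_iff] at h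
    rw [mem_mm_iff] at h'
    exact Subtype.ext (eq_zero_of_theta h h')
  · rw [codisjoint_iff, Submodule.eq_top_iff']
    intro X
    refine Submodule.mem_sup.mpr ⟨⟨_, evenPart_mem_g2 X.2⟩, ?_, ⟨_, oddPart_mem_g2 X.2⟩, ?_, ?_⟩
    · rw [mem_so4_iff]
      exact theta_evenPart _
    · rw [mem_mm_iff]
      exact theta_oddPart _
    · refine Subtype.ext ?_
      change evenPart (X : Mat7) + oddPart X = X
      rw [add_comm, oddPart_add_evenPart]

/-- The splitting exists and is unique, so on 𝔤₂ the default value is not used and whatever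
component is chosen must be the odd part. -/
theorem horizontalPart_mem_mm_and_coe {A : Mat7} (hA : A ∈ g2) :
    horizontalPart A ∈ mm ∧ (horizontalPart A : Mat7) = oddPart A := by
  have h : ∃ X : g2, X ∈ mm ∧ ∃ Z ∈ so4, A = (X : Mat7) + (Z : Mat7) :=
    ⟨⟨_, oddPart_mem_g2 hA⟩, (mem_mm_iff _).mpr (theta_oddPart _), ⟨_, evenPart_mem_g2 hA⟩,
      (mem_so4_iff _).mpr (theta_evenPart _), (oddPart_add_evenPart A).symm⟩
  rw [horizontalPart, dif_pos h]
  obtain ⟨h1, Z, hZ, e⟩ := h.choose_spec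
  refine ⟨h1, ?_⟩
  rw [mem_mm_iff] at h1
  rw [mem_so4_iff] at hZ
  conv_rhs => rw [e]
  rw [oddPart, theta_add, h1, hZ]
  module

theorem genSign_cases : ∀ k, genSign k = 1 ∨ genSign k = -1 := by
  decide

theorem trForm_gE_eq_zero_of_theta {X : Mat7} (hX : theta X = X) {k : Fin 14}
    (hk : genSign k = -1) : trForm X (gE k) = 0 :=
  trForm_eq_zero_of_theta hX (by rw [theta_gE, hk]; simp)

theorem trForm_gE_eq_zero_of_theta_neg {X : Mat7} (hX : theta X = -X) {k : Fin 14}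
    (hk : genSign k = 1) : trForm X (gE k) = 0 := by
  rw [trForm_comm]
  exact trForm_eq_zero_of_theta (by rw [theta_gE, hk]; simp) hX

theorem exists_of_mem_latin {n : ℕ} (h : n ∈ latin) : ∃ k : Fin 14, n = k + 1 ∧ genSign k = 1 := by
  simp only [latin, Set.mem_insert_iff, Set.mem_singleton_iff] at h
  rcases h with rfl | rfl | rfl | rfl | rfl | rfl
  exacts [⟨0, rfl, rfl⟩, ⟨1, rfl, rfl⟩, ⟨2, rfl, rfl⟩, ⟨7, rfl, rfl⟩, ⟨8, rfl, rfl⟩, ⟨9, rfl, rfl⟩]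

theorem exists_of_mem_greek {n : ℕ} (h : n ∈ greek) :
    ∃ k : Fin 14, n = k + 1 ∧ genSign k = -1 := by
  simp only [greek, Set.mem_insert_iff, Set.mem_singleton_iff] at h
  rcases h with rfl | rfl | rfl | rfl | rfl | rfl | rfl | rfl
  exacts [⟨3, rfl, rfl⟩, ⟨4, rfl, rfl⟩, ⟨5, rfl, rfl⟩, ⟨6, rfl, rfl⟩, ⟨10, rfl, rfl⟩,
    ⟨11, rfl, rfl⟩, ⟨12, rfl, rfl⟩, ⟨13, rfl, rfl⟩]

theorem mem_latin_of_genSign {k : Fin 14} (h : genSign k = 1) : (k : ℕ) + 1 ∈ latin := by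
  fin_cases k <;> simp [latin, genSign] at h ⊢

theorem mem_greek_of_genSign {k : Fin 14} (h : genSign k = -1) : (k : ℕ) + 1 ∈ greek := by
  fin_cases k <;> simp [greek, genSign] at h ⊢

theorem so4_map_incl :
    so4.map (g2.incl : g2 →ₗ[ℝ] Mat7) = Submodule.span ℝ (genC '' latin) := by
  refine le_antisymm ?_ (Submodule.span_le.mpr ?_)
  · rintro _ ⟨X, hX, rfl⟩
    change (X : Mat7) ∈ _
    have hX' := (mem_so4_iff X).mp hX
    rw [eq_sum_trForm_smul_gE X.2]
    refine Submodule.sum_mem _ fun k _ => ?_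
    rcases genSign_cases k with hk | hk
    · exact Submodule.smul_mem _ _
        (Submodule.subset_span ⟨_, mem_latin_of_genSign hk, rfl⟩)
    · rw [trForm_gE_eq_zero_of_theta hX' hk, zero_smul]
      exact Submodule.zero_mem _
  · rintro _ ⟨n, hn, rfl⟩
    obtain ⟨k, rfl, hk⟩ := exists_of_mem_latin hn
    refine ⟨⟨gE k, gE_mem_g2 k⟩, ?_, rfl⟩
    refine (mem_so4_iff _).mpr ?_
    change theta (gE k) = gE k
    rw [theta_gE, hk]
    simp

theorem mm_map_incl :
    mm.map (g2.incl : g2 →ₗ[ℝ] Mat7) = Submodule.span ℝ (genC '' greek) := by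
  refine le_antisymm ?_ (Submodule.span_le.mpr ?_)
  · rintro _ ⟨X, hX, rfl⟩
    change (X : Mat7) ∈ _
    have hX' := (mem_mm_iff X).mp hX
    rw [eq_sum_trForm_smul_gE X.2]
    refine Submodule.sum_mem _ fun k _ => ?_
    rcases genSign_cases k with hk | hk
    · rw [trForm_gE_eq_zero_of_theta_neg hX' hk, zero_smul]
      exact Submodule.zero_mem _
    · exact Submodule.smul_mem _ _
        (Submodule.subset_span ⟨_, mem_greek_of_genSign hk, rfl⟩)
  · rintro _ ⟨n, hn, rfl⟩
    obtain ⟨k, rfl, hk⟩ := exists_of_mem_greek hn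
    refine ⟨⟨gE k, gE_mem_g2 k⟩, ?_, rfl⟩
    refine (mem_mm_iff _).mpr ?_
    change theta (gE k) = -gE k
    rw [theta_gE, hk]
    simp

theorem invInner_generators (I : ℕ) (hI : I ∈ latin ∪ greek) (J : ℕ) (hJ : J ∈ latin ∪ greek)
    (X Y : g2) (hX : (X : Mat7) = genC I) (hY : (Y : Mat7) = genC J) :
    invInner X Y = if I = J then 1 else 0 := by
  have ex : ∀ n ∈ latin ∪ greek, ∃ k : Fin 14, n = k + 1 := by
    rintro n (h | h)
    · obtain ⟨k, hk, -⟩ := exists_of_mem_latin h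
      exact ⟨k, hk⟩
    · obtain ⟨k, hk, -⟩ := exists_of_mem_greek h
      exact ⟨k, hk⟩
  obtain ⟨j, rfl⟩ := ex I hI
  obtain ⟨k, rfl⟩ := ex J hJ
  rw [invInner_eq, hX, hY]
  refine (trForm_gE j k).trans ?_
  simp [Fin.ext_iff]

/-! ### Partial derivatives of functions -/

section Scalar

variable {U : Set (Fin 8 → ℝ)} {a : Fin 8 → ℝ} {f g : (Fin 8 → ℝ) → ℝ}

theorem differentiableAt_of_contDiffOn (hU : IsOpen U) (ha : a ∈ U) (hf : ContDiffOn ℝ ∞ f U) :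
    DifferentiableAt ℝ f a :=
  (hf.contDiffAt (hU.mem_nhds ha)).differentiableAt (by simp)

theorem pd_add (hf : DifferentiableAt ℝ f a) (hg : DifferentiableAt ℝ g a) (i : Fin 8) :
    pd (fun b => f b + g b) i a = pd f i a + pd g i a := by
  rw [pd, fderiv_fun_add hf hg]
  rfl

theorem pd_mul (hf : DifferentiableAt ℝ f a) (hg : DifferentiableAt ℝ g a) (i : Fin 8) :
    pd (fun b => f b * g b) i a = pd f i a * g a + f a * pd g i a := by
  rw [pd, fderiv_fun_mul hf hg]
  simp [pd]
  ring

theorem pd_const (c : ℝ) (i : Fin 8) : pd (fun _ => c) i a = 0 := by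
  simp [pd]

theorem pd_const_mul (hf : DifferentiableAt ℝ f a) (c : ℝ) (i : Fin 8) :
    pd (fun b => c * f b) i a = c * pd f i a := by
  rw [pd_mul (differentiableAt_const c) hf, pd_const, zero_mul, zero_add]

theorem pd_sum {ι : Type*} (s : Finset ι) {F : ι → (Fin 8 → ℝ) → ℝ}
    (hF : ∀ k ∈ s, DifferentiableAt ℝ (F k) a) (i : Fin 8) :
    pd (fun b => ∑ k ∈ s, F k b) i a = ∑ k ∈ s, pd (F k) i a := by
  rw [pd, fderiv_fun_sum hF]
  simp [pd]

theorem pd_congr (hU : IsOpen U) (ha : a ∈ U) (h : ∀ b ∈ U, f b = g b) (i : Fin 8) :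
    pd f i a = pd g i a := by
  rw [pd, pd, Filter.EventuallyEq.fderiv_eq (Filter.eventuallyEq_of_mem (hU.mem_nhds ha) h)]

theorem contDiffOn_pd (hU : IsOpen U) (hf : ContDiffOn ℝ ∞ f U) (i : Fin 8) :
    ContDiffOn ℝ ∞ (pd f i) U :=
  (hf.fderiv_of_isOpen (m := ∞) hU (by simp)).clm_apply contDiffOn_const

theorem pd_comm (hU : IsOpen U) (ha : a ∈ U) (hf : ContDiffOn ℝ ∞ f U) (i j : Fin 8) :
    pd (pd f i) j a = pd (pd f j) i a := by
  have hd : DifferentiableAt ℝ (fderiv ℝ f) a :=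
    ((hf.fderiv_of_isOpen (m := ∞) hU (by simp)).contDiffAt (hU.mem_nhds ha)).differentiableAt
      (by simp)
  have e : ∀ k l, pd (pd f k) l a = fderiv ℝ (fderiv ℝ f) a (Pi.single l 1) (Pi.single k 1) := by
    intro k l
    change fderiv ℝ (fun b => fderiv ℝ f b (Pi.single k 1)) a (Pi.single l 1) = _
    rw [fderiv_clm_apply hd (differentiableAt_const _)]
    simp
  rw [e, e]
  exact ((hf.contDiffAt (hU.mem_nhds ha)).isSymmSndFDerivAt
    (by
      rw [minSmoothness_of_isRCLikeNormedField]
      exact WithTop.coe_le_coe.mpr (le_top (a := (2 : ℕ∞))))) _ _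

end Scalar

/-! ### Partial derivatives of matrices -/

/-- Entrywise partial derivative. -/
noncomputable def mpd (F : (Fin 8 → ℝ) → Mat7) (i : Fin 8) (a : Fin 8 → ℝ) : Mat7 :=
  Matrix.of fun r s => pd (fun b => F b r s) i a

/-- Entrywise smoothness. -/
def MSmooth (F : (Fin 8 → ℝ) → Mat7) (U : Set (Fin 8 → ℝ)) : Prop :=
  ∀ r s, ContDiffOn ℝ ∞ (fun a => F a r s) U

section Mat

variable {U : Set (Fin 8 → ℝ)} {a : Fin 8 → ℝ} {F G : (Fin 8 → ℝ) → Mat7}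

theorem mSmooth_const (M : Mat7) : MSmooth (fun _ => M) U := fun _ _ => contDiffOn_const

theorem MSmooth.add (hF : MSmooth F U) (hG : MSmooth G U) : MSmooth (fun b => F b + G b) U :=
  fun r s => (hF r s).add (hG r s)

theorem MSmooth.sub (hF : MSmooth F U) (hG : MSmooth G U) : MSmooth (fun b => F b - G b) U :=
  fun r s => (hF r s).sub (hG r s)

theorem MSmooth.mul (hF : MSmooth F U) (hG : MSmooth G U) : MSmooth (fun b => F b * G b) U := by
  intro r s
  simp only [Matrix.mul_apply]
  exact ContDiffOn.sum fun k _ => (hF r k).mul (hG k s)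

theorem MSmooth.smul {c : (Fin 8 → ℝ) → ℝ} (hc : ContDiffOn ℝ ∞ c U) (hF : MSmooth F U) :
    MSmooth (fun b => c b • F b) U :=
  fun r s => hc.mul (hF r s)

theorem MSmooth.transpose (hF : MSmooth F U) : MSmooth (fun b => (F b)ᵀ) U :=
  fun r s => hF s r

theorem MSmooth.congr (hF : MSmooth F U) (h : ∀ b ∈ U, G b = F b) : MSmooth G U :=
  fun r s => (hF r s).congr fun b hb => by rw [h b hb]

theorem MSmooth.mpd (hU : IsOpen U) (hF : MSmooth F U) (i : Fin 8) : MSmooth (mpd F i) U :=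
  fun r s => contDiffOn_pd hU (hF r s) i

theorem MSmooth.theta (hF : MSmooth F U) : MSmooth (fun b => theta (F b)) U :=
  ((mSmooth_const _).mul hF).mul (mSmooth_const _)

theorem MSmooth.oddPart (hF : MSmooth F U) : MSmooth (fun b => oddPart (F b)) U :=
  MSmooth.smul contDiffOn_const (hF.sub hF.theta)

theorem MSmooth.evenPart (hF : MSmooth F U) : MSmooth (fun b => evenPart (F b)) U :=
  MSmooth.smul contDiffOn_const (hF.add hF.theta)

theorem MSmooth.lie (hF : MSmooth F U) (hG : MSmooth G U) : MSmooth (fun b => ⁅F b, G b⁆) U :=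
  (hF.mul hG).sub (hG.mul hF)

theorem MSmooth.trForm (hF : MSmooth F U) (hG : MSmooth G U) :
    ContDiffOn ℝ ∞ (fun b => trForm (F b) (G b)) U :=
  contDiffOn_const.mul (ContDiffOn.sum fun r _ => hF.mul hG r r)

theorem MSmooth.differentiableAt (hF : MSmooth F U) (hU : IsOpen U) (ha : a ∈ U) (r s : Fin 7) :
    DifferentiableAt ℝ (fun b => F b r s) a :=
  differentiableAt_of_contDiffOn hU ha (hF r s)

theorem mpd_congr (hU : IsOpen U) (ha : a ∈ U) (h : ∀ b ∈ U, F b = G b) (i : Fin 8) :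
    mpd F i a = mpd G i a := by
  ext r s
  exact pd_congr hU ha (fun b hb => by rw [h b hb]) i

theorem mpd_comm (hU : IsOpen U) (ha : a ∈ U) (hF : MSmooth F U) (i j : Fin 8) :
    mpd (mpd F i) j a = mpd (mpd F j) i a := by
  ext r s
  exact pd_comm hU ha (hF r s) i j

theorem mpd_transpose (F : (Fin 8 → ℝ) → Mat7) (i : Fin 8) (a : Fin 8 → ℝ) :
    mpd (fun b => (F b)ᵀ) i a = (mpd F i a)ᵀ := rfl

theorem mpd_const (M : Mat7) (i : Fin 8) : mpd (fun _ => M) i a = 0 := by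
  ext r s
  exact pd_const _ i

theorem mpd_add_of_differentiableAt (hF : ∀ r s, DifferentiableAt ℝ (fun b => F b r s) a)
    (hG : ∀ r s, DifferentiableAt ℝ (fun b => G b r s) a) (i : Fin 8) :
    mpd (fun b => F b + G b) i a = mpd F i a + mpd G i a := by
  ext r s
  exact pd_add (hF r s) (hG r s) i

theorem mpd_mul_of_differentiableAt (hF : ∀ r s, DifferentiableAt ℝ (fun b => F b r s) a)
    (hG : ∀ r s, DifferentiableAt ℝ (fun b => G b r s) a) (i : Fin 8) :
    mpd (fun b => F b * G b) i a = mpd F i a * G a + F a * mpd G i a := by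
  ext r s
  simp only [mpd, Matrix.of_apply, Matrix.mul_apply, Matrix.add_apply]
  rw [pd_sum _ fun k _ => (hF r k).fun_mul (hG k s), ← Finset.sum_add_distrib]
  exact Finset.sum_congr rfl fun k _ => pd_mul (hF r k) (hG k s) i

theorem mpd_add (hU : IsOpen U) (ha : a ∈ U) (hF : MSmooth F U) (hG : MSmooth G U) (i : Fin 8) :
    mpd (fun b => F b + G b) i a = mpd F i a + mpd G i a :=
  mpd_add_of_differentiableAt (hF.differentiableAt hU ha) (hG.differentiableAt hU ha) i

theorem mpd_mul (hU : IsOpen U) (ha : a ∈ U) (hF : MSmooth F U) (hG : MSmooth G U) (i : Fin 8) :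
    mpd (fun b => F b * G b) i a = mpd F i a * G a + F a * mpd G i a :=
  mpd_mul_of_differentiableAt (hF.differentiableAt hU ha) (hG.differentiableAt hU ha) i

theorem mpd_smul (hU : IsOpen U) (ha : a ∈ U) {c : (Fin 8 → ℝ) → ℝ} (hc : ContDiffOn ℝ ∞ c U)
    (hF : MSmooth F U) (i : Fin 8) :
    mpd (fun b => c b • F b) i a = pd c i a • F a + c a • mpd F i a := by
  ext r s
  exact pd_mul (differentiableAt_of_contDiffOn hU ha hc) (hF.differentiableAt hU ha r s) i

theorem mpd_const_smul (hU : IsOpen U) (ha : a ∈ U) (hF : MSmooth F U) (c : ℝ) (i : Fin 8) :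
    mpd (fun b => c • F b) i a = c • mpd F i a := by
  rw [mpd_smul hU ha contDiffOn_const hF, pd_const, zero_smul, zero_add]

theorem mpd_sub (hU : IsOpen U) (ha : a ∈ U) (hF : MSmooth F U) (hG : MSmooth G U) (i : Fin 8) :
    mpd (fun b => F b - G b) i a = mpd F i a - mpd G i a := by
  have e : (fun b => F b - G b) = fun b => F b + (-1 : ℝ) • G b := by
    funext b
    module
  rw [e, mpd_add hU ha hF (MSmooth.smul contDiffOn_const hG), mpd_const_smul hU ha hG]
  module

theorem mpd_sum (hU : IsOpen U) (ha : a ∈ U) {ι : Type*} (s : Finset ι)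
    {F : ι → (Fin 8 → ℝ) → Mat7} (hF : ∀ k, MSmooth (F k) U) (i : Fin 8) :
    mpd (fun b => ∑ k ∈ s, F k b) i a = ∑ k ∈ s, mpd (F k) i a := by
  ext r t
  simp only [mpd, Matrix.of_apply, Matrix.sum_apply]
  exact pd_sum _ (fun k _ => (hF k).differentiableAt hU ha r t) i

theorem mpd_theta (hU : IsOpen U) (ha : a ∈ U) (hF : MSmooth F U) (i : Fin 8) :
    mpd (fun b => theta (F b)) i a = theta (mpd F i a) := by
  simp only [theta]
  rw [mpd_mul hU ha ((mSmooth_const _).mul hF) (mSmooth_const _),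
    mpd_mul hU ha (mSmooth_const _) hF, mpd_const]
  simp

theorem mpd_oddPart (hU : IsOpen U) (ha : a ∈ U) (hF : MSmooth F U) (i : Fin 8) :
    mpd (fun b => oddPart (F b)) i a = oddPart (mpd F i a) := by
  simp only [oddPart]
  rw [mpd_const_smul hU ha (hF.sub hF.theta), mpd_sub hU ha hF hF.theta, mpd_theta hU ha hF]

theorem mpd_evenPart (hU : IsOpen U) (ha : a ∈ U) (hF : MSmooth F U) (i : Fin 8) :
    mpd (fun b => evenPart (F b)) i a = evenPart (mpd F i a) := by
  simp only [evenPart]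
  rw [mpd_const_smul hU ha (hF.add hF.theta), mpd_add hU ha hF hF.theta, mpd_theta hU ha hF]

theorem mpd_lie (hU : IsOpen U) (ha : a ∈ U) (hF : MSmooth F U) (hG : MSmooth G U) (i : Fin 8) :
    mpd (fun b => ⁅F b, G b⁆) i a = ⁅mpd F i a, G a⁆ + ⁅F a, mpd G i a⁆ := by
  simp only [Ring.lie_def]
  rw [mpd_sub hU ha (hF.mul hG) (hG.mul hF), mpd_mul hU ha hF hG, mpd_mul hU ha hG hF]
  abel

theorem pd_trForm (hU : IsOpen U) (ha : a ∈ U) (hF : MSmooth F U) (hG : MSmooth G U)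
    (i : Fin 8) : pd (fun b => trForm (F b) (G b)) i a =
      trForm (mpd F i a) (G a) + trForm (F a) (mpd G i a) := by
  have hd := (hF.mul hG).differentiableAt hU ha
  simp only [trForm, Matrix.trace, Matrix.diag_apply]
  rw [pd_const_mul (DifferentiableAt.fun_sum fun r _ => hd r r), pd_sum _ fun r _ => hd r r]
  have e : ∀ r, pd (fun b => (F b * G b) r r) i a =
      (mpd F i a * G a) r r + (F a * mpd G i a) r r := fun r => by
    rw [← Matrix.add_apply, ← mpd_mul hU ha hF hG]
    rfl
  simp only [e, Finset.sum_add_distrib, mul_add]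

/-- Expanded in the constant generators, only the coefficients are differentiated. -/
theorem mpd_mem_g2 (hU : IsOpen U) (ha : a ∈ U) (hF : MSmooth F U) (h : ∀ b ∈ U, F b ∈ g2)
    (i : Fin 8) : mpd F i a ∈ g2 := by
  have hs : ∀ k, ContDiffOn ℝ ∞ (fun b => trForm (F b) (gE k)) U :=
    fun k => hF.trForm (mSmooth_const _)
  rw [mpd_congr hU ha (fun b hb => eq_sum_trForm_smul_gE (h b hb)),
    mpd_sum hU ha _ fun k => MSmooth.smul (hs k) (mSmooth_const _)]
  refine g2.toSubmodule.sum_mem fun k _ => ?_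
  rw [mpd_smul hU ha (hs k) (mSmooth_const _), mpd_const, smul_zero, add_zero]
  exact g2.smul_mem _ (gE_mem_g2 k)

end Mat

/-! ### Derivatives of curves of automorphisms -/

theorem hasDerivAt_octMul {x y : ℝ → Octonion} {x' y' : Octonion} {t : ℝ}
    (hx : HasDerivAt x x' t) (hy : HasDerivAt y y' t) :
    HasDerivAt (fun u => octMul (x u) (y u)) (octMul x' (y t) + octMul (x t) y') t := by
  have hx1 : HasDerivAt (fun u => (x u).1) x'.1 t :=
    (hasFDerivAt_fst (𝕜 := ℝ) (p := x t)).comp_hasDerivAt t hx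
  have hx2 : HasDerivAt (fun u => (x u).2) x'.2 t :=
    (hasFDerivAt_snd (𝕜 := ℝ) (p := x t)).comp_hasDerivAt t hx
  have hy1 : HasDerivAt (fun u => (y u).1) y'.1 t :=
    (hasFDerivAt_fst (𝕜 := ℝ) (p := y t)).comp_hasDerivAt t hy
  have hy2 : HasDerivAt (fun u => (y u).2) y'.2 t :=
    (hasFDerivAt_snd (𝕜 := ℝ) (p := y t)).comp_hasDerivAt t hy
  have : StarModule ℝ ℍ[ℝ] := ⟨fun r q => by rw [Quaternion.star_smul, star_trivial r]⟩
  have h := ((hx1.fun_mul hy1).fun_sub (hy2.star.fun_mul hx2)).prodMk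
    ((hy2.fun_mul hx1).fun_add (hx2.fun_mul hy1.star))
  refine h.congr_deriv ?_
  refine Prod.ext ?_ ?_ <;> simp only [octMul, Prod.fst_add, Prod.snd_add] <;> abel

theorem octOf_eq_sum (t : ℝ) (u : Fin 7 → ℝ) :
    octOf t u = octOf t 0 + ∑ i, u i • octOf 0 (Pi.single i 1) := by
  have hs : ∀ s : Finset (Fin 7), ∑ i ∈ s, u i • octOf 0 (Pi.single i 1) =
      octOf 0 (∑ i ∈ s, u i • (Pi.single i 1 : Fin 7 → ℝ)) := by
    intro s
    induction s using Finset.induction_on with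
    | empty => simp; rfl
    | insert i s hi ih =>
      rw [Finset.sum_insert hi, Finset.sum_insert hi, ih, ← octOf_smul, mul_zero, ← octOf_add,
        add_zero]
  rw [hs, ← octOf_add, add_zero, zero_add]
  congr 1
  ext j
  simp [Pi.single_apply]

/-- The hypotheses concern entries and coordinates only, so that no norm on matrices enters. -/
theorem hasDerivAt_autAct {M : ℝ → Mat7} {M' : Mat7} {t : ℝ}
    (hM : ∀ r s, HasDerivAt (fun u => M u r s) (M' r s) t) {x : ℝ → Octonion} {x' : Octonion}
    (hx : ∀ j, HasDerivAt (fun u => octIm (x u) j) (octIm x' j) t)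
    (hx0 : HasDerivAt (fun u => (x u).1.re) x'.1.re t) :
    HasDerivAt (fun u => autAct (M u) (x u)) (derAct M' (x t) + autAct (M t) x') t := by
  have h : ∀ i, HasDerivAt (fun u => (M u *ᵥ octIm (x u)) i)
      ((M' *ᵥ octIm (x t)) i + (M t *ᵥ octIm x') i) t := by
    intro i
    simp only [Matrix.mulVec, dotProduct]
    rw [← Finset.sum_add_distrib]
    exact HasDerivAt.fun_sum fun j _ => (hM i j).mul (hx j)
  have e : ∀ s, octOf s (0 : Fin 7 → ℝ) = s • ((1, 0) : Octonion) := fun s => by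
    ext <;> simp [re_octOf, fst_imI_octOf, fst_imJ_octOf, fst_imK_octOf, snd_re_octOf,
      snd_imI_octOf, snd_imJ_octOf, snd_imK_octOf]
  simp only [autAct, derAct, ← octOf_add, zero_add]
  rw [octOf_eq_sum, e]
  simp only [octOf_eq_sum _ (_ *ᵥ _), e]
  exact (hx0.smul_const _).add (HasDerivAt.fun_sum fun i _ => (h i).smul_const _)

/-- Differentiating φ(xy) = φ(x)φ(y) along a coordinate line gives a twisted Leibniz rule for ∂φ;
applying the automorphism φ⁻¹ untwists it. -/
theorem current_mem_g2 {U : Set (Fin 8 → ℝ)} {a : Fin 8 → ℝ} {φ : (Fin 8 → ℝ) → Mat7}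
    (hU : IsOpen U) (ha : a ∈ U) (hmem : ∀ b ∈ U, φ b ∈ G2) (hφ : MSmooth φ U) (i : Fin 8) :
    current φ i a ∈ g2 := by
  obtain ⟨γ, hγ⟩ : ∃ γ : ℝ → (Fin 8 → ℝ), γ = fun t => a + t • Pi.single i 1 := ⟨_, rfl⟩
  have hγ0 : γ 0 = a := by simp [hγ]
  have hγd : HasDerivAt γ (Pi.single i 1) 0 := by
    rw [hγ]
    simpa using ((hasDerivAt_id (0 : ℝ)).smul_const (Pi.single i (1 : ℝ))).const_add a
  have hM : ∀ r s, HasDerivAt (fun t => φ (γ t) r s) (mpd φ i a r s) 0 := by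
    intro r s
    have h1 : HasFDerivAt (fun b => φ b r s) (fderiv ℝ (fun b => φ b r s) a) (γ 0) := by
      rw [hγ0]
      exact (hφ.differentiableAt hU ha r s).hasFDerivAt
    exact h1.comp_hasDerivAt 0 hγd
  have hA : ∀ x, HasDerivAt (fun t => autAct (φ (γ t)) x) (derAct (mpd φ i a) x) 0 := by
    intro x
    have h := hasDerivAt_autAct hM (x := fun _ => x) (x' := 0)
      (fun j => by
        have : octIm 0 j = 0 := by fin_cases j <;> rfl
        rw [this]
        exact hasDerivAt_const _ _) (hasDerivAt_const _ _)
    have e : autAct (φ (γ 0)) 0 = 0 := by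
      have := autAct_smul (φ (γ 0)) 0 0
      rwa [zero_smul, zero_smul] at this
    rwa [e, add_zero] at h
  have key : ∀ x y, derAct (mpd φ i a) (octMul x y) =
      octMul (derAct (mpd φ i a) x) (autAct (φ a) y) +
        octMul (autAct (φ a) x) (derAct (mpd φ i a) y) := by
    intro x y
    have h := hasDerivAt_octMul (hA x) (hA y)
    rw [hγ0] at h
    refine (hA (octMul x y)).unique (h.congr_of_eventuallyEq ?_)
    have hU' : ∀ᶠ t in nhds 0, γ t ∈ U :=
      hγd.continuousAt.eventually_mem (by rw [hγ0]; exact hU.mem_nhds ha)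
    filter_upwards [hU'] with t ht
    exact (hmem _ ht).2 x y
  have hg := hmem a ha
  have hc : ∀ x, derAct (current φ i a) x = autAct (φ a)⁻¹ (derAct (mpd φ i a) x) := by
    intro x
    rw [autAct, octIm_derAct, Matrix.mulVec_mulVec]
    rfl
  intro x y
  rw [hc, hc, hc, key, autAct_add, (inv_mem_G2 hg).2, (inv_mem_G2 hg).2, autAct_inv_autAct hg,
    autAct_inv_autAct hg]

/-! ### The odd part of the Lie algebra -/

/-- The generators that are odd under the involution. -/
noncomputable def oddGen (k : {k : Fin 14 // genSign k = -1}) : mm :=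
  ⟨⟨gE k, gE_mem_g2 k⟩, (mem_mm_iff _).mpr (by
    rw [theta_gE, k.2]
    simp)⟩

theorem coe_sum_oddGen (c : {k : Fin 14 // genSign k = -1} → ℝ) :
    (((∑ k, c k • oddGen k : mm) : g2) : Mat7) = ∑ k, c k • gE k := by
  simp [oddGen]

theorem sum_genSign_subtype {M : Type*} [AddCommMonoid M] (f : Fin 14 → M) :
    ∑ k : {k : Fin 14 // genSign k = -1}, f k = ∑ k, if genSign k = -1 then f k else 0 := by
  rw [← Finset.sum_filter]
  exact (Finset.sum_subtype _ (by simp) f).symm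

/-- The odd generators form a basis of the odd part. -/
noncomputable def mmBasis : Module.Basis {k : Fin 14 // genSign k = -1} ℝ mm :=
  Module.Basis.ofEquivFun
    { toFun := fun X k => trForm ((X : g2) : Mat7) (gE k)
      map_add' := fun X Y => funext fun k => trForm_add_left _ _ _
      map_smul' := fun c X => funext fun k => trForm_smul_left _ _ _
      invFun := fun c => ∑ k, c k • oddGen k
      left_inv := fun X => by
        refine Subtype.ext (Subtype.ext ?_)
        rw [coe_sum_oddGen, sum_genSign_subtype fun k => trForm ((X : g2) : Mat7) (gE k) • gE k]
        conv_rhs => rw [eq_sum_trForm_smul_gE (X : g2).2]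
        refine Finset.sum_congr rfl fun k _ => ?_
        rcases genSign_cases k with hk | hk
        · rw [trForm_gE_eq_zero_of_theta_neg ((mem_mm_iff _).mp X.2) hk, zero_smul, ite_self]
        · rw [if_pos hk]
      right_inv := fun c => by
        ext k
        change trForm (((∑ j, c j • oddGen j : mm) : g2) : Mat7) (gE k) = c k
        rw [coe_sum_oddGen, trForm_sum_left]
        simp [trForm_smul_left, trForm_gE, Subtype.coe_inj] }

theorem coe_mmBasis (k : {k : Fin 14 // genSign k = -1}) :
    ((mmBasis k : g2) : Mat7) = gE k := by
  rw [mmBasis, Module.Basis.coe_ofEquivFun]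
  change (((∑ j, (Pi.single k 1 : {k : Fin 14 // genSign k = -1} → ℝ) j • oddGen j : mm) : g2) :
    Mat7) = gE k
  rw [coe_sum_oddGen]
  simp [Pi.single_apply]

theorem mmBasis_repr (X : mm) (k : {k : Fin 14 // genSign k = -1}) :
    mmBasis.repr X k = trForm ((X : g2) : Mat7) (gE k) := rfl

theorem finrank_mm : Module.finrank ℝ mm = 8 := by
  rw [Module.finrank_eq_card_basis mmBasis]
  decide

theorem sum_gE_sandwich_of_theta {Y : Mat7} (hY : Y ∈ g2) (h : theta Y = -Y) :
    ∑ k, (if genSign k = -1 then (1 : ℝ) else 0) • (gE k * Y * gE k) = (-2 / 3 : ℝ) • Y := by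
  have e : ∀ k, gE k * Y * gE k = ∑ j, trForm Y (gE j) • (gE k * gE j * gE k) := by
    intro k
    conv_lhs => rw [eq_sum_trForm_smul_gE hY, Finset.mul_sum, Finset.sum_mul]
    simp only [mul_smul_comm, smul_mul_assoc]
  simp only [e, Finset.smul_sum]
  rw [Finset.sum_comm]
  conv_rhs => rw [eq_sum_trForm_smul_gE hY, Finset.smul_sum]
  refine Finset.sum_congr rfl fun j _ => ?_
  rcases genSign_cases j with hj | hj
  · simp [trForm_gE_eq_zero_of_theta_neg h hj]
  · rw [smul_comm, ← sum_gE_sandwich_odd j hj, Finset.smul_sum]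
    exact Finset.sum_congr rfl fun k _ => smul_comm _ _ _

/-- An odd Y maps each eigenspace of the odd Casimir to the other, so every entry is multiplied by
the sum -16/3 - 4. -/
theorem casimir_odd_anticommutator {Y : Mat7} (h : theta Y = -Y) :
    Y * (∑ k, (if genSign k = -1 then (1 : ℝ) else 0) • (gE k * gE k)) +
      (∑ k, (if genSign k = -1 then (1 : ℝ) else 0) • (gE k * gE k)) * Y =
      (-28 / 3 : ℝ) • Y := by
  rw [sum_gE_mul_self_odd]
  ext i j
  have e := congrFun₂ h i j
  rw [theta_apply, Matrix.neg_apply] at e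
  rw [Matrix.add_apply, Matrix.mul_diagonal, Matrix.diagonal_mul, Matrix.smul_apply, smul_eq_mul]
  rw [involSign_eq, involSign_eq] at *
  split_ifs at * with h1 h2 h2 <;> linarith

/-- The map `X ↦ -[[X, Y], Z]` of the odd part. -/
noncomputable def curvOp (Y Z : mm) : mm →ₗ[ℝ] mm where
  toFun X := ⟨-⁅⁅(X : g2), (Y : g2)⁆, (Z : g2)⁆,
    mm.neg_mem (lie_mem_mm _ (lie_mem_so4_of_mm _ X.2 _ Y.2) _ Z.2)⟩
  map_add' X X' := Subtype.ext (by simp only [Submodule.coe_add, add_lie, neg_add_rev, add_comm])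
  map_smul' c X := Subtype.ext (by
    simp only [Submodule.coe_smul, smul_lie, RingHom.id_apply, smul_neg])

/-- Source of the Einstein constant. Expanding the double bracket in the odd orthonormal basis
leaves ¼(-28/3 + 2·2/3) tr(YZ) = -2 tr(YZ), from the anticommutator with the odd Casimir and from
the odd sandwich sum; this is 8 times the form -tr/4. -/
theorem trace_curvOp (Y Z : mm) :
    LinearMap.trace ℝ mm (curvOp Y Z) = 8 * trForm ((Z : g2) : Mat7) ((Y : g2) : Mat7) := by
  obtain ⟨y, hy⟩ : ∃ y : Mat7, y = ((Y : g2) : Mat7) := ⟨_, rfl⟩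
  obtain ⟨z, hz⟩ : ∃ z : Mat7, z = ((Z : g2) : Mat7) := ⟨_, rfl⟩
  have hy1 : y ∈ g2 := hy ▸ (Y : g2).2
  have hy2 : theta y = -y := hy ▸ (mem_mm_iff _).mp Y.2
  have hz2 : theta z = -z := hz ▸ (mem_mm_iff _).mp Z.2
  rw [LinearMap.trace_eq_matrix_trace ℝ mmBasis, Matrix.trace]
  have e : ∀ k : {k : Fin 14 // genSign k = -1},
      Matrix.diag (LinearMap.toMatrix mmBasis mmBasis (curvOp Y Z)) k = (1 / 4) *
          ((y * z * (gE k * gE k)).trace + (y * (gE k * gE k) * z).trace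
            - 2 * (z * (gE k * y * gE k)).trace) := by
    intro k
    rw [Matrix.diag_apply, LinearMap.toMatrix_apply, mmBasis_repr]
    change trForm (-⁅⁅((mmBasis k : g2) : Mat7), ((Y : g2) : Mat7)⁆, ((Z : g2) : Mat7)⁆) (gE k) = _
    rw [coe_mmBasis, ← hy, ← hz, trForm_neg_left, trForm, Ring.lie_def, Ring.lie_def]
    have t1 : (y * z * (gE k * gE k)).trace = (gE k * y * z * gE k).trace := by
      rw [← mul_assoc, Matrix.trace_mul_comm, ← mul_assoc, ← mul_assoc]
    have t2 : (y * (gE k * gE k) * z).trace = (z * y * gE k * gE k).trace := by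
      rw [Matrix.trace_mul_comm]
      simp only [mul_assoc]
    have t3 : (z * (gE k * y * gE k)).trace = (y * gE k * z * gE k).trace := by
      rw [mul_assoc, ← mul_assoc z, Matrix.trace_mul_comm]
      simp only [mul_assoc]
    have t4 : (z * (gE k * y * gE k)).trace = (z * gE k * y * gE k).trace := by
      simp only [mul_assoc]
    rw [two_mul, t1, t2]
    nth_rewrite 1 [t3]
    rw [t4]
    simp only [sub_mul, mul_sub, Matrix.trace_sub, mul_assoc]
    ring
  rw [Finset.sum_congr rfl fun k _ => e k]
  rw [sum_genSign_subtype fun k => (1 / 4) * ((y * z * (gE k * gE k)).trace +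
    (y * (gE k * gE k) * z).trace - 2 * (z * (gE k * y * gE k)).trace)]
  have s1 := casimir_odd_anticommutator hz2
  have s2 := sum_gE_sandwich_of_theta hy1 hy2
  have r1 := congrArg (fun M => (y * M).trace) s1
  have r2 := congrArg (fun M => (z * M).trace) s2
  simp only [Finset.mul_sum, Finset.sum_mul, mul_add, Matrix.trace_add, Matrix.trace_sum,
    mul_smul_comm, smul_mul_assoc, Matrix.trace_smul, smul_eq_mul] at r1 r2
  rw [trForm, ← hy, ← hz]
  have e2 : ∀ k, (if genSign k = -1 then
      (1 / 4) * ((y * z * (gE k * gE k)).trace + (y * (gE k * gE k) * z).trace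
            - 2 * (z * (gE k * y * gE k)).trace) else 0) =
      (1 / 4) * ((if genSign k = -1 then (1 : ℝ) else 0) * (y * (z * (gE k * gE k))).trace) +
      (1 / 4) * ((if genSign k = -1 then (1 : ℝ) else 0) * (y * ((gE k * gE k) * z)).trace) -
      (1 / 2) * ((if genSign k = -1 then (1 : ℝ) else 0) * (z * (gE k * y * gE k)).trace) := by
    intro k
    simp only [mul_assoc]
    split_ifs <;> ring
  rw [Finset.sum_congr rfl fun k _ => e2 k, Finset.sum_sub_distrib, Finset.sum_add_distrib,
    ← Finset.mul_sum, ← Finset.mul_sum, ← Finset.mul_sum]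
  rw [Matrix.trace_mul_comm y z] at r1
  linarith

/-! ### The moving frame of a local parametrization -/

/-- The odd part of the Maurer-Cartan form. -/
noncomputable def hPart (φ : (Fin 8 → ℝ) → Mat7) (i : Fin 8) (a : Fin 8 → ℝ) : Mat7 :=
  oddPart (current φ i a)

/-- The even part of the Maurer-Cartan form. -/
noncomputable def vPart (φ : (Fin 8 → ℝ) → Mat7) (i : Fin 8) (a : Fin 8 → ℝ) : Mat7 :=
  evenPart (current φ i a)

/-- The covariant derivative of the frame. -/
noncomputable def covFrame (φ : (Fin 8 → ℝ) → Mat7) (i j : Fin 8) (a : Fin 8 → ℝ) : Mat7 :=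
  mpd (hPart φ j) i a + ⁅vPart φ i a, hPart φ j a⁆

section Frame

variable {U : Set (Fin 8 → ℝ)} {φ : (Fin 8 → ℝ) → Mat7} {a : Fin 8 → ℝ}

theorem theta_hPart (i : Fin 8) : theta (hPart φ i a) = -hPart φ i a := theta_oddPart _

theorem theta_vPart (i : Fin 8) : theta (vPart φ i a) = vPart φ i a := theta_evenPart _

theorem oddPart_add_of_theta {X Y : Mat7} (hX : theta X = X) (hY : theta Y = -Y) :
    oddPart (X + Y) = Y := by
  rw [oddPart, theta_add, hX, hY]
  module

theorem evenPart_add_of_theta {X Y : Mat7} (hX : theta X = X) (hY : theta Y = -Y) :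
    evenPart (X + Y) = X := by
  rw [evenPart, theta_add, hX, hY]
  module

theorem current_eq (φ : (Fin 8 → ℝ) → Mat7) (i : Fin 8) (b : Fin 8 → ℝ) :
    current φ i b = (φ b)⁻¹ * mpd φ i b := rfl

theorem IsLocalParam.current_eq_transpose (h : IsLocalParam U φ) (ha : a ∈ U) (i : Fin 8) :
    current φ i a = (φ a)ᵀ * mpd φ i a := by
  rw [current_eq, inv_eq_transpose_of_mem_G2 (h.mem a ha)]

theorem IsLocalParam.mpd_eq (h : IsLocalParam U φ) (ha : a ∈ U) (i : Fin 8) :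
    mpd φ i a = φ a * current φ i a := by
  rw [current_eq, ← mul_assoc, mul_inv_self_of_mem_G2 (h.mem a ha), one_mul]

theorem IsLocalParam.mSmooth_current (h : IsLocalParam U φ) (i : Fin 8) :
    MSmooth (current φ i) U :=
  MSmooth.congr ((MSmooth.transpose h.smooth).mul (MSmooth.mpd h.isOpen h.smooth i))
    fun _ hb => h.current_eq_transpose hb i

theorem IsLocalParam.mSmooth_hPart (h : IsLocalParam U φ) (i : Fin 8) : MSmooth (hPart φ i) U :=
  (h.mSmooth_current i).oddPart

theorem IsLocalParam.mSmooth_vPart (h : IsLocalParam U φ) (i : Fin 8) : MSmooth (vPart φ i) U :=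
  (h.mSmooth_current i).evenPart

theorem IsLocalParam.current_mem (h : IsLocalParam U φ) (ha : a ∈ U) (i : Fin 8) :
    current φ i a ∈ g2 :=
  current_mem_g2 h.isOpen ha h.mem h.smooth i

theorem IsLocalParam.hPart_mem (h : IsLocalParam U φ) (ha : a ∈ U) (i : Fin 8) :
    hPart φ i a ∈ g2 :=
  oddPart_mem_g2 (h.current_mem ha i)

theorem IsLocalParam.vPart_mem (h : IsLocalParam U φ) (ha : a ∈ U) (i : Fin 8) :
    vPart φ i a ∈ g2 :=
  evenPart_mem_g2 (h.current_mem ha i)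

theorem IsLocalParam.coe_achtBein (h : IsLocalParam U φ) (ha : a ∈ U) (i : Fin 8) :
    (achtBein φ i a : Mat7) = hPart φ i a :=
  (horizontalPart_mem_mm_and_coe (h.current_mem ha i)).2

theorem IsLocalParam.achtBein_mem (h : IsLocalParam U φ) (ha : a ∈ U) (i : Fin 8) :
    achtBein φ i a ∈ mm :=
  (horizontalPart_mem_mm_and_coe (h.current_mem ha i)).1

theorem IsLocalParam.inducedMetric_eq (h : IsLocalParam U φ) (ha : a ∈ U) (i j : Fin 8) :
    inducedMetric φ a i j = trForm (hPart φ i a) (hPart φ j a) := by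
  rw [inducedMetric, Matrix.of_apply, invInner_eq, h.coe_achtBein ha, h.coe_achtBein ha]

theorem IsLocalParam.contDiffOn_inducedMetric (h : IsLocalParam U φ) (i j : Fin 8) :
    ContDiffOn ℝ ∞ (fun b => inducedMetric φ b i j) U :=
  ((h.mSmooth_hPart i).trForm (h.mSmooth_hPart j)).congr fun _ hb => h.inducedMetric_eq hb i j

/-- Differentiate ω_k = φᵀ∂_kφ: since ∂_lφ = φω_l and ω_l is skew, ∂_lω_k = -ω_lω_k + φᵀ∂_l∂_kφ, and
the last term is symmetric in k, l. -/
theorem IsLocalParam.maurerCartan (h : IsLocalParam U φ) (ha : a ∈ U) (i j : Fin 8) :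
    mpd (current φ j) i a - mpd (current φ i) j a = -⁅current φ i a, current φ j a⁆ := by
  have e : ∀ k l, mpd (current φ k) l a =
      -(current φ l a * current φ k a) + (φ a)ᵀ * mpd (mpd φ k) l a := by
    intro k l
    have hT : (current φ l a)ᵀ = -current φ l a := transpose_eq_neg_of_mem_g2 (h.current_mem ha l)
    have hG := transpose_mul_self_of_mem_G2 (h.mem a ha)
    rw [mpd_congr h.isOpen ha (fun b hb => h.current_eq_transpose hb k),
      mpd_mul h.isOpen ha (MSmooth.transpose h.smooth) (MSmooth.mpd h.isOpen h.smooth k),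
      mpd_transpose, h.mpd_eq ha l, h.mpd_eq ha k, Matrix.transpose_mul, hT, mul_assoc,
      ← mul_assoc _ (φ a), hG, one_mul, neg_mul]
  rw [e, e, mpd_comm h.isOpen ha h.smooth j i, Ring.lie_def]
  abel

theorem current_eq_add (i : Fin 8) : current φ i a = hPart φ i a + vPart φ i a :=
  (oddPart_add_evenPart _).symm

theorem lie_current_eq (i j : Fin 8) : ⁅current φ i a, current φ j a⁆ =
    (⁅vPart φ i a, vPart φ j a⁆ + ⁅hPart φ i a, hPart φ j a⁆) +
      (⁅vPart φ i a, hPart φ j a⁆ + ⁅hPart φ i a, vPart φ j a⁆) := by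
  rw [current_eq_add, current_eq_add]
  simp only [add_lie, lie_add]
  abel

theorem theta_neg (X : Mat7) : theta (-X) = -theta X := by
  simp [theta]

theorem theta_even_bracket (i j : Fin 8) :
    theta (⁅vPart φ i a, vPart φ j a⁆ + ⁅hPart φ i a, hPart φ j a⁆) =
      ⁅vPart φ i a, vPart φ j a⁆ + ⁅hPart φ i a, hPart φ j a⁆ := by
  simp only [theta_add, theta_lie, theta_vPart, theta_hPart, neg_lie, lie_neg, neg_neg]

theorem theta_odd_bracket (i j : Fin 8) :
    theta (⁅vPart φ i a, hPart φ j a⁆ + ⁅hPart φ i a, vPart φ j a⁆) =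
      -(⁅vPart φ i a, hPart φ j a⁆ + ⁅hPart φ i a, vPart φ j a⁆) := by
  simp only [theta_add, theta_lie, theta_vPart, theta_hPart, neg_lie, lie_neg, neg_add]

theorem oddPart_sub (X Y : Mat7) : oddPart (X - Y) = oddPart X - oddPart Y := by
  simp only [oddPart, theta_sub]
  module

theorem evenPart_sub (X Y : Mat7) : evenPart (X - Y) = evenPart X - evenPart Y := by
  simp only [evenPart, theta_sub]
  module

theorem oddPart_neg (X : Mat7) : oddPart (-X) = -oddPart X := by
  simp only [oddPart, theta_neg]
  module

theorem evenPart_neg (X : Mat7) : evenPart (-X) = -evenPart X := by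
  simp only [evenPart, theta_neg]
  module

/-- The odd part of the Maurer-Cartan equation contains only the mixed brackets, because [𝔪,𝔪] is
even. It is the vanishing of the torsion, in the form of `covFrame_comm` below. -/
theorem IsLocalParam.mpd_hPart_sub (h : IsLocalParam U φ) (ha : a ∈ U) (i j : Fin 8) :
    mpd (hPart φ j) i a - mpd (hPart φ i) j a =
      -(⁅vPart φ i a, hPart φ j a⁆ + ⁅hPart φ i a, vPart φ j a⁆) := by
  have e := congrArg oddPart (h.maurerCartan ha i j)
  rw [oddPart_sub, ← mpd_oddPart h.isOpen ha (h.mSmooth_current j),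
    ← mpd_oddPart h.isOpen ha (h.mSmooth_current i), oddPart_neg, lie_current_eq,
    oddPart_add_of_theta (theta_even_bracket i j) (theta_odd_bracket i j)] at e
  exact e

/-- The even part of the Maurer-Cartan equation: the curvature of the connection form V is -[H,H].
-/
theorem IsLocalParam.mpd_vPart_sub (h : IsLocalParam U φ) (ha : a ∈ U) (i j : Fin 8) :
    mpd (vPart φ j) i a - mpd (vPart φ i) j a =
      -(⁅vPart φ i a, vPart φ j a⁆ + ⁅hPart φ i a, hPart φ j a⁆) := by
  have e := congrArg evenPart (h.maurerCartan ha i j)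
  rw [evenPart_sub, ← mpd_evenPart h.isOpen ha (h.mSmooth_current j),
    ← mpd_evenPart h.isOpen ha (h.mSmooth_current i), evenPart_neg, lie_current_eq,
    evenPart_add_of_theta (theta_even_bracket i j) (theta_odd_bracket i j)] at e
  exact e

theorem IsLocalParam.covFrame_comm (h : IsLocalParam U φ) (ha : a ∈ U) (i j : Fin 8) :
    covFrame φ i j a = covFrame φ j i a := by
  have e := h.mpd_hPart_sub ha i j
  rw [covFrame, covFrame, sub_eq_iff_eq_add.mp e, ← lie_skew (hPart φ i a)]
  abel

theorem IsLocalParam.theta_mpd_hPart (h : IsLocalParam U φ) (ha : a ∈ U) (i j : Fin 8) :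
    theta (mpd (hPart φ j) i a) = -mpd (hPart φ j) i a := by
  rw [← mpd_theta h.isOpen ha (h.mSmooth_hPart j)]
  have e := mpd_const_smul h.isOpen ha (h.mSmooth_hPart j) (-1) i
  rw [neg_one_smul] at e
  rw [← e]
  congr 1
  funext b
  rw [theta_hPart, neg_one_smul]

theorem IsLocalParam.theta_covFrame (h : IsLocalParam U φ) (ha : a ∈ U) (i j : Fin 8) :
    theta (covFrame φ i j a) = -covFrame φ i j a := by
  rw [covFrame, theta_add, theta_lie, theta_vPart, theta_hPart, h.theta_mpd_hPart ha, lie_neg,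
    neg_add]

theorem lie_mem_g2 {X Y : Mat7} (hX : X ∈ g2) (hY : Y ∈ g2) : ⁅X, Y⁆ ∈ g2 := g2.lie_mem hX hY

theorem IsLocalParam.covFrame_mem (h : IsLocalParam U φ) (ha : a ∈ U) (i j : Fin 8) :
    covFrame φ i j a ∈ g2 :=
  g2.add_mem (mpd_mem_g2 h.isOpen ha (h.mSmooth_hPart j) (fun _ hb => h.hPart_mem hb j) i)
    (lie_mem_g2 (h.vPart_mem ha i) (h.hPart_mem ha j))

/-- Metric compatibility: the terms [Vᵢ,·] may be inserted freely because the trace form is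
ad-invariant. -/
theorem IsLocalParam.pd_inducedMetric (h : IsLocalParam U φ) (ha : a ∈ U) (i j l : Fin 8) :
    pd (fun b => inducedMetric φ b j l) i a =
      trForm (covFrame φ i j a) (hPart φ l a) + trForm (hPart φ j a) (covFrame φ i l a) := by
  rw [pd_congr h.isOpen ha (fun b hb => h.inducedMetric_eq hb j l),
    pd_trForm h.isOpen ha (h.mSmooth_hPart j) (h.mSmooth_hPart l), covFrame, covFrame,
    trForm_add_left, trForm_add_right, trForm_lie]
  ring

/-- A vector with vanishing odd part has φ⁻¹∂ᵥφ in so(4), which the immersion condition excludes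
unless v = 0. Positive definiteness and the frame property both come from here. -/
theorem IsLocalParam.eq_zero_of_sum_hPart (h : IsLocalParam U φ) (ha : a ∈ U) (v : Fin 8 → ℝ)
    (hv : ∑ i, v i • hPart φ i a = 0) : v = 0 := by
  refine h.immersion a ha v ⟨⟨∑ i, v i • vPart φ i a, ?_⟩, ?_, ?_⟩
  · exact g2.toSubmodule.sum_mem fun i _ => g2.smul_mem _ (h.vPart_mem ha i)
  · rw [mem_so4_iff]
    simp only [theta_sum, theta_smul, theta_vPart]
  · simp only [current_eq_add, smul_add, Finset.sum_add_distrib, hv, zero_add]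

theorem IsLocalParam.posDef_inducedMetric (h : IsLocalParam U φ) (ha : a ∈ U) :
    (inducedMetric φ a).PosDef := by
  rw [Matrix.posDef_iff_dotProduct_mulVec]
  refine ⟨?_, fun v hv => ?_⟩
  · ext i j
    rw [Matrix.conjTranspose_apply, star_trivial, h.inducedMetric_eq ha, h.inducedMetric_eq ha,
      trForm_comm]
  · have e : star v ⬝ᵥ inducedMetric φ a *ᵥ v =
        trForm (∑ i, v i • hPart φ i a) (∑ i, v i • hPart φ i a) := by
      simp only [trForm_sum_left, trForm_sum_right, trForm_smul_left, trForm_smul_right,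
        star_trivial, Matrix.mulVec, dotProduct, h.inducedMetric_eq ha, Finset.mul_sum]
      exact Finset.sum_congr rfl fun i _ => Finset.sum_congr rfl fun j _ => by
        rw [trForm_comm (hPart φ j a)]
        ring
    rw [e]
    have hm : ∑ i, v i • hPart φ i a ∈ g2 :=
      g2.toSubmodule.sum_mem fun i _ => g2.smul_mem _ (h.hPart_mem ha i)
    refine lt_of_le_of_ne (trForm_self_nonneg hm) fun h0 => hv ?_
    exact h.eq_zero_of_sum_hPart ha v (eq_zero_of_trForm_self hm h0.symm)

/-- The moving frame. -/
noncomputable def IsLocalParam.frame (h : IsLocalParam U φ) (ha : a ∈ U) :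
    Module.Basis (Fin 8) ℝ mm :=
  basisOfLinearIndependentOfCardEqFinrank
    (b := fun i => (⟨achtBein φ i a, h.achtBein_mem ha i⟩ : mm))
    (Fintype.linearIndependent_iff.mpr fun v hv => by
      refine congrFun (h.eq_zero_of_sum_hPart ha v ?_)
      have e := congrArg (fun X : mm => ((X : g2) : Mat7)) hv
      simpa [h.coe_achtBein ha] using e)
    (by rw [finrank_mm, Fintype.card_fin])

theorem IsLocalParam.frame_apply (h : IsLocalParam U φ) (ha : a ∈ U) (i : Fin 8) :
    h.frame ha i = ⟨achtBein φ i a, h.achtBein_mem ha i⟩ := by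
  rw [frame, coe_basisOfLinearIndependentOfCardEqFinrank]

theorem IsLocalParam.eq_of_trForm_hPart (h : IsLocalParam U φ) (ha : a ∈ U) {X Y : Mat7}
    (hX : X ∈ g2) (hX' : theta X = -X) (hY : Y ∈ g2) (hY' : theta Y = -Y)
    (e : ∀ l, trForm X (hPart φ l a) = trForm Y (hPart φ l a)) : X = Y := by
  have hZ : X - Y ∈ g2 := g2.sub_mem hX hY
  have hZ' : (⟨X - Y, hZ⟩ : g2) ∈ mm := by
    rw [mem_mm_iff]
    simp only [theta_sub, hX', hY']
    abel
  refine sub_eq_zero.mp (eq_zero_of_trForm_self hZ ?_)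
  have s := (h.frame ha).sum_repr ⟨⟨X - Y, hZ⟩, hZ'⟩
  have s' := congrArg (fun X : mm => ((X : g2) : Mat7)) s
  simp only [h.frame_apply ha] at s'
  have s2 : X - Y = ∑ i, (h.frame ha).repr ⟨⟨X - Y, hZ⟩, hZ'⟩ i • hPart φ i a := by
    refine s'.symm.trans ?_
    simp [h.coe_achtBein ha]
  nth_rewrite 2 [s2]
  rw [trForm_sum_right]
  refine Finset.sum_eq_zero fun i _ => ?_
  rw [trForm_smul_right, trForm_sub_left, e, sub_self, mul_zero]

/-! ### The Levi-Civita connection -/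

/-- Koszul's argument: `covFrame` is symmetric and metric, so the three derivatives in the
Christoffel symbol combine to 2(∇ᵢHⱼ,H_l). Raising the index and testing against the frame gives the
identity. -/
theorem IsLocalParam.sum_christoffel_smul (h : IsLocalParam U φ) (ha : a ∈ U) (i j : Fin 8) :
    ∑ k, christoffel (inducedMetric φ) k i j a • hPart φ k a = covFrame φ i j a := by
  have hdet : IsUnit (inducedMetric φ a).det :=
    (Matrix.isUnit_iff_isUnit_det _).mp (h.posDef_inducedMetric ha).isUnit
  refine h.eq_of_trForm_hPart ha
    (g2.toSubmodule.sum_mem fun k _ => g2.smul_mem _ (h.hPart_mem ha k)) ?_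
    (h.covFrame_mem ha i j) (h.theta_covFrame ha i j) fun m => ?_
  · simp only [theta_sum, theta_smul, theta_hPart, smul_neg, Finset.sum_neg_distrib]
  have hc : ∀ k, christoffel (inducedMetric φ) k i j a =
      ∑ l, (inducedMetric φ a)⁻¹ k l * trForm (covFrame φ i j a) (hPart φ l a) := by
    intro k
    rw [christoffel, Finset.mul_sum]
    refine Finset.sum_congr rfl fun l _ => ?_
    rw [h.pd_inducedMetric ha, h.pd_inducedMetric ha, h.pd_inducedMetric ha,
      h.covFrame_comm ha j i, h.covFrame_comm ha l i, h.covFrame_comm ha l j,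
      trForm_comm (hPart φ i a), trForm_comm (hPart φ j a)]
    ring
  simp only [trForm_sum_left, trForm_smul_left, hc, ← h.inducedMetric_eq ha, Finset.sum_mul]
  rw [Finset.sum_comm]
  have hinv : ∀ l, ∑ k, (inducedMetric φ a)⁻¹ k l * inducedMetric φ a k m =
      if l = m then 1 else 0 := by
    intro l
    have hs : (inducedMetric φ a)⁻¹ᵀ = (inducedMetric φ a)⁻¹ := by
      rw [Matrix.transpose_nonsing_inv]
      congr 1
      ext r s
      rw [Matrix.transpose_apply, h.inducedMetric_eq ha, h.inducedMetric_eq ha, trForm_comm]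
    have e := congrFun₂ (Matrix.nonsing_inv_mul _ hdet) l m
    rw [Matrix.mul_apply, Matrix.one_apply] at e
    rw [← e]
    refine Finset.sum_congr rfl fun k _ => ?_
    rw [← Matrix.transpose_apply (inducedMetric φ a)⁻¹, hs]
  have e3 : ∀ l, ∑ k, (inducedMetric φ a)⁻¹ k l * trForm (covFrame φ i j a) (hPart φ l a) *
      inducedMetric φ a k m = trForm (covFrame φ i j a) (hPart φ l a) *
        (if l = m then 1 else 0) := by
    intro l
    rw [← hinv, Finset.mul_sum]
    exact Finset.sum_congr rfl fun k _ => by ring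
  simp only [e3]
  simp

theorem contDiffOn_det {n : Type*} [Fintype n] [DecidableEq n]
    {g : (Fin 8 → ℝ) → Matrix n n ℝ} (hg : ∀ i j, ContDiffOn ℝ ∞ (fun b => g b i j) U) :
    ContDiffOn ℝ ∞ (fun b => (g b).det) U := by
  simp only [Matrix.det_apply]
  exact ContDiffOn.sum fun σ _ => (contDiffOn_prod fun i _ => hg _ _).const_smul _

/-- Cramer's rule: the entries of the inverse are quotients of determinants. -/
theorem contDiffOn_inv {g : (Fin 8 → ℝ) → Matrix (Fin 8) (Fin 8) ℝ}
    (hg : ∀ i j, ContDiffOn ℝ ∞ (fun b => g b i j) U) (hdet : ∀ b ∈ U, (g b).det ≠ 0)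
    (i j : Fin 8) : ContDiffOn ℝ ∞ (fun b => (g b)⁻¹ i j) U := by
  simp only [Matrix.inv_def, Ring.inverse_eq_inv', Matrix.smul_apply, Matrix.adjugate_apply,
    smul_eq_mul]
  refine ((contDiffOn_det hg).inv hdet).mul (contDiffOn_det fun r s => ?_)
  simp only [Matrix.updateRow_apply]
  split_ifs
  · exact contDiffOn_const
  · exact hg r s

theorem IsLocalParam.contDiffOn_christoffel (h : IsLocalParam U φ) (k i j : Fin 8) :
    ContDiffOn ℝ ∞ (christoffel (inducedMetric φ) k i j) U := by
  have hg := h.contDiffOn_inducedMetric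
  have hp : ∀ i j k, ContDiffOn ℝ ∞ (pd (fun b => inducedMetric φ b i j) k) U :=
    fun i j k => contDiffOn_pd h.isOpen (hg i j) k
  exact contDiffOn_const.mul (ContDiffOn.sum fun l _ =>
    (contDiffOn_inv hg (fun b hb => (h.posDef_inducedMetric hb).det_pos.ne') k l).mul
      (((hp j l i).add (hp i l j)).sub (hp i j l)))

/-! ### Curvature -/

/-- The commutator of ∂ᵢ + [Vᵢ,·] and ∂ⱼ + [Vⱼ,·] on H_l is computed twice: through Christoffel
symbols it is the Riemann tensor, and through V it is the bracket of H_l with the curvature of V. -/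
theorem IsLocalParam.sum_riemann_smul (h : IsLocalParam U φ) (ha : a ∈ U) (l i j : Fin 8) :
    ∑ k, riemann (inducedMetric φ) k l i j a • hPart φ k a =
      -⁅⁅hPart φ i a, hPart φ j a⁆, hPart φ l a⁆ := by
  -- The Leibniz rule for ∂ᵢ + [Vᵢ,·] applied to ∇ⱼH_l = Σ Γ^k_{jl} H_k.
  have first : ∀ i j, mpd (covFrame φ j l) i a + ⁅vPart φ i a, covFrame φ j l a⁆ =
      ∑ k, (pd (christoffel (inducedMetric φ) k j l) i a + ∑ m,
        christoffel (inducedMetric φ) k i m a * christoffel (inducedMetric φ) m j l a) •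
          hPart φ k a := by
    intro i j
    have e : mpd (covFrame φ j l) i a = ∑ k, (pd (christoffel (inducedMetric φ) k j l) i a •
        hPart φ k a + christoffel (inducedMetric φ) k j l a • mpd (hPart φ k) i a) := by
      rw [mpd_congr h.isOpen ha (fun b hb => (h.sum_christoffel_smul hb j l).symm),
        mpd_sum h.isOpen ha _ fun k => MSmooth.smul (h.contDiffOn_christoffel k j l)
          (h.mSmooth_hPart k)]
      exact Finset.sum_congr rfl fun k _ =>
        mpd_smul h.isOpen ha (h.contDiffOn_christoffel k j l) (h.mSmooth_hPart k) i
    have e2 : ∑ k, christoffel (inducedMetric φ) k j l a • mpd (hPart φ k) i a +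
        ⁅vPart φ i a, covFrame φ j l a⁆ =
          ∑ k, christoffel (inducedMetric φ) k j l a • covFrame φ i k a := by
      rw [← h.sum_christoffel_smul ha j l, lie_sum, ← Finset.sum_add_distrib]
      refine Finset.sum_congr rfl fun k _ => ?_
      rw [covFrame, smul_add, lie_smul]
    rw [e, Finset.sum_add_distrib, add_assoc, e2]
    simp only [← h.sum_christoffel_smul ha i, add_smul, Finset.sum_add_distrib, Finset.smul_sum,
      Finset.sum_smul, smul_smul]
    congr 1
    rw [Finset.sum_comm]
    exact Finset.sum_congr rfl fun k _ => Finset.sum_congr rfl fun m _ => by rw [mul_comm]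
  have second : ∀ i j, mpd (covFrame φ j l) i a = mpd (mpd (hPart φ l) j) i a +
      (⁅mpd (vPart φ j) i a, hPart φ l a⁆ + ⁅vPart φ j a, mpd (hPart φ l) i a⁆) := by
    intro i j
    rw [← mpd_lie h.isOpen ha (h.mSmooth_vPart j) (h.mSmooth_hPart l)]
    exact mpd_add h.isOpen ha (MSmooth.mpd h.isOpen (h.mSmooth_hPart l) j)
      ((h.mSmooth_vPart j).lie (h.mSmooth_hPart l)) i
  have e : ∑ k, riemann (inducedMetric φ) k l i j a • hPart φ k a =
      (mpd (covFrame φ j l) i a + ⁅vPart φ i a, covFrame φ j l a⁆) -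
        (mpd (covFrame φ i l) j a + ⁅vPart φ j a, covFrame φ i l a⁆) := by
    rw [first, first, ← Finset.sum_sub_distrib]
    refine Finset.sum_congr rfl fun k _ => ?_
    rw [← sub_smul, riemann, Finset.sum_sub_distrib]
    congr 1
    ring
  have hv := h.mpd_vPart_sub ha i j
  rw [e, second, second, mpd_comm h.isOpen ha (h.mSmooth_hPart l) j i, covFrame, covFrame,
    sub_eq_iff_eq_add.mp hv]
  -- By the Jacobi identity the terms in [Vᵢ,Vⱼ] cancel, and only the bracket with [Hᵢ,Hⱼ] survives.
  simp only [add_lie, lie_add, neg_lie, lie_lie]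
  abel

theorem IsLocalParam.sum_riemann_smul_achtBein (h : IsLocalParam U φ) (ha : a ∈ U)
    (l i j : Fin 8) : ∑ k, riemann (inducedMetric φ) k l i j a • achtBein φ k a =
      -⁅⁅achtBein φ i a, achtBein φ j a⁆, achtBein φ l a⁆ := by
  refine Subtype.ext ?_
  have e := h.sum_riemann_smul ha l i j
  simp only [← h.coe_achtBein ha] at e
  refine Eq.trans ?_ e
  simp

/-- In the frame J_k, the contraction Σ R^k_{lkj} is the trace of X ↦ -[[X,Jⱼ],J_l] on 𝔪, and a
trace may be taken in any basis, in particular in the odd generators. -/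
theorem IsLocalParam.ricci_inducedMetric (h : IsLocalParam U φ) (ha : a ∈ U) :
    ricci (inducedMetric φ) a = (8 : ℝ) • inducedMetric φ a := by
  ext l j
  rw [ricci, Matrix.of_apply, Matrix.smul_apply, smul_eq_mul, h.inducedMetric_eq ha,
    ← h.coe_achtBein ha, ← h.coe_achtBein ha]
  refine Eq.trans ?_ (trace_curvOp ⟨achtBein φ j a, h.achtBein_mem ha j⟩
    ⟨achtBein φ l a, h.achtBein_mem ha l⟩)
  rw [LinearMap.trace_eq_matrix_trace ℝ (h.frame ha), Matrix.trace]
  refine Finset.sum_congr rfl fun k _ => ?_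
  rw [Matrix.diag_apply, LinearMap.toMatrix_apply]
  have e : curvOp ⟨achtBein φ j a, h.achtBein_mem ha j⟩ ⟨achtBein φ l a, h.achtBein_mem ha l⟩
      (h.frame ha k) = ∑ m, riemann (inducedMetric φ) m l k j a • h.frame ha m := by
    refine Subtype.ext ?_
    rw [h.frame_apply ha k]
    refine Eq.trans (h.sum_riemann_smul_achtBein ha l k j).symm ?_
    simp [h.frame_apply ha]
  rw [e, (h.frame ha).repr_sum_self]

end Frame

/-! ### One-parameter groups -/

section Exponential

attribute [local instance] Matrix.linftyOpNormedRing Matrix.linftyOpNormedAlgebra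

theorem hasDerivAt_exp_smul_apply (X : Mat7) (t : ℝ) (r s : Fin 7) :
    HasDerivAt (fun u : ℝ => NormedSpace.exp (u • X) r s)
      ((NormedSpace.exp (t • X) * X) r s) t :=
  (Matrix.entryLinearMap ℝ ℝ r s).toContinuousLinearMap.hasFDerivAt.comp_hasDerivAt t
    (hasDerivAt_exp_smul_const (𝕂 := ℝ) X t)

theorem contDiff_exp_smul_apply (X : Mat7) (r s : Fin 7) :
    ContDiff ℝ ∞ (fun u : ℝ => NormedSpace.exp (u • X) r s) := by
  have h : ContDiff ℝ ∞ (NormedSpace.exp : Mat7 → Mat7) := contDiff_iff_contDiffAt.mpr fun Y =>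
    (NormedSpace.exp_analytic (𝕂 := ℝ) Y).contDiffAt
  exact (Matrix.entryLinearMap ℝ ℝ r s).toContinuousLinearMap.contDiff.comp
    (h.comp (contDiff_id.smul contDiff_const))

theorem commute_exp_smul (X : Mat7) (t : ℝ) : NormedSpace.exp (t • X) * X =
    X * NormedSpace.exp (t • X) :=
  ((hasDerivAt_exp_smul_const (𝕂 := ℝ) X t).unique
    (hasDerivAt_exp_smul_const' (𝕂 := ℝ) X t))

end Exponential

theorem exp_mul_exp_neg (X : Mat7) : NormedSpace.exp X * NormedSpace.exp (-X) = 1 := by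
  rw [Matrix.exp_neg, Matrix.mul_nonsing_inv _ ((Matrix.isUnit_iff_isUnit_det _).mp
    (Matrix.isUnit_exp X))]

theorem exp_neg_mul_exp (X : Mat7) : NormedSpace.exp (-X) * NormedSpace.exp X = 1 :=
  mul_eq_one_comm.mp (exp_mul_exp_neg X)

theorem hasDerivAt_mul_apply {M N : ℝ → Mat7} {M' N' : Mat7} {t : ℝ}
    (hM : ∀ r s, HasDerivAt (fun u => M u r s) (M' r s) t)
    (hN : ∀ r s, HasDerivAt (fun u => N u r s) (N' r s) t) (r s : Fin 7) :
    HasDerivAt (fun u => (M u * N u) r s) ((M' * N t + M t * N') r s) t := by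
  simp only [Matrix.mul_apply, Matrix.add_apply]
  rw [← Finset.sum_add_distrib]
  exact HasDerivAt.fun_sum fun k _ => (hM r k).mul (hN k s)

theorem hasDerivAt_exp_neg_smul_apply (X : Mat7) (t : ℝ) (r s : Fin 7) :
    HasDerivAt (fun u : ℝ => NormedSpace.exp (-(u • X)) r s)
      ((-(NormedSpace.exp (-(t • X)) * X)) r s) t := by
  have h := hasDerivAt_exp_smul_apply (-X) t r s
  simpa only [smul_neg, mul_neg] using h

theorem eq_of_hasDerivAt_zero {M : ℝ → Mat7} (h : ∀ t r s, HasDerivAt (fun u => M u r s) 0 t)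
    (t : ℝ) : M t = M 0 := by
  ext r s
  exact is_const_of_deriv_eq_zero (fun t => (h t r s).differentiableAt)
    (fun t => (h t r s).deriv) t 0

/-- The adjoint action of a one-parameter group, from the differential equation. -/
theorem exp_conj_eq {X : Mat7} {V : ℝ → Mat7}
    (hV : ∀ t r s, HasDerivAt (fun u => V u r s) ((-⁅X, V t⁆) r s) t) (t : ℝ) :
    NormedSpace.exp (-(t • X)) * V 0 * NormedSpace.exp (t • X) = V t := by
  -- The differential equation for V says exactly that e^{uX} V(u) e^{-uX} has derivative zero.
  have key := eq_of_hasDerivAt_zero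
    (M := fun u => NormedSpace.exp (u • X) * V u * NormedSpace.exp (-(u • X))) (fun t r s => by
      have h := hasDerivAt_mul_apply (hasDerivAt_mul_apply (hasDerivAt_exp_smul_apply X t) (hV t))
        (hasDerivAt_exp_neg_smul_apply X t) r s
      refine h.congr_deriv ?_
      have e : NormedSpace.exp (-(t • X)) * X = X * NormedSpace.exp (-(t • X)) := by
        simpa only [smul_neg, mul_neg, neg_mul, neg_inj] using commute_exp_smul (-X) t
      rw [e]
      have e0 : (NormedSpace.exp (t • X) * X * V t + NormedSpace.exp (t • X) * -⁅X, V t⁆) *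
          NormedSpace.exp (-(t • X)) + NormedSpace.exp (t • X) * V t *
            -(X * NormedSpace.exp (-(t • X))) = 0 := by
        rw [Ring.lie_def]
        noncomm_ring
      rw [e0]
      rfl) t
  simp only [zero_smul, neg_zero, NormedSpace.exp_zero, one_mul, mul_one] at key
  rw [← key]
  calc _ = (NormedSpace.exp (-(t • X)) * NormedSpace.exp (t • X)) * V t *
        (NormedSpace.exp (-(t • X)) * NormedSpace.exp (t • X)) := by noncomm_ring
    _ = V t := by rw [exp_neg_mul_exp, one_mul, mul_one]

theorem exp_conj_rotation {X Y Z : Mat7} {l : ℝ} (h1 : ⁅X, Y⁆ = l • Z) (h2 : ⁅X, Z⁆ = -l • Y)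
    (t : ℝ) : NormedSpace.exp (-(t • X)) * Y * NormedSpace.exp (t • X) =
      Real.cos (l * t) • Y - Real.sin (l * t) • Z := by
  have h := exp_conj_eq (X := X) (V := fun t => Real.cos (l * t) • Y - Real.sin (l * t) • Z)
    (fun t r s => by
      have hl : HasDerivAt (fun u : ℝ => l * u) l t := by
        simpa using (hasDerivAt_id t).const_mul l
      refine ((hl.cos.mul_const (Y r s)).sub (hl.sin.mul_const (Z r s))).congr_deriv ?_
      have e : -⁅X, Real.cos (l * t) • Y - Real.sin (l * t) • Z⁆ =
          (-Real.sin (l * t) * l) • Y - (Real.cos (l * t) * l) • Z := by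
        have e1 : ⁅X, Real.cos (l * t) • Y⁆ = Real.cos (l * t) • ⁅X, Y⁆ := by
          simp only [Ring.lie_def, mul_smul_comm, smul_mul_assoc, smul_sub]
        have e2 : ⁅X, Real.sin (l * t) • Z⁆ = Real.sin (l * t) • ⁅X, Z⁆ := by
          simp only [Ring.lie_def, mul_smul_comm, smul_mul_assoc, smul_sub]
        rw [lie_sub, e1, e2, h1, h2]
        module
      rw [e]
      simp) t
  simpa using h

theorem autAct_derAct (M N : Mat7) (x : Octonion) :
    autAct M (derAct N x) = derAct (M * N) x := by
  rw [autAct, derAct, octIm_octOf, Matrix.mulVec_mulVec]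
  rfl

theorem hasDerivAt_autAct_exp (X : Mat7) (x : Octonion) (t : ℝ) :
    HasDerivAt (fun u : ℝ => autAct (NormedSpace.exp (u • X)) x)
      (derAct X (autAct (NormedSpace.exp (t • X)) x)) t := by
  have h := hasDerivAt_autAct (hasDerivAt_exp_smul_apply X t) (x := fun _ => x) (x' := 0)
    (fun j => by
      have : octIm 0 j = 0 := by fin_cases j <;> rfl
      rw [this]
      exact hasDerivAt_const _ _) (hasDerivAt_const _ _)
  refine h.congr_deriv ?_
  have e : autAct (NormedSpace.exp (t • X)) 0 = 0 := by
    have := autAct_smul (NormedSpace.exp (t • X)) 0 0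
    rwa [zero_smul, zero_smul] at this
  rw [e, add_zero, commute_exp_smul, derAct, derAct, autAct, octIm_octOf, Matrix.mulVec_mulVec]

theorem _root_.IsLinearMap.hasDerivAt {E : Type*} [NormedAddCommGroup E] [NormedSpace ℝ E]
    [FiniteDimensional ℝ E] {f : E → ℝ} (hf : IsLinearMap ℝ f) {z : ℝ → E} {z' : E} {t : ℝ}
    (hz : HasDerivAt z z' t) : HasDerivAt (fun u => f (z u)) (f z') t :=
  (hf.mk' f).toContinuousLinearMap.hasFDerivAt.comp_hasDerivAt t hz

/-- The curve z(t) = (e^{tX}x)(e^{tX}y) satisfies z' = Xz because X is a derivation. Hence e^{-tX}z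
is constant, equal to xy. -/
theorem exp_smul_mem_G2 {X : Mat7} (hX : X ∈ g2) (t : ℝ) : NormedSpace.exp (t • X) ∈ G2 := by
  refine ⟨(Matrix.isUnit_iff_isUnit_det _).mp (Matrix.isUnit_exp _), fun x y => ?_⟩
  obtain ⟨z, hz⟩ : ∃ z : ℝ → Octonion, z = fun t => octMul
    (autAct (NormedSpace.exp (t • X)) x) (autAct (NormedSpace.exp (t • X)) y) := ⟨_, rfl⟩
  have hzd : ∀ t, HasDerivAt z (derAct X (z t)) t := by
    intro t
    rw [hz]
    refine (hasDerivAt_octMul (hasDerivAt_autAct_exp X x t)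
      (hasDerivAt_autAct_exp X y t)).congr_deriv ?_
    exact (hX _ _).symm
  have him : ∀ t j, HasDerivAt (fun u => octIm (z u) j) (octIm (derAct X (z t)) j) t := by
    intro t j
    refine (IsLinearMap.mk (fun x y => ?_) fun c x => ?_ :
      IsLinearMap ℝ fun x : Octonion => octIm x j).hasDerivAt (hzd t)
    · fin_cases j <;> rfl
    · fin_cases j <;> rfl
  have hre : ∀ t, HasDerivAt (fun u => (z u).1.re) (derAct X (z t)).1.re t := fun t =>
    (IsLinearMap.mk (fun _ _ => rfl) fun _ _ => rfl :
      IsLinearMap ℝ fun x : Octonion => x.1.re).hasDerivAt (hzd t)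
  have hw : ∀ t, HasDerivAt (fun u => autAct (NormedSpace.exp (-(u • X))) (z u)) 0 t := by
    intro t
    refine (hasDerivAt_autAct (hasDerivAt_exp_neg_smul_apply X t) (him t) (hre t)).congr_deriv ?_
    rw [autAct_derAct, ← derAct_add, neg_add_cancel, derAct_zero]
  have hc := is_const_of_deriv_eq_zero (fun t => (hw t).differentiableAt)
    (fun t => (hw t).deriv) t 0
  simp only [zero_smul, neg_zero, NormedSpace.exp_zero, autAct_one_left] at hc
  have hc' := congrArg (autAct (NormedSpace.exp (t • X))) hc
  rw [← autAct_mul, exp_mul_exp_neg, autAct_one_left] at hc'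
  rw [hz] at hc'
  simpa only [zero_smul, NormedSpace.exp_zero, autAct_one_left] using hc'.symm

/-! ### The Maurer-Cartan form along a vector -/

/-- The value of `φ⁻¹ dφ` on the vector `v`. -/
noncomputable def dirCurrent (φ : (Fin 8 → ℝ) → Mat7) (v a : Fin 8 → ℝ) : Mat7 :=
  ∑ i, v i • current φ i a

/-- Maps to `G₂` that are smooth everywhere. -/
structure SmoothUnits (F : (Fin 8 → ℝ) → Mat7) : Prop where
  mSmooth : MSmooth F Set.univ
  mem : ∀ a, F a ∈ G2

theorem SmoothUnits.mul {F G : (Fin 8 → ℝ) → Mat7} (hF : SmoothUnits F) (hG : SmoothUnits G) :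
    SmoothUnits fun b => F b * G b :=
  ⟨hF.mSmooth.mul hG.mSmooth, fun a => mul_mem_G2 (hF.mem a) (hG.mem a)⟩

theorem current_mul {F G : (Fin 8 → ℝ) → Mat7} {U : Set (Fin 8 → ℝ)} {a : Fin 8 → ℝ}
    (hU : IsOpen U) (ha : a ∈ U) (hF : MSmooth F U) (hG : MSmooth G U) (hFa : F a ∈ G2)
    (i : Fin 8) :
    current (fun b => F b * G b) i a = (G a)⁻¹ * current F i a * G a + current G i a := by
  have e : ((F a)⁻¹ * F a) * mpd G i a = mpd G i a := by
    rw [inv_mul_self_of_mem_G2 hFa, one_mul]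
  rw [current_eq, current_eq, current_eq, mpd_mul hU ha hF hG, Matrix.mul_inv_rev, mul_add]
  congr 1
  · noncomm_ring
  · conv_rhs => rw [← e]
    noncomm_ring

theorem SmoothUnits.dirCurrent_mul {F G : (Fin 8 → ℝ) → Mat7} (hF : SmoothUnits F)
    (hG : SmoothUnits G) (v a : Fin 8 → ℝ) :
    dirCurrent (fun b => F b * G b) v a =
      (G a)⁻¹ * dirCurrent F v a * G a + dirCurrent G v a := by
  simp only [dirCurrent, Finset.mul_sum, Finset.sum_mul, ← Finset.sum_add_distrib]
  refine Finset.sum_congr rfl fun i _ => ?_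
  rw [current_mul isOpen_univ (Set.mem_univ a) hF.mSmooth hG.mSmooth (hF.mem a)]
  simp

theorem smoothUnits_exp {X : Mat7} (hX : X ∈ g2) (j : Fin 8) :
    SmoothUnits fun b => NormedSpace.exp (b j • X) :=
  ⟨fun r s => ((contDiff_exp_smul_apply X r s).comp (contDiff_apply ℝ ℝ j)).contDiffOn,
    fun a => exp_smul_mem_G2 hX (a j)⟩

theorem dirCurrent_exp (X : Mat7) (j : Fin 8) (v a : Fin 8 → ℝ) :
    dirCurrent (fun b => NormedSpace.exp (b j • X)) v a = v j • X := by
  have e : ∀ i, mpd (fun b => NormedSpace.exp (b j • X)) i a =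
      (if i = j then (1 : ℝ) else 0) • (NormedSpace.exp (a j • X) * X) := by
    intro i
    ext r s
    have h := (hasDerivAt_exp_smul_apply X (a j) r s).comp_hasFDerivAt a
      (hasFDerivAt_apply (𝕜 := ℝ) j a)
    have h' : HasFDerivAt (fun b : Fin 8 → ℝ => NormedSpace.exp (b j • X) r s) _ a := h
    rw [mpd, Matrix.of_apply, pd, h'.fderiv]
    simp [Pi.single_apply, mul_comm, eq_comm]
  have e2 : (NormedSpace.exp (a j • X))⁻¹ * (NormedSpace.exp (a j • X) * X) = X := by
    rw [← Matrix.exp_neg, ← mul_assoc, exp_neg_mul_exp, one_mul]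
  simp only [dirCurrent, current_eq, e, mul_smul_comm, e2]
  simp

/-! ### Rotations of the generators -/

/-- The generators `C₁, …, C₇, √3 C₈, …, √3 C₁₄`, numbered from `0`. -/
def genR (k : Fin 14) : Mat7 := (genT k).map (Int.cast : ℤ → ℝ)

theorem genC_eq_genR {k : Fin 14} (h : k < 7) : genC (k + 1) = genR k := by
  rw [genC_eq, genW, if_pos h, one_smul, genR]

theorem sqrt_mul_smul_genC {k : Fin 14} (h : ¬k < 7) (t : ℝ) :
    (√3 * t) • genC (k + 1) = t • genR k := by
  have h3 : √3 ≠ 0 := by positivity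
  rw [genC_eq, genW, if_neg h, genR, smul_smul]
  congr 1
  field_simp

theorem genR_mem_g2 (k : Fin 14) : genR k ∈ g2 := by
  have e : genR k = (genW k)⁻¹ • gE k := by
    rw [gE_eq, smul_smul, inv_mul_cancel₀ (genW_ne_zero k), one_smul, genR]
  rw [e]
  exact g2.smul_mem _ (gE_mem_g2 k)

/-- The adjoint action of `e^{tX}`. -/
noncomputable def adExp (X : Mat7) (t : ℝ) : Mat7 →ₗ[ℝ] Mat7 where
  toFun Y := (NormedSpace.exp (t • X))⁻¹ * Y * NormedSpace.exp (t • X)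
  map_add' Y Z := by rw [mul_add, add_mul]
  map_smul' c Y := by simp

theorem adExp_apply (X : Mat7) (t : ℝ) (Y : Mat7) :
    adExp X t Y = (NormedSpace.exp (t • X))⁻¹ * Y * NormedSpace.exp (t • X) := rfl

/-- The bracket relations are assumed over ℤ, where they can be decided by evaluation; the resulting
real rotation has integer frequency l. -/
theorem adExp_genR {k : Fin 14} {Y Z : Matrix (Fin 7) (Fin 7) ℤ} (l : ℤ)
    (h1 : genT k * Y - Y * genT k = l • Z) (h2 : genT k * Z - Z * genT k = -l • Y) (t : ℝ) :
    adExp (genR k) t (Y.map (Int.cast : ℤ → ℝ)) =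
      Real.cos (l * t) • Y.map (Int.cast : ℤ → ℝ) -
        Real.sin (l * t) • Z.map (Int.cast : ℤ → ℝ) := by
  have e : ∀ {A B : Matrix (Fin 7) (Fin 7) ℤ} {m : ℤ}, genT k * A - A * genT k = m • B →
      ⁅genR k, A.map (Int.cast : ℤ → ℝ)⁆ = (m : ℝ) • B.map (Int.cast : ℤ → ℝ) := by
    intro A B m h
    rw [Ring.lie_def, genR, ← map_intCast_mul, ← map_intCast_mul]
    ext i j
    have hij := congrFun (congrFun h i) j
    simp only [Matrix.sub_apply, Matrix.smul_apply, smul_eq_mul] at hij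
    simp only [Matrix.sub_apply, Matrix.smul_apply, smul_eq_mul, Matrix.map_apply]
    exact_mod_cast hij
  rw [adExp_apply, ← Matrix.exp_neg, exp_conj_rotation (e h1) (by simpa using e h2)]

theorem adExp_genR_fixed {k : Fin 14} {Y : Matrix (Fin 7) (Fin 7) ℤ}
    (h : genT k * Y - Y * genT k = 0) (t : ℝ) :
    adExp (genR k) t (Y.map (Int.cast : ℤ → ℝ)) = Y.map (Int.cast : ℤ → ℝ) := by
  have e := adExp_genR (k := k) (Y := Y) (Z := 0) 0 (by simpa using h) (by simp) t
  simpa using e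

theorem intCast_map_combo (x y : ℤ) (A B : Matrix (Fin 7) (Fin 7) ℤ) :
    (x • A + y • B).map (Int.cast : ℤ → ℝ) =
      (x : ℝ) • A.map (Int.cast : ℤ → ℝ) + (y : ℝ) • B.map (Int.cast : ℤ → ℝ) := by
  ext i j
  simp only [Matrix.map_apply, Matrix.add_apply, Matrix.smul_apply, smul_eq_mul, Int.cast_add,
    Int.cast_mul]

/-- A rotation in the plane of two combinations of generators. -/
theorem adExp_genR_combo {k p q r s : Fin 14} (l x y z w : ℤ)
    (h1 : genT k * (x • genT p + y • genT q) - (x • genT p + y • genT q) * genT k =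
      l • (z • genT r + w • genT s))
    (h2 : genT k * (z • genT r + w • genT s) - (z • genT r + w • genT s) * genT k =
      -l • (x • genT p + y • genT q)) (t : ℝ) :
    (x : ℝ) • adExp (genR k) t (genR p) + (y : ℝ) • adExp (genR k) t (genR q) =
      Real.cos (l * t) • ((x : ℝ) • genR p + (y : ℝ) • genR q) -
        Real.sin (l * t) • ((z : ℝ) • genR r + (w : ℝ) • genR s) := by
  have e := adExp_genR l h1 h2 t
  rw [intCast_map_combo, intCast_map_combo, map_add, map_smul, map_smul] at e
  exact e

theorem adExp_genR_single {k p r : Fin 14} (l z : ℤ)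
    (h1 : genT k * genT p - genT p * genT k = l • (z • genT r))
    (h2 : genT k * (z • genT r) - (z • genT r) * genT k = -l • genT p) (t : ℝ) :
    adExp (genR k) t (genR p) =
      Real.cos (l * t) • genR p - Real.sin (l * t) • ((z : ℝ) • genR r) := by
  have e := adExp_genR_combo (k := k) (p := p) (q := p) (r := r) (s := r) l 1 0 z 0
    (by simpa using h1) (by simpa using h2) t
  simpa using e

theorem adExp_genR_fixed_single {k p : Fin 14}
    (h : genT k * genT p - genT p * genT k = 0) (t : ℝ) :
    adExp (genR k) t (genR p) = genR p :=
  adExp_genR_fixed h t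

/-- The rotations needed for Euler angles in the two su(2) factors of so(4). The triple `genR 2`,
`genR 1`, `-genR 0` obeys the relations of `genR 7`, `genR 8`, `genR 9`. -/
theorem adExp_seven_eight (t : ℝ) : adExp (genR 7) t (genR 8) =
    Real.cos (2 * t) • genR 8 - Real.sin (2 * t) • genR 9 := by
  have e := adExp_genR_single (k := 7) (p := 8) (r := 9) 2 1 (by decide +kernel)
    (by decide +kernel) t
  simpa using e

theorem adExp_seven_nine (t : ℝ) : adExp (genR 7) t (genR 9) =
    Real.cos (2 * t) • genR 9 + Real.sin (2 * t) • genR 8 := by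
  have e := adExp_genR_single (k := 7) (p := 9) (r := 8) 2 (-1) (by decide +kernel)
    (by decide +kernel) t
  simpa using e

theorem adExp_eight_seven (t : ℝ) : adExp (genR 8) t (genR 7) =
    Real.cos (2 * t) • genR 7 + Real.sin (2 * t) • genR 9 := by
  have e := adExp_genR_single (k := 8) (p := 7) (r := 9) 2 (-1) (by decide +kernel)
    (by decide +kernel) t
  simpa using e

theorem adExp_two_zero (t : ℝ) : adExp (genR 2) t (genR 0) =
    Real.cos (2 * t) • genR 0 - Real.sin (2 * t) • genR 1 := by
  have e := adExp_genR_single (k := 2) (p := 0) (r := 1) 2 1 (by decide +kernel)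
    (by decide +kernel) t
  simpa using e

theorem adExp_two_one (t : ℝ) : adExp (genR 2) t (genR 1) =
    Real.cos (2 * t) • genR 1 + Real.sin (2 * t) • genR 0 := by
  have e := adExp_genR_single (k := 2) (p := 1) (r := 0) 2 (-1) (by decide +kernel)
    (by decide +kernel) t
  simpa using e

theorem adExp_one_two (t : ℝ) : adExp (genR 1) t (genR 2) =
    Real.cos (2 * t) • genR 2 - Real.sin (2 * t) • genR 0 := by
  have e := adExp_genR_single (k := 1) (p := 2) (r := 0) 2 1 (by decide +kernel)
    (by decide +kernel) t
  simpa using e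

theorem lie_genT_commuting : ∀ k : Fin 14, k = 1 ∨ k = 2 → ∀ p : Fin 14, p = 7 ∨ p = 8 ∨ p = 9 →
    genT k * genT p - genT p * genT k = 0 := by
  decide +kernel

theorem adExp_genR_self (k : Fin 14) (t : ℝ) : adExp (genR k) t (genR k) = genR k :=
  adExp_genR_fixed_single (sub_self _) t

/-- The adjoint action of `e^{tX}` for the eleventh generator on the even part. -/
theorem adExp_ten_even (A₁ A₂ A₃ B₁ B₂ B₃ t : ℝ) :
    adExp (genR 10) t (-A₁ • genR 0 + A₂ • genR 1 + A₃ • genR 2 + B₃ • genR 7 + B₂ • genR 8 +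
        B₁ • genR 9) =
      ((B₂ - A₁) / 4) • (Real.cos t • ((3 : ℝ) • genR 0 + genR 8) +
          Real.sin t • ((3 : ℝ) • genR 6 + genR 13)) -
        ((A₁ + 3 * B₂) / 4) • (Real.cos (3 * t) • (genR 0 - genR 8) -
          Real.sin (3 * t) • (genR 6 - genR 13)) +
        ((A₂ + B₁) / 4) • (Real.cos t • ((3 : ℝ) • genR 1 + genR 9) -
          Real.sin t • (genR 12 - (3 : ℝ) • genR 5)) +
        ((A₂ - 3 * B₁) / 4) • (Real.cos (3 * t) • (genR 1 - genR 9) -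
          Real.sin (3 * t) • (genR 12 + genR 5)) +
        ((A₃ + 3 * B₃) / 4) • (genR 2 + genR 7) +
        ((A₃ - B₃) / 4) • (Real.cos (2 * t) • ((3 : ℝ) • genR 2 - genR 7) +
          Real.sin (2 * t) • ((2 : ℝ) • genR 11)) := by
  -- The six even combinations that ad C₁₁ rotates with a single frequency: 1 and 3 in the span of
  -- generators 0 and 8, again 1 and 3 in that of 1 and 9, and 0 and 2 in that of 2 and 7.
  have e1 := adExp_genR_combo (k := 10) (p := 0) (q := 8) (r := 6) (s := 13) 1 3 1 (-3) (-1)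
    (by decide +kernel) (by decide +kernel) t
  have e2 := adExp_genR_combo (k := 10) (p := 0) (q := 8) (r := 6) (s := 13) 3 1 (-1) 1 (-1)
    (by decide +kernel) (by decide +kernel) t
  have e3 := adExp_genR_combo (k := 10) (p := 1) (q := 9) (r := 12) (s := 5) 1 3 1 1 (-3)
    (by decide +kernel) (by decide +kernel) t
  have e4 := adExp_genR_combo (k := 10) (p := 1) (q := 9) (r := 12) (s := 5) 3 1 (-1) 1 1
    (by decide +kernel) (by decide +kernel) t
  have e5 := adExp_genR_combo (k := 10) (p := 2) (q := 7) (r := 0) (s := 0) 0 1 1 0 0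
    (by decide +kernel) (by decide +kernel) t
  have e6 := adExp_genR_combo (k := 10) (p := 2) (q := 7) (r := 11) (s := 11) 2 3 (-1) (-2) 0
    (by decide +kernel) (by decide +kernel) t
  push_cast at e1 e2 e3 e4 e5 e6
  simp only [one_mul, zero_mul, Real.cos_zero, Real.sin_zero] at e1 e2 e3 e4 e5 e6
  simp only [map_add, map_smul]
  linear_combination (norm := module) ((B₂ - A₁) / 4) • e1 - ((A₁ + 3 * B₂) / 4) • e2 +
    ((A₂ + B₁) / 4) • e3 + ((A₂ - 3 * B₁) / 4) • e4 + ((A₃ + 3 * B₃) / 4) • e5 +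
    ((A₃ - B₃) / 4) • e6

/-! ### The coframe in the explicit coordinates -/

/-- The odd part of the adjoint action of `e^{tX}`. -/
noncomputable def oddAdExp (X : Mat7) (t : ℝ) : Mat7 →ₗ[ℝ] Mat7 where
  toFun Y := oddPart (adExp X t Y)
  map_add' Y Z := by
    simp only [oddPart, map_add, theta_add]
    module
  map_smul' c Y := by
    simp only [oddPart, map_smul, theta_smul, RingHom.id_apply]
    module

theorem oddAdExp_apply (X : Mat7) (t : ℝ) (Y : Mat7) : oddAdExp X t Y = oddPart (adExp X t Y) := rfl

theorem theta_genR (k : Fin 14) : theta (genR k) = (genSign k : ℝ) • genR k := by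
  have e : genR k = (genW k)⁻¹ • gE k := by
    rw [gE_eq, smul_smul, inv_mul_cancel₀ (genW_ne_zero k), one_smul, genR]
  rw [e, theta_smul, theta_gE, smul_comm]

theorem theta_genR_of_pos {k : Fin 14} (h : genSign k = 1) : theta (genR k) = genR k := by
  rw [theta_genR, h, Int.cast_one, one_smul]

theorem theta_genR_of_neg {k : Fin 14} (h : genSign k = -1) : theta (genR k) = -genR k := by
  rw [theta_genR, h, Int.cast_neg, Int.cast_one, neg_one_smul]

theorem oddPart_even_add_odd {p q : Fin 14} (hp : genSign p = 1) (hq : genSign q = -1) (x y : ℝ) :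
    oddPart (x • genR p + y • genR q) = y • genR q := by
  refine oddPart_add_of_theta ?_ ?_
  · rw [theta_smul, theta_genR_of_pos hp]
  · rw [theta_smul, theta_genR_of_neg hq, smul_neg]

theorem oddAdExp_even {k p r : Fin 14} (z : ℤ) (hp : genSign p = 1) (hr : genSign r = -1)
    (h1 : genT k * genT p - genT p * genT k = (1 : ℤ) • (z • genT r))
    (h2 : genT k * (z • genT r) - (z • genT r) * genT k = -(1 : ℤ) • genT p) (t : ℝ) :
    oddAdExp (genR k) t (genR p) = -(z * Real.sin t) • genR r := by
  rw [oddAdExp_apply, adExp_genR_single 1 z h1 h2,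
    ← oddPart_even_add_odd hp hr (Real.cos t) (-(z * Real.sin t))]
  congr 1
  rw [Int.cast_one, one_mul]
  module

theorem oddAdExp_odd {k p r : Fin 14} (z : ℤ) (hp : genSign p = -1) (hr : genSign r = 1)
    (h1 : genT k * genT p - genT p * genT k = (1 : ℤ) • (z • genT r))
    (h2 : genT k * (z • genT r) - (z • genT r) * genT k = -(1 : ℤ) • genT p) (t : ℝ) :
    oddAdExp (genR k) t (genR p) = Real.cos t • genR p := by
  rw [oddAdExp_apply, adExp_genR_single 1 z h1 h2,
    ← oddPart_even_add_odd hr hp (-(z * Real.sin t)) (Real.cos t)]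
  congr 1
  rw [Int.cast_one, one_mul]
  module

theorem oddAdExp_odd_fixed {k p : Fin 14} (hp : genSign p = -1)
    (h : genT k * genT p - genT p * genT k = 0) (t : ℝ) :
    oddAdExp (genR k) t (genR p) = genR p := by
  have e := oddPart_even_add_odd (p := 0) (by decide) hp 0 1
  rw [oddAdExp_apply, adExp_genR_fixed_single h]
  simpa using e

/-- Neither generator lies in a single rotation plane of C₅: their sum rotates with frequency 2 into
`genR 3`, while the combination in `oddAdExp_four_diff` commutes with C₅ and contributes nothing
odd. -/
theorem oddAdExp_four_sum (t : ℝ) : oddAdExp (genR 4) t (genR 2) + oddAdExp (genR 4) t (genR 7) =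
    -(2 * Real.sin (2 * t)) • genR 3 := by
  have e := adExp_genR_combo (k := 4) (p := 2) (q := 7) (r := 3) (s := 3) 2 1 1 2 0
    (by decide +kernel) (by decide +kernel) t
  push_cast at e
  simp only [one_smul, zero_smul, add_zero] at e
  have h : theta (Real.cos (2 * t) • (genR 2 + genR 7)) = Real.cos (2 * t) • (genR 2 + genR 7) := by
    rw [theta_smul, theta_add, theta_genR_of_pos (by decide), theta_genR_of_pos (by decide)]
  have h' : theta (-(2 * Real.sin (2 * t)) • genR 3) = -(-(2 * Real.sin (2 * t)) • genR 3) := by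
    rw [theta_smul, theta_genR_of_neg (by decide), smul_neg]
  rw [← oddPart_add_of_theta h h', ← map_add, oddAdExp_apply, map_add, e]
  congr 1
  module

theorem oddAdExp_four_diff (t : ℝ) :
    (3 : ℝ) • oddAdExp (genR 4) t (genR 2) - oddAdExp (genR 4) t (genR 7) = 0 := by
  have e := adExp_genR_combo (k := 4) (p := 2) (q := 7) (r := 3) (s := 3) 0 3 (-1) 0 0
    (by decide +kernel) (by decide +kernel) t
  push_cast at e
  simp only [neg_smul, one_smul, zero_smul, add_zero, zero_mul, Real.cos_zero, smul_zero,
    sub_zero] at e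
  have h : theta ((3 : ℝ) • genR 2 + -genR 7) = (3 : ℝ) • genR 2 + -genR 7 := by
    rw [theta_add, theta_neg, theta_smul, theta_genR_of_pos (by decide),
      theta_genR_of_pos (by decide)]
  rw [← map_smul, ← map_sub, oddAdExp_apply, map_sub, map_smul, sub_eq_add_neg, e, oddPart, h,
    sub_self, smul_zero]

/-- The horizontal part of the Maurer-Cartan form of the explicit coordinates. -/
theorem oddAdExp_four_adExp_ten (A₁ A₂ A₃ B₁ B₂ B₃ s t v w : ℝ) :
    oddAdExp (genR 4) t (adExp (genR 10) s (-A₁ • genR 0 + A₂ • genR 1 + A₃ • genR 2 +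
        B₃ • genR 7 + B₂ • genR 8 + B₁ • genR 9) + v • genR 10) + w • genR 4 =
      -((A₃ + 3 * B₃) / 2 * Real.sin (2 * t)) • genR 3 + w • genR 4 +
      (((3 * (B₂ - A₁) * Real.cos s - (A₁ + 3 * B₂) * Real.cos (3 * s)) * Real.sin t +
        (3 * (A₂ + B₁) * Real.sin s - (A₂ - 3 * B₁) * Real.sin (3 * s)) * Real.cos t) / 4) •
          genR 5 +
      (((3 * (A₂ + B₁) * Real.cos s + (A₂ - 3 * B₁) * Real.cos (3 * s)) * Real.sin t +
        (3 * (B₂ - A₁) * Real.sin s + (A₁ + 3 * B₂) * Real.sin (3 * s)) * Real.cos t) / 4) •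
          genR 6 +
      v • genR 10 + ((A₃ - B₃) / 2 * Real.sin (2 * s)) • genR 11 +
      -((((B₂ - A₁) * Real.cos s + (A₁ + 3 * B₂) * Real.cos (3 * s)) * Real.sin t +
        ((A₂ + B₁) * Real.sin s + (A₂ - 3 * B₁) * Real.sin (3 * s)) * Real.cos t) / 4) •
          genR 12 +
      ((((A₂ + B₁) * Real.cos s - (A₂ - 3 * B₁) * Real.cos (3 * s)) * Real.sin t +
        ((B₂ - A₁) * Real.sin s - (A₁ + 3 * B₂) * Real.sin (3 * s)) * Real.cos t) / 4) •
          genR 13 := by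
  have e0 := oddAdExp_even (k := 4) (p := 0) (r := 5) (-1) (by decide) (by decide)
    (by decide +kernel) (by decide +kernel) t
  have e1 := oddAdExp_even (k := 4) (p := 1) (r := 6) (-1) (by decide) (by decide)
    (by decide +kernel) (by decide +kernel) t
  have e8 := oddAdExp_even (k := 4) (p := 8) (r := 12) 1 (by decide) (by decide)
    (by decide +kernel) (by decide +kernel) t
  have e9 := oddAdExp_even (k := 4) (p := 9) (r := 13) (-1) (by decide) (by decide)
    (by decide +kernel) (by decide +kernel) t
  have e5 := oddAdExp_odd (k := 4) (p := 5) (r := 0) 1 (by decide) (by decide)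
    (by decide +kernel) (by decide +kernel) t
  have e6 := oddAdExp_odd (k := 4) (p := 6) (r := 1) 1 (by decide) (by decide)
    (by decide +kernel) (by decide +kernel) t
  have e12 := oddAdExp_odd (k := 4) (p := 12) (r := 8) (-1) (by decide) (by decide)
    (by decide +kernel) (by decide +kernel) t
  have e13 := oddAdExp_odd (k := 4) (p := 13) (r := 9) 1 (by decide) (by decide)
    (by decide +kernel) (by decide +kernel) t
  have e10 := oddAdExp_odd_fixed (k := 4) (p := 10) (by decide) (by decide +kernel) t
  have e11 := oddAdExp_odd_fixed (k := 4) (p := 11) (by decide) (by decide +kernel) t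
  push_cast at e0 e1 e8 e9
  rw [adExp_ten_even]
  simp only [map_add, map_sub, map_smul, e0, e1, e8, e9, e5, e6, e12, e13, e10, e11]
  linear_combination (norm := module) ((A₃ + 3 * B₃) / 4) • oddAdExp_four_sum t +
    ((A₃ - B₃) / 4 * Real.cos (2 * s)) • oddAdExp_four_diff t

theorem trForm_genR (j k : Fin 14) :
    trForm (genR j) (genR k) = if j = k then (if j < 7 then 1 else 3) else 0 := by
  have e : (genT j * genT k).trace = ((genT j * genT k).map (Int.cast : ℤ → ℝ)).trace := by
    simp [Matrix.trace]
  rw [map_intCast_mul, genT_trace] at e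
  rw [trForm, genR, genR, ← e]
  split_ifs <;> norm_num

theorem trForm_self_odd (x₃ x₄ x₅ x₆ x₁₀ x₁₁ x₁₂ x₁₃ : ℝ) :
    trForm (x₃ • genR 3 + x₄ • genR 4 + x₅ • genR 5 + x₆ • genR 6 + x₁₀ • genR 10 +
      x₁₁ • genR 11 + x₁₂ • genR 12 + x₁₃ • genR 13)
      (x₃ • genR 3 + x₄ • genR 4 + x₅ • genR 5 + x₆ • genR 6 + x₁₀ • genR 10 +
      x₁₁ • genR 11 + x₁₂ • genR 12 + x₁₃ • genR 13) =
    x₃ ^ 2 + x₄ ^ 2 + x₅ ^ 2 + x₆ ^ 2 + 3 * (x₁₀ ^ 2 + x₁₁ ^ 2 + x₁₂ ^ 2 + x₁₃ ^ 2) := by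
  have e : (x₃ • genR 3 + x₄ • genR 4 + x₅ • genR 5 + x₆ • genR 6 + x₁₀ • genR 10 +
      x₁₁ • genR 11 + x₁₂ • genR 12 + x₁₃ • genR 13) =
      ∑ k, (![0, 0, 0, x₃, x₄, x₅, x₆, 0, 0, 0, x₁₀, x₁₁, x₁₂, x₁₃] : Fin 14 → ℝ) k • genR k := by
    simp [Fin.sum_univ_succ]
    abel
  rw [e]
  simp only [trForm_sum_left, trForm_sum_right, trForm_smul_left, trForm_smul_right, trForm_genR,
    mul_ite, mul_zero]
  simp [Fin.sum_univ_succ]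
  ring

/-! ### The explicit coordinates -/

theorem sigmaElt_eq (x y z : ℝ) : sigmaElt x y z =
    NormedSpace.exp (x • genR 7) * NormedSpace.exp (y • genR 8) * NormedSpace.exp (z • genR 7) := by
  rw [← sqrt_mul_smul_genC (k := 7) (by decide), ← sqrt_mul_smul_genC (k := 7) (by decide),
    ← sqrt_mul_smul_genC (k := 8) (by decide)]
  rfl

theorem sElt_eq (x y z : ℝ) : sElt x y z =
    NormedSpace.exp (x • genR 2) * NormedSpace.exp (y • genR 1) * NormedSpace.exp (z • genR 2) := by
  rw [← genC_eq_genR (k := 2) (by decide), ← genC_eq_genR (k := 1) (by decide)]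
  rfl

theorem hElt_eq (a : Fin 8 → ℝ) : hElt a = sigmaElt (a 0) (a 1) (a 2) * sElt (a 3) (a 4) (a 5) *
    NormedSpace.exp (a 6 • genR 10) * NormedSpace.exp (a 7 • genR 4) := by
  rw [← sqrt_mul_smul_genC (k := 10) (by decide), ← genC_eq_genR (k := 4) (by decide)]
  rfl

theorem smoothUnits_exp_genR (k : Fin 14) (j : Fin 8) :
    SmoothUnits fun b => NormedSpace.exp (b j • genR k) :=
  smoothUnits_exp (genR_mem_g2 k) j

theorem smoothUnits_sigmaElt : SmoothUnits fun b => sigmaElt (b 0) (b 1) (b 2) := by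
  simp only [sigmaElt_eq]
  exact ((smoothUnits_exp_genR 7 0).mul (smoothUnits_exp_genR 8 1)).mul (smoothUnits_exp_genR 7 2)

theorem smoothUnits_sElt : SmoothUnits fun b => sElt (b 3) (b 4) (b 5) := by
  simp only [sElt_eq]
  exact ((smoothUnits_exp_genR 2 3).mul (smoothUnits_exp_genR 1 4)).mul (smoothUnits_exp_genR 2 5)

theorem smoothUnits_hElt : SmoothUnits hElt := by
  rw [funext hElt_eq]
  exact ((smoothUnits_sigmaElt.mul smoothUnits_sElt).mul (smoothUnits_exp_genR 10 6)).mul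
    (smoothUnits_exp_genR 4 7)

theorem SmoothUnits.dirCurrent_mul_exp {F : (Fin 8 → ℝ) → Mat7} (hF : SmoothUnits F) (k : Fin 14)
    (j : Fin 8) (v a : Fin 8 → ℝ) :
    dirCurrent (fun b => F b * NormedSpace.exp (b j • genR k)) v a =
      adExp (genR k) (a j) (dirCurrent F v a) + v j • genR k := by
  rw [hF.dirCurrent_mul (smoothUnits_exp_genR k j), dirCurrent_exp]
  rfl

theorem dirCurrent_sigmaElt (v a : Fin 8 → ℝ) :
    dirCurrent (fun b => sigmaElt (b 0) (b 1) (b 2)) v a =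
      formI3 ![a 0, a 1, a 2] ![v 0, v 1, v 2] • genR 7 +
      formI2 ![a 0, a 1, a 2] ![v 0, v 1, v 2] • genR 8 +
      formI1 ![a 0, a 1, a 2] ![v 0, v 1, v 2] • genR 9 := by
  simp only [sigmaElt_eq]
  rw [((smoothUnits_exp_genR 7 0).mul (smoothUnits_exp_genR 8 1)).dirCurrent_mul_exp,
    (smoothUnits_exp_genR 7 0).dirCurrent_mul_exp, dirCurrent_exp]
  simp only [map_add, map_smul, adExp_eight_seven, adExp_genR_self, adExp_seven_eight,
    adExp_seven_nine]
  simp only [formI1, formI2, formI3, Matrix.cons_val]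
  module

/-- The Euler angle computation of `dirCurrent_sigmaElt` with `-genR 0` in the role of `genR 9`;
this is the origin of the sign of I₁. -/
theorem dirCurrent_sElt (v a : Fin 8 → ℝ) :
    dirCurrent (fun b => sElt (b 3) (b 4) (b 5)) v a =
      -formI1 ![a 3, a 4, a 5] ![v 3, v 4, v 5] • genR 0 +
      formI2 ![a 3, a 4, a 5] ![v 3, v 4, v 5] • genR 1 +
      formI3 ![a 3, a 4, a 5] ![v 3, v 4, v 5] • genR 2 := by
  simp only [sElt_eq]
  rw [((smoothUnits_exp_genR 2 3).mul (smoothUnits_exp_genR 1 4)).dirCurrent_mul_exp,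
    (smoothUnits_exp_genR 2 3).dirCurrent_mul_exp, dirCurrent_exp]
  simp only [map_add, map_sub, map_smul, adExp_one_two, adExp_genR_self, adExp_two_one,
    adExp_two_zero]
  simp only [formI1, formI2, formI3, Matrix.cons_val]
  module

theorem sElt_conj (x y z : ℝ) {p : Fin 14} (hp : p = 7 ∨ p = 8 ∨ p = 9) :
    (sElt x y z)⁻¹ * genR p * sElt x y z = genR p := by
  have e : (sElt x y z)⁻¹ * genR p * sElt x y z =
      adExp (genR 2) z (adExp (genR 1) y (adExp (genR 2) x (genR p))) := by
    simp only [adExp_apply, sElt_eq, Matrix.mul_inv_rev, mul_assoc]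
  rw [e, adExp_genR_fixed_single (lie_genT_commuting 2 (by decide) p hp),
    adExp_genR_fixed_single (lie_genT_commuting 1 (by decide) p hp),
    adExp_genR_fixed_single (lie_genT_commuting 2 (by decide) p hp)]

/-- The two su(2) factors commute, so conjugation by s leaves the contribution of σ unchanged and
the two Maurer-Cartan forms simply add before C₁₁ and C₅ act. -/
theorem dirCurrent_hElt (v a : Fin 8 → ℝ) :
    dirCurrent hElt v a = adExp (genR 4) (a 7) (adExp (genR 10) (a 6)
      (-formI1 ![a 3, a 4, a 5] ![v 3, v 4, v 5] • genR 0 +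
      formI2 ![a 3, a 4, a 5] ![v 3, v 4, v 5] • genR 1 +
      formI3 ![a 3, a 4, a 5] ![v 3, v 4, v 5] • genR 2 +
      formI3 ![a 0, a 1, a 2] ![v 0, v 1, v 2] • genR 7 +
      formI2 ![a 0, a 1, a 2] ![v 0, v 1, v 2] • genR 8 +
      formI1 ![a 0, a 1, a 2] ![v 0, v 1, v 2] • genR 9) + v 6 • genR 10) + v 7 • genR 4 := by
  rw [funext hElt_eq,
    ((smoothUnits_sigmaElt.mul smoothUnits_sElt).mul
      (smoothUnits_exp_genR 10 6)).dirCurrent_mul_exp,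
    (smoothUnits_sigmaElt.mul smoothUnits_sElt).dirCurrent_mul_exp,
    smoothUnits_sigmaElt.dirCurrent_mul smoothUnits_sElt, dirCurrent_sigmaElt, dirCurrent_sElt]
  simp only [mul_add, add_mul, mul_smul_comm, smul_mul_assoc, sElt_conj _ _ _ (p := 7) (by decide),
    sElt_conj _ _ _ (p := 8) (by decide), sElt_conj _ _ _ (p := 9) (by decide)]
  congr 4
  abel

theorem oddPart_add_smul_genR {k : Fin 14} (hk : genSign k = -1) (Y : Mat7) (v : ℝ) :
    oddPart (Y + v • genR k) = oddPart Y + v • genR k := by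
  rw [oddPart, oddPart, theta_add, theta_smul, theta_genR_of_neg hk]
  module

theorem oddPart_dirCurrent_hElt (v a : Fin 8 → ℝ) :
    oddPart (dirCurrent hElt v a) = oddAdExp (genR 4) (a 7) (adExp (genR 10) (a 6)
      (-formI1 ![a 3, a 4, a 5] ![v 3, v 4, v 5] • genR 0 +
      formI2 ![a 3, a 4, a 5] ![v 3, v 4, v 5] • genR 1 +
      formI3 ![a 3, a 4, a 5] ![v 3, v 4, v 5] • genR 2 +
      formI3 ![a 0, a 1, a 2] ![v 0, v 1, v 2] • genR 7 +
      formI2 ![a 0, a 1, a 2] ![v 0, v 1, v 2] • genR 8 +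
      formI1 ![a 0, a 1, a 2] ![v 0, v 1, v 2] • genR 9) + v 6 • genR 10) + v 7 • genR 4 := by
  rw [dirCurrent_hElt, oddPart_add_smul_genR (by decide), oddAdExp_apply]

/-- The squared length of the horizontal part of the Maurer-Cartan form, as a sum of squares. -/
theorem trForm_oddPart_dirCurrent_hElt (v a : Fin 8 → ℝ) {A₁ A₂ A₃ B₁ B₂ B₃ : ℝ}
    (hA₁ : A₁ = formI1 ![a 3, a 4, a 5] ![v 3, v 4, v 5])
    (hA₂ : A₂ = formI2 ![a 3, a 4, a 5] ![v 3, v 4, v 5])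
    (hA₃ : A₃ = formI3 ![a 3, a 4, a 5] ![v 3, v 4, v 5])
    (hB₁ : B₁ = formI1 ![a 0, a 1, a 2] ![v 0, v 1, v 2])
    (hB₂ : B₂ = formI2 ![a 0, a 1, a 2] ![v 0, v 1, v 2])
    (hB₃ : B₃ = formI3 ![a 0, a 1, a 2] ![v 0, v 1, v 2]) :
    trForm (oddPart (dirCurrent hElt v a)) (oddPart (dirCurrent hElt v a)) =
      v 7 ^ 2 + 3 * v 6 ^ 2 +
      1 / 4 * ((A₁ + 3 * B₂) * (Real.cos (3 * a 6) * Real.sin (a 7)) +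
        (A₂ - 3 * B₁) * (Real.sin (3 * a 6) * Real.cos (a 7))) ^ 2 +
      1 / 4 * ((A₂ - 3 * B₁) * (Real.cos (3 * a 6) * Real.sin (a 7)) +
        (A₁ + 3 * B₂) * (Real.sin (3 * a 6) * Real.cos (a 7))) ^ 2 +
      3 / 4 * ((B₂ - A₁) * (Real.cos (a 6) * Real.sin (a 7)) +
        (A₂ + B₁) * (Real.sin (a 6) * Real.cos (a 7))) ^ 2 +
      3 / 4 * ((A₂ + B₁) * (Real.cos (a 6) * Real.sin (a 7)) +
        (B₂ - A₁) * (Real.sin (a 6) * Real.cos (a 7))) ^ 2 +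
      3 / 4 * (Real.sin (2 * a 6) * (A₃ - B₃)) ^ 2 +
      1 / 4 * (Real.sin (2 * a 7) * (A₃ + 3 * B₃)) ^ 2 := by
  -- The coefficients of generators 5 and 12 are (3P - Q)/4 and -(P + Q)/4, with weights 1 and 3.
  -- Cross terms cancel, leaving ¾P² + ¼Q²; generators 6 and 13 behave in the same way.
  rw [oddPart_dirCurrent_hElt, ← hA₁, ← hA₂, ← hA₃, ← hB₁, ← hB₂, ← hB₃,
    oddAdExp_four_adExp_ten, trForm_self_odd]
  ring

theorem formI1_sq_add_formI2_sq (x y z dx dy dz : ℝ) :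
    formI1 ![x, y, z] ![dx, dy, dz] ^ 2 + formI2 ![x, y, z] ![dx, dy, dz] ^ 2 =
      dy ^ 2 + Real.sin (2 * y) ^ 2 * dx ^ 2 := by
  simp only [formI1, formI2, Matrix.cons_val]
  linear_combination (dy ^ 2 + Real.sin (2 * y) ^ 2 * dx ^ 2) * Real.sin_sq_add_cos_sq (2 * z)

theorem current_hElt_mem (i : Fin 8) (a : Fin 8 → ℝ) : current hElt i a ∈ g2 :=
  current_mem_g2 isOpen_univ (Set.mem_univ a) (fun b _ => smoothUnits_hElt.mem b)
    smoothUnits_hElt.mSmooth i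

theorem oddPart_sum_smul (v : Fin 8 → ℝ) (f : Fin 8 → Mat7) :
    oddPart (∑ i, v i • f i) = ∑ i, v i • oddPart (f i) := by
  simp only [oddPart, theta_sum, theta_smul, ← smul_sub, ← Finset.sum_sub_distrib,
    Finset.smul_sum]
  exact Finset.sum_congr rfl fun i _ => smul_comm _ _ _

theorem sum_inducedMetric_mul {φ : (Fin 8 → ℝ) → Mat7} {a : Fin 8 → ℝ}
    (h : ∀ i, current φ i a ∈ g2) (v : Fin 8 → ℝ) :
    ∑ i, ∑ j, inducedMetric φ a i j * v i * v j =
      trForm (oddPart (dirCurrent φ v a)) (oddPart (dirCurrent φ v a)) := by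
  rw [dirCurrent, oddPart_sum_smul]
  simp only [trForm_sum_left, trForm_sum_right, trForm_smul_left, trForm_smul_right,
    Finset.mul_sum]
  refine Finset.sum_congr rfl fun i _ => Finset.sum_congr rfl fun j _ => ?_
  rw [inducedMetric, Matrix.of_apply, invInner_eq, achtBein, achtBein,
    (horizontalPart_mem_mm_and_coe (h i)).2, (horizontalPart_mem_mm_and_coe (h j)).2]
  rw [trForm_comm]
  ring

theorem sum_sq_rotation (p q c s C S : ℝ) :
    (p * (c * S) + q * (s * C)) ^ 2 + (q * (c * S) + p * (s * C)) ^ 2 =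
      (p ^ 2 + q ^ 2) * (c ^ 2 * S ^ 2 + s ^ 2 * C ^ 2) + 4 * p * q * (s * c) * (S * C) := by
  ring

theorem sin_mul_cos_eq (x : ℝ) : Real.sin x * Real.cos x = Real.sin (2 * x) / 2 := by
  rw [Real.sin_two_mul]
  ring

theorem sum_inducedMetric_hElt (a v : Fin 8 → ℝ) :
    ∑ i, ∑ j, inducedMetric hElt a i j * v i * v j = explicitMetric a v := by
  rw [sum_inducedMetric_mul (fun i => current_hElt_mem i a),
    trForm_oddPart_dirCurrent_hElt v a rfl rfl rfl rfl rfl rfl]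
  have hA := formI1_sq_add_formI2_sq (a 3) (a 4) (a 5) (v 3) (v 4) (v 5)
  have hB := formI1_sq_add_formI2_sq (a 0) (a 1) (a 2) (v 0) (v 1) (v 2)
  simp only [explicitMetric]
  generalize formI1 ![a 3, a 4, a 5] ![v 3, v 4, v 5] = A₁ at *
  generalize formI2 ![a 3, a 4, a 5] ![v 3, v 4, v 5] = A₂ at *
  generalize formI3 ![a 3, a 4, a 5] ![v 3, v 4, v 5] = A₃ at *
  generalize formI1 ![a 0, a 1, a 2] ![v 0, v 1, v 2] = B₁ at *
  generalize formI2 ![a 0, a 1, a 2] ![v 0, v 1, v 2] = B₂ at *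
  generalize formI3 ![a 0, a 1, a 2] ![v 0, v 1, v 2] = B₃ at *
  have h6 : 2 * (3 * a 6) = 3 * (2 * a 6) := by ring
  have e1 := sum_sq_rotation (A₁ + 3 * B₂) (A₂ - 3 * B₁) (Real.cos (3 * a 6))
    (Real.sin (3 * a 6)) (Real.cos (a 7)) (Real.sin (a 7))
  have e2 := sum_sq_rotation (B₂ - A₁) (A₂ + B₁) (Real.cos (a 6))
    (Real.sin (a 6)) (Real.cos (a 7)) (Real.sin (a 7))
  rw [sin_mul_cos_eq, sin_mul_cos_eq, Real.cos_sq, Real.sin_sq_eq_half_sub, Real.cos_sq,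
    Real.sin_sq_eq_half_sub, h6, Real.sin_three_mul (2 * a 6),
    Real.cos_three_mul (2 * a 6)] at e1
  rw [sin_mul_cos_eq, sin_mul_cos_eq, Real.cos_sq, Real.sin_sq_eq_half_sub, Real.cos_sq,
    Real.sin_sq_eq_half_sub] at e2
  rw [Real.cos_sq (a 6), Real.cos_sq (a 7), Real.sin_sq_eq_half_sub (a 6),
    Real.sin_sq_eq_half_sub (a 7)]
  have hX := Real.sin_sq_add_cos_sq (2 * a 6)
  -- The weights ¼ and ¾ are chosen so that the squares of A₁ + 3B₂, A₂ - 3B₁, B₂ - A₁, A₂ + B₁ add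
  -- up to A₁² + A₂² + 3(B₁² + B₂²). Both e1 and e2 use c²S² + s²C² = (1 - cos cos)/2 at doubled
  -- angles.
  linear_combination 1 / 4 * e1 + 3 / 4 * e2 +
    (1 - Real.cos (2 * a 6) * Real.cos (2 * a 7)) / 2 * (hA + 3 * hB) -
    1 / 2 * Real.cos (2 * a 6) * Real.cos (2 * a 7) * ((A₁ + 3 * B₂) ^ 2 + (A₂ - 3 * B₁) ^ 2) * hX

/-- At x = a₇ and x = 3a₇, with y = a₈, these determinants of the two linear systems are the first
four factors of `densF`. -/
theorem sq_sub_sq_rotation (x y : ℝ) :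
    (Real.cos x * Real.sin y) ^ 2 - (Real.sin x * Real.cos y) ^ 2 =
      Real.sin (y - x) * Real.sin (y + x) := by
  rw [Real.sin_sub, Real.sin_add]
  ring

theorem eq_zero_of_rotation {p q c s : ℝ} (h1 : p * c + q * s = 0) (h2 : q * c + p * s = 0)
    (h : c ^ 2 - s ^ 2 ≠ 0) : p = 0 ∧ q = 0 := by
  constructor
  · refine (mul_eq_zero.mp ?_).resolve_right h
    linear_combination c * h1 - s * h2
  · refine (mul_eq_zero.mp ?_).resolve_right h
    linear_combination c * h2 - s * h1

theorem eq_zero_of_forms {x y z dx dy dz : ℝ} (hy : Real.sin (2 * y) ≠ 0)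
    (h1 : formI1 ![x, y, z] ![dx, dy, dz] = 0) (h2 : formI2 ![x, y, z] ![dx, dy, dz] = 0)
    (h3 : formI3 ![x, y, z] ![dx, dy, dz] = 0) : dx = 0 ∧ dy = 0 ∧ dz = 0 := by
  have h := formI1_sq_add_formI2_sq x y z dx dy dz
  rw [h1, h2] at h
  have hdy : dy = 0 := by
    refine pow_eq_zero_iff two_ne_zero |>.mp (le_antisymm ?_ (sq_nonneg _))
    linarith [mul_nonneg (sq_nonneg (Real.sin (2 * y))) (sq_nonneg dx)]
  have hdx : dx = 0 := by
    have h0 : Real.sin (2 * y) ^ 2 * dx ^ 2 = 0 := by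
      rw [hdy] at h
      linarith
    exact pow_eq_zero_iff two_ne_zero |>.mp
      ((mul_eq_zero.mp h0).resolve_left (pow_ne_zero 2 hy))
  refine ⟨hdx, hdy, ?_⟩
  simpa [formI3, hdx] using h3

theorem eq_zero_of_sum_sq {x₁ x₂ x₃ x₄ x₅ x₆ x₇ x₈ : ℝ}
    (h : x₁ ^ 2 + 3 * x₂ ^ 2 + 1 / 4 * x₃ ^ 2 + 1 / 4 * x₄ ^ 2 + 3 / 4 * x₅ ^ 2 + 3 / 4 * x₆ ^ 2 +
      3 / 4 * x₇ ^ 2 + 1 / 4 * x₈ ^ 2 = 0) :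
    x₁ = 0 ∧ x₂ = 0 ∧ x₃ = 0 ∧ x₄ = 0 ∧ x₅ = 0 ∧ x₆ = 0 ∧ x₇ = 0 ∧ x₈ = 0 := by
  have z : ∀ {x : ℝ}, x ^ 2 ≤ 0 → x = 0 := fun h =>
    pow_eq_zero_iff two_ne_zero |>.mp (le_antisymm h (sq_nonneg _))
  have p₁ := sq_nonneg x₁
  have p₂ := sq_nonneg x₂
  have p₃ := sq_nonneg x₃
  have p₄ := sq_nonneg x₄
  have p₅ := sq_nonneg x₅
  have p₆ := sq_nonneg x₆
  have p₇ := sq_nonneg x₇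
  have p₈ := sq_nonneg x₈
  refine ⟨z ?_, z ?_, z ?_, z ?_, z ?_, z ?_, z ?_, z ?_⟩ <;> linarith

theorem isOpen_chartDomain : IsOpen chartDomain := by
  have h : Continuous fun a : Fin 8 → ℝ =>
      densF (2 * a 6) (2 * a 7) * Real.sin (2 * a 1) * Real.sin (2 * a 4) := by
    simp only [densF]
    fun_prop
  exact isOpen_ne_fun h continuous_const

/-- All eight squares vanish. The first four factors of the density make the two 2×2 systems
invertible, the next two remove A₃ - B₃ and A₃ + 3B₃, and sin 2a₂, sin 2a₅ let the differentials be
recovered from the forms. -/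
theorem eq_zero_of_oddPart_dirCurrent_hElt {a : Fin 8 → ℝ} (ha : a ∈ chartDomain)
    {v : Fin 8 → ℝ} (h : oddPart (dirCurrent hElt v a) = 0) : v = 0 := by
  have e := trForm_oddPart_dirCurrent_hElt v a rfl rfl rfl rfl rfl rfl
  rw [h, trForm_zero_left] at e
  have hd : densF (2 * a 6) (2 * a 7) * Real.sin (2 * a 1) * Real.sin (2 * a 4) ≠ 0 := ha
  have r1 : (2 * a 7 - 2 * a 6) / 2 = a 7 - a 6 := by ring
  have r2 : (2 * a 7 + 2 * a 6) / 2 = a 7 + a 6 := by ring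
  have r3 : (2 * a 7 - 3 * (2 * a 6)) / 2 = a 7 - 3 * a 6 := by ring
  have r4 : (2 * a 7 + 3 * (2 * a 6)) / 2 = a 7 + 3 * a 6 := by ring
  simp only [densF, mul_ne_zero_iff, r1, r2, r3, r4] at hd
  obtain ⟨⟨⟨⟨⟨⟨⟨d1, d2⟩, d3⟩, d4⟩, d5⟩, d6⟩, d7⟩, d8⟩ := hd
  have f1 := eq_zero_of_forms (x := a 3) (y := a 4) (z := a 5) (dx := v 3) (dy := v 4)
    (dz := v 5) d8
  have f2 := eq_zero_of_forms (x := a 0) (y := a 1) (z := a 2) (dx := v 0) (dy := v 1)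
    (dz := v 2) d7
  generalize formI1 ![a 3, a 4, a 5] ![v 3, v 4, v 5] = A₁ at *
  generalize formI2 ![a 3, a 4, a 5] ![v 3, v 4, v 5] = A₂ at *
  generalize formI3 ![a 3, a 4, a 5] ![v 3, v 4, v 5] = A₃ at *
  generalize formI1 ![a 0, a 1, a 2] ![v 0, v 1, v 2] = B₁ at *
  generalize formI2 ![a 0, a 1, a 2] ![v 0, v 1, v 2] = B₂ at *
  generalize formI3 ![a 0, a 1, a 2] ![v 0, v 1, v 2] = B₃ at *
  obtain ⟨hv7, hv6, k1, k2, k3, k4, k5, k6⟩ := eq_zero_of_sum_sq e.symm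
  clear e
  have hq := eq_zero_of_rotation k1 k2 (by
    rw [sq_sub_sq_rotation]
    exact mul_ne_zero d3 d4)
  have hp := eq_zero_of_rotation k3 k4 (by
    rw [sq_sub_sq_rotation]
    exact mul_ne_zero d1 d2)
  have h3 := (mul_eq_zero.mp k5).resolve_left d5
  have h3' := (mul_eq_zero.mp k6).resolve_left d6
  clear k1 k2 k3 k4 k5 k6
  obtain ⟨g3, g4, g5⟩ := f1 (by linear_combination 1 / 4 * hq.1 - 3 / 4 * hp.1)
    (by linear_combination 1 / 4 * hq.2 + 3 / 4 * hp.2)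
    (by linear_combination 3 / 4 * h3 + 1 / 4 * h3')
  obtain ⟨g0, g1, g2⟩ := f2 (by linear_combination 1 / 4 * hp.2 - 1 / 4 * hq.2)
    (by linear_combination 1 / 4 * hq.1 + 1 / 4 * hp.1)
    (by linear_combination 1 / 4 * h3' - 1 / 4 * h3)
  ext i
  fin_cases i <;> assumption

theorem isLocalParam_hElt : IsLocalParam chartDomain hElt where
  isOpen := isOpen_chartDomain
  mem a _ := smoothUnits_hElt.mem a
  smooth r s := (smoothUnits_hElt.mSmooth r s).mono (Set.subset_univ _)
  immersion a ha v := by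
    rintro ⟨Z, hZ, e⟩
    refine eq_zero_of_oddPart_dirCurrent_hElt ha ?_
    rw [dirCurrent, ← e, oddPart, (mem_so4_iff Z).mp hZ, sub_self, smul_zero]

/-! ### Covering by local parametrizations -/

/-- The form φ⁻¹dφ is invariant under left translation, so one chart yields charts around every
point of the orbit. -/
theorem IsLocalParam.const_mul {U : Set (Fin 8 → ℝ)} {φ : (Fin 8 → ℝ) → Mat7}
    (h : IsLocalParam U φ) {k : Mat7} (hk : k ∈ G2) : IsLocalParam U fun b => k * φ b where
  isOpen := h.isOpen
  mem a ha := mul_mem_G2 hk (h.mem a ha)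
  smooth := (mSmooth_const k).mul h.smooth
  immersion a ha v := by
    have e : ∀ i, current (fun b => k * φ b) i a = current φ i a := by
      intro i
      rw [current_mul h.isOpen ha (mSmooth_const k) h.smooth hk, current_eq (fun _ => k),
        mpd_const, mul_zero, mul_zero, zero_mul, zero_add]
    simp only [e]
    exact h.immersion a ha v

theorem chartDomain_nonempty : chartDomain.Nonempty := by
  -- Here 2a₇ = π/3 and 2a₈ = π/2, so the sines in `densF` are taken at π/12, 5π/12, -π/4, 3π/4,
  -- π/3, π/2; only the third angle is negative.
  refine ⟨![0, Real.pi / 4, 0, 0, Real.pi / 4, 0, Real.pi / 6, Real.pi / 4], ?_⟩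
  have hp := Real.pi_pos
  have pos : ∀ x, 0 < x → x < Real.pi → Real.sin x ≠ 0 := fun x h0 h1 =>
    (Real.sin_pos_of_pos_of_lt_pi h0 h1).ne'
  simp only [chartDomain, Set.mem_ofPred_eq, densF, Matrix.cons_val, mul_ne_zero_iff]
  refine ⟨⟨⟨⟨⟨⟨⟨?_, ?_⟩, ?_⟩, ?_⟩, ?_⟩, ?_⟩, ?_⟩, ?_⟩
  · exact pos _ (by linarith) (by linarith)
  · exact pos _ (by linarith) (by linarith)
  · rw [← neg_ne_zero, ← Real.sin_neg]
    exact pos _ (by linarith) (by linarith)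
  all_goals exact pos _ (by linarith) (by linarith)

theorem exists_isLocalParam (Q : Set Octonion) (hQ : IsQuaternionicSubalgebra Q) :
    ∃ U φ, IsLocalParam U φ ∧ ∃ a ∈ U, orbitPoint (φ a) = Q := by
  obtain ⟨g, hg, rfl⟩ := (isQuaternionicSubalgebra_iff Q).mp hQ
  obtain ⟨a, ha⟩ := chartDomain_nonempty
  have hh := smoothUnits_hElt.mem a
  refine ⟨chartDomain, fun b => g * (hElt a)⁻¹ * hElt b,
    isLocalParam_hElt.const_mul (mul_mem_G2 hg (inv_mem_G2 hh)), a, ha, ?_⟩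
  change orbitPoint (g * (hElt a)⁻¹ * hElt a) = orbitPoint g
  rw [mul_assoc, inv_mul_self_of_mem_G2 hh, mul_one]

/-! ### Change of parameters -/

/-- Stabilizing ℍ kills the lower left block of k. The same holds for k⁻¹ = kᵀ, which kills the
upper right block of k. -/
theorem theta_of_stabilizer {k : Mat7} (hk : k ∈ G2) (h : orbitPoint k = canonicalH) :
    theta k = k := by
  have low : ∀ g : Mat7, orbitPoint g = canonicalH → ∀ i j : Fin 7, ¬i < 3 → j < 3 →
      g i j = 0 := by
    intro g hg i j hi hj
    have hH : octOf 0 (Pi.single j 1) ∈ canonicalH := by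
      fin_cases j <;> first | (exfalso; revert hj; decide) | (ext <;> rfl)
    have h2 : autAct g (octOf 0 (Pi.single j 1)) ∈ canonicalH := hg ▸ Set.mem_image_of_mem _ hH
    rw [autAct, octIm_octOf, Matrix.mulVec_single_one] at h2
    have h3 := Quaternion.ext_iff.mp (show (octOf _ _ : Octonion).2 = 0 from h2)
    obtain ⟨c0, c1, c2, c3⟩ := h3
    fin_cases i <;> first | (exfalso; revert hi; decide) | assumption
  have hi' : orbitPoint k⁻¹ = canonicalH := by
    have := orbitPoint_inv_mul_eq (h := 1) hk (by rw [h, orbitPoint_one])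
    rwa [mul_one] at this
  rw [theta_eq_self_iff]
  rintro i j (⟨hi, hj⟩ | ⟨hi, hj⟩)
  · have e := low _ hi' j i hj hi
    rwa [inv_eq_transpose_of_mem_G2 hk, Matrix.transpose_apply] at e
  · exact low k h i j hi hj

theorem theta_inv {k : Mat7} (hk : k ∈ G2) (h : theta k = k) : theta k⁻¹ = k⁻¹ := by
  rw [inv_eq_transpose_of_mem_G2 hk]
  ext i j
  have := congrFun (congrFun h j) i
  rw [theta_apply] at this ⊢
  rw [Matrix.transpose_apply]
  linear_combination this

theorem mpd_comp {V U : Set (Fin 8 → ℝ)} {φ : (Fin 8 → ℝ) → Mat7} {τ : (Fin 8 → ℝ) → Fin 8 → ℝ}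
    {b : Fin 8 → ℝ} (hV : IsOpen V) (hU : IsOpen U) (hb : b ∈ V) (hτb : τ b ∈ U)
    (hφ : MSmooth φ U) (hτ : ContDiffOn ℝ ∞ τ V) (i : Fin 8) :
    mpd (fun c => φ (τ c)) i b = ∑ k, pd (fun c => τ c k) i b • mpd φ k (τ b) := by
  ext r s
  have hτd : DifferentiableAt ℝ τ b :=
    (hτ.contDiffAt (hV.mem_nhds hb)).differentiableAt (by simp)
  have hd := (hφ.differentiableAt hU hτb r s).hasFDerivAt.comp b hτd.hasFDerivAt
  have hd' : HasFDerivAt (fun c => φ (τ c) r s) _ b := hd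
  rw [mpd, Matrix.of_apply, pd, hd'.fderiv, ContinuousLinearMap.comp_apply]
  have e : fderiv ℝ τ b (Pi.single i 1) =
      ∑ k, pd (fun c => τ c k) i b • (Pi.single k 1 : Fin 8 → ℝ) := by
    ext k
    have hk := ((hasFDerivAt_apply (𝕜 := ℝ) k (τ b)).comp b hτd.hasFDerivAt)
    have hk' : HasFDerivAt (fun c => τ c k) _ b := hk
    simp [pd, hk'.fderiv, Finset.sum_apply, Pi.single_apply]
  rw [e]
  simp [Matrix.sum_apply, mpd, pd]

/-- The lifts differ by κ in the stabilizer: ψ = (φ∘τ)κ. Then ψ⁻¹dψ = κ⁻¹(τ*(φ⁻¹dφ))κ + κ⁻¹dκ, where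
the last term is even and conjugation by κ commutes with the odd part and preserves the trace form.
-/
theorem inducedMetric_comp {U V : Set (Fin 8 → ℝ)} {φ ψ : (Fin 8 → ℝ) → Mat7}
    (hφ : IsLocalParam U φ) (hψ : IsLocalParam V ψ) {τ : (Fin 8 → ℝ) → Fin 8 → ℝ}
    (hτ : ContDiffOn ℝ ∞ τ V) (hm : Set.MapsTo τ V U)
    (h : ∀ b ∈ V, orbitPoint (ψ b) = orbitPoint (φ (τ b))) {b : Fin 8 → ℝ} (hb : b ∈ V)
    (i j : Fin 8) : inducedMetric ψ b i j =
      ∑ k, ∑ l, pd (fun c => τ c k) i b * pd (fun c => τ c l) j b *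
        inducedMetric φ (τ b) k l := by
  -- The transpose replaces the inverse, with which it agrees on G₂, so that smoothness of κ is
  -- immediate.
  obtain ⟨κ, hκ⟩ : ∃ κ : (Fin 8 → ℝ) → Mat7, κ = fun c => (φ (τ c))ᵀ * ψ c := ⟨_, rfl⟩
  have hφτ : MSmooth (fun c => φ (τ c)) V := fun r s => (hφ.smooth r s).comp hτ hm
  have hκs : MSmooth κ V := by
    rw [hκ]
    exact hφτ.transpose.mul hψ.smooth
  have hκ' : ∀ c ∈ V, κ c = (φ (τ c))⁻¹ * ψ c := fun c hc => by
    rw [hκ, inv_eq_transpose_of_mem_G2 (hφ.mem _ (hm hc))]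
  have hκG : ∀ c ∈ V, κ c ∈ G2 := fun c hc => by
    rw [hκ' c hc]
    exact mul_mem_G2 (inv_mem_G2 (hφ.mem _ (hm hc))) (hψ.mem c hc)
  have hκθ : ∀ c ∈ V, theta (κ c) = κ c := fun c hc =>
    theta_of_stabilizer (hκG c hc) (by
      rw [hκ' c hc]
      exact orbitPoint_inv_mul_eq (hφ.mem _ (hm hc)) (h c hc))
  have hψκ : ∀ c ∈ V, ψ c = φ (τ c) * κ c := fun c hc => by
    rw [hκ' c hc, ← mul_assoc, mul_inv_self_of_mem_G2 (hφ.mem _ (hm hc)), one_mul]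
  have hκi := theta_inv (hκG b hb) (hκθ b hb)
  have hc : ∀ i, hPart ψ i b = (κ b)⁻¹ *
      (∑ k, pd (fun c => τ c k) i b • hPart φ k (τ b)) * κ b := by
    intro i
    have e1 : current ψ i b = (κ b)⁻¹ * current (fun c => φ (τ c)) i b * κ b +
        current κ i b := by
      rw [← current_mul hψ.isOpen hb hφτ hκs (hφ.mem _ (hm hb)), current_eq, current_eq,
        mpd_congr hψ.isOpen hb hψκ, hψκ b hb]
    have e2 : current (fun c => φ (τ c)) i b =
        ∑ k, pd (fun c => τ c k) i b • current φ k (τ b) := by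
      rw [current_eq, mpd_comp hψ.isOpen hφ.isOpen hb (hm hb) hφ.smooth hτ, Finset.mul_sum]
      exact Finset.sum_congr rfl fun k _ => by rw [mul_smul_comm, current_eq]
    have e3 : theta (current κ i b) = current κ i b := by
      rw [current_eq, theta_mul, hκi, ← mpd_theta hψ.isOpen hb hκs,
        mpd_congr hψ.isOpen hb hκθ]
    have e4 : oddPart ((κ b)⁻¹ * current (fun c => φ (τ c)) i b * κ b) =
        (κ b)⁻¹ * oddPart (current (fun c => φ (τ c)) i b) * κ b := by
      rw [oddPart, oddPart, theta_mul, theta_mul, hκi, hκθ b hb, mul_smul_comm, smul_mul_assoc,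
        mul_sub, sub_mul]
    have e5 : ∀ X Y : Mat7, theta Y = Y → oddPart (X + Y) = oddPart X := by
      intro X Y hY
      rw [oddPart, oddPart, theta_add, hY, add_sub_add_right_eq_sub]
    change oddPart (current ψ i b) = _
    rw [e1, e5 _ _ e3, e4, e2, oddPart_sum_smul]
    rfl
  rw [hψ.inducedMetric_eq hb, hc, hc, trForm_conj (inv_mul_self_of_mem_G2 (hκG b hb))]
  simp only [trForm_sum_left, trForm_sum_right, trForm_smul_left, trForm_smul_right,
    hφ.inducedMetric_eq (hm hb), Finset.mul_sum]
  rw [Finset.sum_comm]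
  exact Finset.sum_congr rfl fun k _ => Finset.sum_congr rfl fun l _ => by ring

end G2Quat

/-! ### The theorem, assembled -/

theorem mainTheorem4 :
    -- The variety of quaternionic subalgebras is `G₂ / SO(4)`.
    (∀ Q : Set G2Quat.Octonion,
      G2Quat.IsQuaternionicSubalgebra Q ↔ ∃ g ∈ G2Quat.G2, G2Quat.orbitPoint g = Q) ∧
    (∀ F : G2Quat.Octonion → G2Quat.Octonion,
      (∃ g ∈ G2Quat.G2, G2Quat.orbitPoint g = G2Quat.canonicalH ∧ G2Quat.autAct g = F) ↔
        ∃ a b : Quaternion ℝ, ‖a‖ = 1 ∧ ‖b‖ = 1 ∧ F = G2Quat.gammaMap a b) ∧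
    -- The reductive splitting, and the generators as an orthonormal basis adapted to it.
    IsCompl G2Quat.so4 G2Quat.mm ∧
    (∀ X ∈ G2Quat.so4, ∀ Y ∈ G2Quat.so4, ⁅X, Y⁆ ∈ G2Quat.so4) ∧
    (∀ X ∈ G2Quat.so4, ∀ Y ∈ G2Quat.mm, ⁅X, Y⁆ ∈ G2Quat.mm) ∧
    (∀ X ∈ G2Quat.mm, ∀ Y ∈ G2Quat.mm, ⁅X, Y⁆ ∈ G2Quat.so4) ∧
    G2Quat.so4.map (G2Quat.g2.incl : G2Quat.g2 →ₗ[ℝ] G2Quat.Mat7) =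
      Submodule.span ℝ (G2Quat.genC '' G2Quat.latin) ∧
    G2Quat.mm.map (G2Quat.g2.incl : G2Quat.g2 →ₗ[ℝ] G2Quat.Mat7) =
      Submodule.span ℝ (G2Quat.genC '' G2Quat.greek) ∧
    (∀ I ∈ G2Quat.latin ∪ G2Quat.greek, ∀ J ∈ G2Quat.latin ∪ G2Quat.greek,
      ∀ X Y : G2Quat.g2, (X : G2Quat.Mat7) = G2Quat.genC I → (Y : G2Quat.Mat7) = G2Quat.genC J →
        G2Quat.invInner X Y = if I = J then 1 else 0) ∧
    -- Local parametrizations cover the variety, and the induced metric does not depend on them.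
    (∀ Q : Set G2Quat.Octonion, G2Quat.IsQuaternionicSubalgebra Q →
      ∃ U φ, G2Quat.IsLocalParam U φ ∧ ∃ a ∈ U, G2Quat.orbitPoint (φ a) = Q) ∧
    (∀ U φ V ψ, G2Quat.IsLocalParam U φ → G2Quat.IsLocalParam V ψ →
      ∀ τ : (Fin 8 → ℝ) → (Fin 8 → ℝ), ContDiffOn ℝ (⊤ : ℕ∞) τ V → Set.MapsTo τ V U →
        (∀ b ∈ V, G2Quat.orbitPoint (ψ b) = G2Quat.orbitPoint (φ (τ b))) →
        ∀ b ∈ V, ∀ i j, G2Quat.inducedMetric ψ b i j =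
          ∑ k, ∑ l, G2Quat.pd (fun c => τ c k) i b * G2Quat.pd (fun c => τ c l) j b *
            G2Quat.inducedMetric φ (τ b) k l) ∧
    -- The explicit coordinates and the explicit metric.
    G2Quat.IsLocalParam G2Quat.chartDomain G2Quat.hElt ∧
    (∀ a v : Fin 8 → ℝ,
      ∑ i, ∑ j, G2Quat.inducedMetric G2Quat.hElt a i j * v i * v j =
        G2Quat.explicitMetric a v) ∧
    -- The induced metric is a smooth Riemannian metric, its curvature is given by the structure
    -- constants, and its Ricci tensor is `8` times the metric.
    (∀ U φ, G2Quat.IsLocalParam U φ →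
      (∀ i j, ContDiffOn ℝ (⊤ : ℕ∞) (fun a => G2Quat.inducedMetric φ a i j) U) ∧
      ∀ a ∈ U,
        (∀ i, G2Quat.current φ i a ∈ G2Quat.g2) ∧
        (G2Quat.inducedMetric φ a).PosDef ∧
        (∀ l i j, ∑ k, G2Quat.riemann (G2Quat.inducedMetric φ) k l i j a • G2Quat.achtBein φ k a =
          -⁅⁅G2Quat.achtBein φ i a, G2Quat.achtBein φ j a⁆, G2Quat.achtBein φ l a⁆) ∧
        G2Quat.ricci (G2Quat.inducedMetric φ) a = (8 : ℝ) • G2Quat.inducedMetric φ a) := by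
  refine ⟨G2Quat.isQuaternionicSubalgebra_iff, G2Quat.stabilizer_canonicalH_iff,
    G2Quat.isCompl_so4_mm, G2Quat.lie_mem_so4_of_so4, G2Quat.lie_mem_mm,
    G2Quat.lie_mem_so4_of_mm, G2Quat.so4_map_incl, G2Quat.mm_map_incl,
    G2Quat.invInner_generators, G2Quat.exists_isLocalParam, ?_, G2Quat.isLocalParam_hElt,
    G2Quat.sum_inducedMetric_hElt, fun U φ h => ⟨h.contDiffOn_inducedMetric, fun a ha =>
      ⟨h.current_mem ha, h.posDef_inducedMetric ha, h.sum_riemann_smul_achtBein ha,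
        h.ricci_inducedMetric ha⟩⟩⟩
  intro U φ V ψ hφ hψ τ hτ hm h b hb i j
  exact G2Quat.inducedMetric_comp hφ hψ hτ hm h hb i j
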